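/- **Setting.** All algorithms are polynomial-time uniform families of circuits: Boolean circuits with uniformly random coins for classical (probabilistic) algorithms, and circuits of Hadamard, $\pi/8$, NOT, CNOT and Toffoli gates with ancillas and measurements for BQP machines. Write $\lambda$ for the security parameter. A function $\nu:\mathbb N\to\mathbb R$ is negligible if $p(\lambda)\nu(\lambda)\to0$ for every polynomial $p$. Let $\mathrm{HE}=(\mathrm{KeyGen},\mathrm{Enc},\mathrm{Dec},\mathrm{Eval})$ be a compact leveled public-key bit encryption scheme, with $(pk,evk,sk,t_{sk})\leftarrow\mathrm{KeyGen}(1^\lambda,1^{L})$, where $t_{sk}$ is trapdoor information and $\mathrm{Dec}$ is deterministic. Let $L_c=L_c(\lambda)$ be computable in polynomial time (from and into unary). Let $C_{\mathrm{HE}}$ be the set of all possible ciphertexts $\mathrm{Eval}_{evk}(f,\mathrm{Enc}_{pk}(\mu_1),\dots,\mathrm{Enc}_{pk}(\mu_l))$ with $f$ a Boolean (NAND) circuit of depth at most $L_c$, $l\ge1$ and $\mu_j\in\{0,1\}$. Assume the following. 1. *$\mathrm{HE}$ is homomorphic for depth $L_c$*: for all but a negligible fraction of the outputs of $\mathrm{KeyGen}(1^\lambda,1^{L_c})$,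 with all but negligible probability (uniformly in $\mu$, $f$ and $c_1,\dots,c_l$), $\mathrm{Dec}_{sk}(\mathrm{Enc}_{pk}(\mu))=\mu$, and $\mathrm{Dec}_{sk}(\mathrm{Eval}_{evk}(f,c_1,\dots,c_l))=f(\mathrm{Dec}_{sk}(c_1),\dots,\mathrm{Dec}_{sk}(c_l))$ for fresh encryptions $c_j$ and $f$ of depth at most $L_c$. 2. *$\mathrm{HE}$ is quantum capable for depth $L_c$*: there are an encryption scheme $\mathrm{AltHE}$ with the same keys, a distribution $D$ (which may depend on $pk$) on pairs $(\mu,r)$ of a bit and an encryption randomness (a bit string), and efficient algorithms $\mathrm{Convert}$, $\oplus_H$, inversion of $\oplus_H$ (all given $pk$) and randomness recovery (given $pk,sk,t_{sk}$) such that, for all but a negligible fraction of the keys, the following holds with bounds that are uniform in $c\in C_{\mathrm{HE}}$, writing $\hat c=\mathrm{Convert}(c)$: (a) $\mathrm{AltHE.Dec}_{sk}(\hat c)=\mathrm{Dec}_{sk}(c)$; (b) for $(\mu,r)\leftarrow D$, with all but negligible probability, $\mathrm{AltHE.Dec}_{sk}(\mathrm{AltHE.Enc}_{pk}(\mu;r))=\mu$,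 $(\mu,r)$ is recovered from $\mathrm{AltHE.Enc}_{pk}(\mu;r)$, and $\mathrm{AltHE.Dec}_{sk}(\mathrm{AltHE.Enc}_{pk}(\mu;r)\oplus_H\hat c)=\mathrm{AltHE.Dec}_{sk}(\mathrm{AltHE.Enc}_{pk}(\mu;r))\oplus\mathrm{AltHE.Dec}_{sk}(\hat c)$; (c) for all $(\mu,r)$ in the support of $D$, inversion of $\oplus_H$ finds $\mathrm{AltHE.Enc}_{pk}(\mu;r)$ from $\mathrm{AltHE.Enc}_{pk}(\mu;r)\oplus_H\hat c$ and $\hat c$; (d) the Hellinger distance $1-\sum_y\sqrt{P(y)P'(y)}$ of the laws $P,P'$ of $\mathrm{AltHE.Enc}_{pk}(\mu;r)$ and $\mathrm{AltHE.Enc}_{pk}(\mu;r)\oplus_H\hat c$, where $(\mu,r)\leftarrow D$, is negligible; (e) a BQP machine can create from $pk$ the state $\sum_{\mu,r}\sqrt{D(\mu,r)}\,|\mu,r\rangle$ up to negligible trace distance. 3. *$L_c$ is at least the depth of a Pauli key update*: each bit of the following function is computed by uniform Boolean circuits of depth at most $L_c$. On input $pk,sk,t_{sk}$, four ciphertexts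 under $pk$ decrypting to $z_1,z_2,x_1,x_2$, two ciphertexts $\hat c,y$ of $\mathrm{AltHE}$ and a string $d$, the function recovers $(\mu_0,r_0)$ from $y$, inverts $\oplus_H$ at $(y,\hat c)$ and recovers $(\mu_1,r_1)$ from the result, and outputs $z_1\oplus d\cdot((\mu_0,r_0)\oplus(\mu_1,r_1)),\ z_2,\ x_1,\ x_2\oplus\mu_0$. The key generation of $\mathrm{QHE}$ with $\ell$ levels draws independent keys $(pk_i,evk_i,sk_i,t_{sk_i})\leftarrow\mathrm{KeyGen}(1^\lambda,1^{L_c})$ for $1\le i\le\ell+1$. The public key is $pk_1$, and the evaluation key consists of $evk_1,\dots,evk_{\ell+1}$ and of $pk_{i+1}$, $\mathrm{Enc}_{pk_{i+1}}(sk_i)$, $\mathrm{Enc}_{pk_{i+1}}(t_{sk_i})$ (bit by bit) for $1\le i\le\ell$. **Claim.** There are a BQP machine $M$, depending on $1^\lambda,1^\ell,1^i$, and a negligible function $\nu$ such that for all $\lambda$, $\ell$ and $1\le i\le\ell$ the following holds with probability at least $1-\nu(\lambda)$ over the key generation of $\mathrm{QHE}$. For all $s\in\{0,1\}$, $z,x\in\{0,1\}^2$,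 all two-qubit states $|\psi\rangle$, all ciphertexts $c\in C_{\mathrm{HE}}$ under the keys of level $i$ with $\mathrm{Dec}_{sk_i}(c)=s$, and all ciphertexts $c_{z,x}$ that decrypt under $sk_i$ to $z_1,z_2,x_1,x_2$: on input the two-qubit state $Z^zX^x|\psi\rangle$ and the classical strings $pk_1$, the evaluation key, $c$ and $c_{z,x}$, the machine $M$ outputs four ciphertexts $o$ and a state of two qubits such that * every $o$ that occurs with positive probability consists of ciphertexts in $C_{\mathrm{HE}}$ under the keys of level $i+1$, which decrypt under $sk_{i+1}$ to the bits of some $z'=z'(o),x'=x'(o)\in\{0,1\}^2$; * the joint state of $o$ and the two qubits is within trace distance $\nu(\lambda)$ of the ideal state $$\sum_o\Pr[o]\;|o\rangle\langle o|\otimes \mathrm{CNOT}_{1,2}^s\,Z^{z'}X^{x'}|\psi\rangle\langle\psi|\,(Z^{z'}X^{x'})^\dagger(\mathrm{CNOT}_{1,2}^s)^\dagger .$$ -/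

import Mathlib

namespace QHom

/-- Bit strings of length `n`. -/
abbrev Bits (n : ℕ) : Type := Fin n → Bool

/-! ### Unary polynomial time -/

/-- Programs computing functions of `k` natural numbers (given in unary): the elementary operations
are zero, successor and projection; programs are combined by composition and by a counted loop. -/
inductive Prog : ℕ → Type
  | zero {k : ℕ} : Prog k
  | succ : Prog 1
  | proj {k : ℕ} (i : Fin k) : Prog k
  | comp {m k : ℕ} (f : Prog m) (g : Fin m → Prog k) : Prog k
  | loop {k : ℕ} (f : Prog k) (g : Prog (k + 2)) : Prog (k + 1)

/-- The value computed by a program. `loop f g` starts from the value of `f` and applies `g` to the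
loop counter, the current value and the remaining arguments, as often as its first argument says. -/
def Prog.eval : {k : ℕ} → Prog k → (Fin k → ℕ) → ℕ
  | _, .zero, _ => 0
  | _, .succ, v => v 0 + 1
  | _, .proj i, v => v i
  | _, .comp f g, v => f.eval fun i => (g i).eval v
  | _, .loop f g, v =>
      Nat.rec (f.eval (Fin.tail v)) (fun y a => g.eval (Fin.cons y (Fin.cons a (Fin.tail v)))) (v 0)

/-- The number of elementary steps a program makes. A step increases numbers by at most one, so
that programs making polynomially many steps only handle numbers of polynomial size. -/
def Prog.steps : {k : ℕ} → Prog k → (Fin k → ℕ) → ℕ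
  | _, .zero, _ => 1
  | _, .succ, _ => 1
  | _, .proj _, _ => 1
  | _, .comp f g, v => 1 + (∑ i, (g i).steps v) + f.steps fun i => (g i).eval v
  | _, .loop f g, v =>
      1 + f.steps (Fin.tail v) + ∑ y ∈ Finset.range (v 0),
        (1 + g.steps (Fin.cons y (Fin.cons
          (Prog.eval (.loop f g) (Fin.cons y (Fin.tail v))) (Fin.tail v))))

/-- `f` is computed by a program in time polynomial in its arguments (which are thus read in unary,
like `1^λ`). Functions computable in logarithmic space from unary inputs have this property, and
functions with this property are computable in polynomial time from unary inputs. -/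
def PolyTime {k : ℕ} (f : (Fin k → ℕ) → ℕ) : Prop :=
  ∃ (P : Prog k) (e : ℕ), ∀ v, P.eval v = f v ∧ P.steps v ≤ (∑ i, v i + 2) ^ e

/-! ### Boolean circuits -/

/-- A Boolean circuit of NAND gates. On `n` inputs, wires `0, …, n - 1` are the inputs and wire
`n + k` is the NAND of the two wires that the `k`-th gate names. The last wires are the outputs. -/
abbrev NandCircuit : Type := List (ℕ × ℕ)

namespace NandCircuit

/-- The values of all wires on the input `x`. Wires that do not exist (yet) read as zero. -/
def wires (C : NandCircuit) (x : List Bool) : List Bool :=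
  C.foldl (fun w g => w ++ [!(w.getD g.1 false && w.getD g.2 false)]) x

/-- The values of the last `m` wires. -/
def out (C : NandCircuit) (m : ℕ) (x : List Bool) : Bits m :=
  fun j => (C.wires x).getD ((C.wires x).length - m + j) false

/-- The value of the last wire. -/
def outBit (C : NandCircuit) (x : List Bool) : Bool := C.out 1 x 0

/-- The depths of all wires, when there are `n` inputs. -/
def wireDepths (C : NandCircuit) (n : ℕ) : List ℕ :=
  C.foldl (fun d g => d ++ [max (d.getD g.1 0) (d.getD g.2 0) + 1]) (List.replicate n 0)

/-- The depth of a circuit with `n` inputs. -/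
def depth (C : NandCircuit) (n : ℕ) : ℕ := (C.wireDepths n).foldr max 0

/-- Every gate refers to inputs or to earlier gates. -/
def WellFormed (C : NandCircuit) (n : ℕ) : Prop :=
  ∀ (k : ℕ) (h : k < C.length), C[k].1 < n + k ∧ C[k].2 < n + k

/-- The description of a circuit with `n` inputs as a bit string: for every gate, the indicator
vectors (among all wires) of its two arguments. -/
def code (C : NandCircuit) (n : ℕ) : List Bool :=
  C.flatMap fun g =>
    (List.range (n + C.length)).map (fun w => decide (w = g.1)) ++
    (List.range (n + C.length)).map (fun w => decide (w = g.2))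

/-- A polynomial-time uniform family of circuits, indexed by natural numbers in unary: the number of
gates and the wires of the `j`-th gate are computable in polynomial time. -/
def Uniform {k : ℕ} (C : (Fin k → ℕ) → NandCircuit) : Prop :=
  PolyTime (fun v => (C v).length) ∧
  PolyTime (fun v : Fin (k + 1) → ℕ => ((C (Fin.tail v)).getD (v 0) (0, 0)).1) ∧
  PolyTime (fun v : Fin (k + 1) → ℕ => ((C (Fin.tail v)).getD (v 0) (0, 0)).2)

end NandCircuit

/-! ### Quantum circuits -/

/-- The bit in position `q`, zero if there is none. -/
def getBit {w : ℕ} (b : Bits w) (q : ℕ) : Bool := if h : q < w then b ⟨q, h⟩ else false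

def setBit {w : ℕ} (b : Bits w) (q : ℕ) (v : Bool) : Bits w :=
  fun j => if (j : ℕ) = q then v else b j

def flipBit {w : ℕ} (b : Bits w) (q : ℕ) : Bits w := setBit b q (!(getBit b q))

/-- The `len` bits from position `off` on. -/
def readBits {w : ℕ} (b : Bits w) (off len : ℕ) : Bits len := fun j => getBit b (off + j)

/-- Gates: Hadamard, `π/8`-phase gate, NOT, CNOT and Toffoli; the target is the last argument. -/
inductive QGate : Type
  | h (q : ℕ)
  | t (q : ℕ)
  | x (q : ℕ)
  | cx (p q : ℕ)
  | ccx (p q r : ℕ)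

/-- The number of the gate type and the qubits the gate acts on. -/
def QGate.code : QGate → Fin 4 → ℕ
  | .h q => ![0, q, 0, 0]
  | .t q => ![1, q, 0, 0]
  | .x q => ![2, q, 0, 0]
  | .cx p q => ![3, p, q, 0]
  | .ccx p q r => ![4, p, q, r]

/-- The action of a gate on the amplitudes of a state of `w` qubits. Gates whose target does not exist
or is also a control act trivially. -/
noncomputable def QGate.apply {w : ℕ} : QGate → (Bits w → ℂ) → (Bits w → ℂ)
  | .h q, φ => fun b =>
      if q < w then
        ((Real.sqrt 2 : ℝ) : ℂ)⁻¹ *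
          ∑ v : Bool, (if v && getBit b q then -1 else 1) * φ (setBit b q v)
      else φ b
  | .t q, φ => fun b =>
      (if getBit b q then Complex.exp (Complex.I * Real.pi / 4) else 1) * φ b
  | .x q, φ => fun b => φ (flipBit b q)
  | .cx p q, φ => fun b => if p ≠ q ∧ getBit b p = true then φ (flipBit b q) else φ b
  | .ccx p q r, φ => fun b =>
      if p ≠ r ∧ q ≠ r ∧ getBit b p = true ∧ getBit b q = true then φ (flipBit b r) else φ b

/-- A quantum circuit: a number of ancilla qubits (behind the input qubits, initially zero) and a
sequence of gates. -/
structure QCircuit : Type where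
  anc : ℕ
  gates : List QGate

namespace QCircuit

/-- The final state on the input state `φ` of `n` qubits. -/
noncomputable def run (C : QCircuit) {n : ℕ} (φ : Bits n → ℂ) : Bits (n + C.anc) → ℂ :=
  C.gates.foldl (fun χ g => g.apply χ) fun b =>
    if ∀ j : Fin C.anc, b (Fin.natAdd n j) = false then φ fun j => b (Fin.castAdd C.anc j) else 0

/-- A polynomial-time uniform family of quantum circuits (a `BQP` machine). -/
def Uniform {k : ℕ} (C : (Fin k → ℕ) → QCircuit) : Prop :=
  PolyTime (fun v => (C v).anc) ∧
  PolyTime (fun v => (C v).gates.length) ∧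
  ∀ a : Fin 4,
    PolyTime (fun v : Fin (k + 1) → ℕ => ((C (Fin.tail v)).gates.getD (v 0) (.h 0)).code a)

end QCircuit

/-- The standard basis state of a bit string. -/
noncomputable def ket (x : List Bool) : Bits x.length → ℂ :=
  fun b => if b = fun j => x.get j then 1 else 0

/-- A two-qubit state followed by the basis state of a bit string. -/
noncomputable def withInput (ψ : Bits 2 → ℂ) (x : List Bool) : Bits (2 + x.length) → ℂ :=
  fun b => ψ (fun j => b (Fin.castAdd x.length j)) * ket x (fun j => b (Fin.natAdd 2 j))

open Classical in
/-- Measure all qubits but the first `k` in the standard basis. This is the unnormalized density matrix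
of the first `k` qubits for the outcomes in the event `S` (an event about the other qubits); for
the sure event it is the reduced density matrix. -/
noncomputable def reduced {w : ℕ} (k : ℕ) (φ : Bits w → ℂ) (S : Bits w → Prop) :
    Matrix (Bits k) (Bits k) ℂ :=
  fun x y => ∑ b : Bits w, ∑ b' : Bits w,
    if readBits b 0 k = x ∧ readBits b' 0 k = y ∧ (∀ j : Fin w, k ≤ j → b j = b' j) ∧ S b
    then φ b * star (φ b') else 0

/-- The density matrix of a pure state. -/
noncomputable def pure {α : Type} (ψ : α → ℂ) : Matrix α α ℂ := Matrix.vecMulVec ψ (star ψ)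

open Matrix in
/-- Trace distance `½ Tr √((ρ - σ)^* (ρ - σ))`. -/
noncomputable def traceDist {α : Type} [Fintype α] [DecidableEq α] (ρ σ : Matrix α α ℂ) : ℝ :=
  (1 / 2) * (Matrix.trace (cfc Real.sqrt ((ρ - σ)ᴴ * (ρ - σ)))).re

/-- `X^x` on `n` qubits. -/
def pauliX {n : ℕ} (x : Bits n) : Matrix (Bits n) (Bits n) ℂ :=
  fun b b' => if b = (fun j => b' j ^^ x j) then 1 else 0

/-- `Z^z` on `n` qubits. -/
def pauliZ {n : ℕ} (z : Bits n) : Matrix (Bits n) (Bits n) ℂ :=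
  Matrix.diagonal fun b => ∏ j, if z j && b j then -1 else 1

/-- The Pauli operator `Z^z X^x`. -/
def pauli {n : ℕ} (z x : Bits n) : Matrix (Bits n) (Bits n) ℂ := pauliZ z * pauliX x

/-- CNOT with the first qubit as control and the second as target. -/
def cnot : Matrix (Bits 2) (Bits 2) ℂ :=
  fun b b' => if b = ![b' 0, b' 0 ^^ b' 1] then 1 else 0

/-! ### Probability -/

/-- A negligible function: it decays faster than every polynomial. -/
def Negligible (ν : ℕ → ℝ) : Prop :=
  Asymptotics.SuperpolynomialDecay Filter.atTop (fun n : ℕ => (n : ℝ)) ν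

open Classical in
/-- The probability of `P` for a uniformly random element. -/
noncomputable def uprob {α : Type} [Fintype α] (P : α → Prop) : ℝ :=
  ((Finset.univ.filter P).card : ℝ) / Fintype.card α

open Classical in
/-- The probability of `P` under the density `D`. -/
noncomputable def dprob {α : Type} [Fintype α] (D : α → ℝ) (P : α → Prop) : ℝ :=
  ∑ a, if P a then D a else 0

/-- `H² = 1 - ∑ √(p q)`. -/
noncomputable def hellinger {α : Type} [Fintype α] (p q : α → ℝ) : ℝ :=
  1 - ∑ a, Real.sqrt (p a * q a)

/-! ### Leveled homomorphic encryption -/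

/-- Efficiently computable length parameters depending on the security parameter and the depth. -/
def PolyLen (f : ℕ → ℕ → ℕ) : Prop := PolyTime fun v : Fin 2 → ℕ => f (v 0) (v 1)

/-- Efficient algorithms for each security parameter and depth. -/
def Efficient (C : ℕ → ℕ → NandCircuit) : Prop :=
  NandCircuit.Uniform fun v : Fin 2 → ℕ => C (v 0) (v 1)

/-- The algorithms of a compact leveled homomorphic encryption scheme for bits, as functions of
`1^λ` and the depth parameter `1^L`; probabilistic algorithms read a string of uniformly random coins.
Homomorphic evaluation depends on the numbers of inputs and of gates of the circuit to be
evaluated. Key generation also outputs trapdoor information `td`. -/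
structure LeveledScheme where
  pkLen : ℕ → ℕ → ℕ
  evkLen : ℕ → ℕ → ℕ
  skLen : ℕ → ℕ → ℕ
  tdLen : ℕ → ℕ → ℕ
  ctLen : ℕ → ℕ → ℕ
  genCoins : ℕ → ℕ → ℕ
  encCoins : ℕ → ℕ → ℕ
  evalCoins : ℕ → ℕ → ℕ → ℕ → ℕ
  keyGenC : ℕ → ℕ → NandCircuit
  encC : ℕ → ℕ → NandCircuit
  decC : ℕ → ℕ → NandCircuit
  evalC : ℕ → ℕ → ℕ → ℕ → NandCircuit
  pkLen_poly : PolyLen pkLen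
  evkLen_poly : PolyLen evkLen
  skLen_poly : PolyLen skLen
  tdLen_poly : PolyLen tdLen
  ctLen_poly : PolyLen ctLen
  genCoins_poly : PolyLen genCoins
  encCoins_poly : PolyLen encCoins
  evalCoins_poly : PolyTime fun v : Fin 4 → ℕ => evalCoins (v 0) (v 1) (v 2) (v 3)
  keyGenC_eff : Efficient keyGenC
  encC_eff : Efficient encC
  decC_eff : Efficient decC
  evalC_eff : NandCircuit.Uniform fun v : Fin 4 → ℕ => evalC (v 0) (v 1) (v 2) (v 3)

/-- The output of key generation. -/
structure Keys (S : LeveledScheme) (lam L : ℕ) : Type where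
  pk : Bits (S.pkLen lam L)
  evk : Bits (S.evkLen lam L)
  sk : Bits (S.skLen lam L)
  td : Bits (S.tdLen lam L)

namespace LeveledScheme

variable (S : LeveledScheme) {lam L : ℕ}

/-- Key generation. -/
def keyGen (r : Bits (S.genCoins lam L)) : Keys S lam L :=
  let n := S.pkLen lam L + S.evkLen lam L + S.skLen lam L + S.tdLen lam L
  let o : Bits n := (S.keyGenC lam L).out n (List.ofFn r)
  { pk := readBits o 0 _
    evk := readBits o (S.pkLen lam L) _
    sk := readBits o (S.pkLen lam L + S.evkLen lam L) _
    td := readBits o (S.pkLen lam L + S.evkLen lam L + S.skLen lam L) _ }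

/-- Encryption of the bit `μ` with coins `r`. -/
def enc (pk : Bits (S.pkLen lam L)) (μ : Bool) (r : Bits (S.encCoins lam L)) :
    Bits (S.ctLen lam L) :=
  (S.encC lam L).out _ (List.ofFn pk ++ [μ] ++ List.ofFn r)

/-- Decryption. -/
def dec (sk : Bits (S.skLen lam L)) (c : Bits (S.ctLen lam L)) : Bool :=
  (S.decC lam L).outBit (List.ofFn sk ++ List.ofFn c)

/-- Homomorphic evaluation of the circuit `f` with `l` inputs, with coins `r`. -/
def eval (evk : Bits (S.evkLen lam L)) {l : ℕ} (f : NandCircuit) (c : Fin l → Bits (S.ctLen lam L))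
    (r : Bits (S.evalCoins lam L l f.length)) : Bits (S.ctLen lam L) :=
  (S.evalC lam L l f.length).out _
    (List.ofFn evk ++ f.code l ++ (List.ofFn fun j => List.ofFn (c j)).flatten ++ List.ofFn r)

/-- Circuits with `l ≥ 1` input bits and one output bit, of depth at most `L`. -/
def IsDepth (L l : ℕ) (f : NandCircuit) : Prop := 0 < l ∧ f.WellFormed l ∧ f.depth l ≤ L

/-- The ciphertexts which can occur during a computation of depth `L` under the given keys:
results of evaluating circuits of depth at most `L` on fresh encryptions. -/
def Occurs (k : Keys S lam L) (c : Bits (S.ctLen lam L)) : Prop :=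
  ∃ (l : ℕ) (f : NandCircuit) (μ : Fin l → Bool) (r : Fin l → Bits (S.encCoins lam L))
    (r' : Bits (S.evalCoins lam L l f.length)),
    IsDepth L l f ∧ c = S.eval k.evk f (fun j => S.enc k.pk (μ j) (r j)) r'

/-- The keys are correct up to the error `ε`: fresh encryptions decrypt correctly, and evaluation
of circuits of depth at most `L` on fresh encryptions commutes with decryption. -/
def CorrectKeys (k : Keys S lam L) (ε : ℝ) : Prop :=
  (∀ μ : Bool, 1 - ε ≤ uprob fun r : Bits (S.encCoins lam L) => S.dec k.sk (S.enc k.pk μ r) = μ) ∧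
  ∀ (l : ℕ) (f : NandCircuit) (μ : Fin l → Bool) (r : Fin l → Bits (S.encCoins lam L)),
    IsDepth L l f →
    1 - ε ≤ uprob fun r' : Bits (S.evalCoins lam L l f.length) =>
      S.dec k.sk (S.eval k.evk f (fun j => S.enc k.pk (μ j) (r j)) r') =
        f.outBit (List.ofFn fun j => S.dec k.sk (S.enc k.pk (μ j) (r j)))

/-- `S` is a homomorphic encryption scheme for circuits of depth `Lc λ`: with all but negligible
probability, everything works with all but negligible probability. -/
def HomomorphicFor (Lc : ℕ → ℕ) : Prop :=
  ∃ ε : ℕ → ℝ, Negligible ε ∧ ∀ lam : ℕ,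
    1 - ε lam ≤ uprob fun r : Bits (S.genCoins lam (Lc lam)) =>
      S.CorrectKeys (S.keyGen r) (ε lam)

end LeveledScheme

/-! ### Quantum capability -/

/-- The algorithms of the alternative encryption scheme `AltHE`, with the keys of `S`, and those that
connect it to `S`. A string of length `rLen + 1` is a bit `μ` followed by the encryption randomness `r`. -/
structure AltScheme (S : LeveledScheme) where
  ctLen : ℕ → ℕ → ℕ
  rLen : ℕ → ℕ → ℕ
  encC : ℕ → ℕ → NandCircuit
  decC : ℕ → ℕ → NandCircuit
  xorC : ℕ → ℕ → NandCircuit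
  xorInvC : ℕ → ℕ → NandCircuit
  convertC : ℕ → ℕ → NandCircuit
  recoverC : ℕ → ℕ → NandCircuit
  /-- the distribution `D` -/
  D : ∀ lam L : ℕ, Bits (S.pkLen lam L) → Bits (rLen lam L + 1) → ℝ
  /-- the quantum circuits creating the superposition over `D` -/
  prepC : ℕ → ℕ → QCircuit
  D_mem : ∀ lam L pk, D lam L pk ∈ stdSimplex ℝ (Bits (rLen lam L + 1))
  ctLen_poly : PolyLen ctLen
  rLen_poly : PolyLen rLen
  encC_eff : Efficient encC
  decC_eff : Efficient decC
  xorC_eff : Efficient xorC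
  xorInvC_eff : Efficient xorInvC
  convertC_eff : Efficient convertC
  recoverC_eff : Efficient recoverC
  prepC_eff : QCircuit.Uniform fun v : Fin 2 → ℕ => prepC (v 0) (v 1)

namespace AltScheme

variable {S : LeveledScheme} (A : AltScheme S) {lam L : ℕ}

/-- `AltHE.Enc_pk(μ; r)`. -/
def enc (pk : Bits (S.pkLen lam L)) (m : Bits (A.rLen lam L + 1)) : Bits (A.ctLen lam L) :=
  (A.encC lam L).out _ (List.ofFn pk ++ List.ofFn m)

/-- `AltHE.Dec_sk`. -/
def dec (sk : Bits (S.skLen lam L)) (c : Bits (A.ctLen lam L)) : Bool :=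
  (A.decC lam L).outBit (List.ofFn sk ++ List.ofFn c)

/-- The homomorphic XOR `c₁ ⊕_H c₂`. -/
def hxor (pk : Bits (S.pkLen lam L)) (c₁ c₂ : Bits (A.ctLen lam L)) : Bits (A.ctLen lam L) :=
  (A.xorC lam L).out _ (List.ofFn pk ++ List.ofFn c₁ ++ List.ofFn c₂)

/-- The inversion of the homomorphic XOR: given `c₁ ⊕_H c₂` and `c₂`, find `c₁`. -/
def hxorInv (pk : Bits (S.pkLen lam L)) (c c₂ : Bits (A.ctLen lam L)) : Bits (A.ctLen lam L) :=
  (A.xorInvC lam L).out _ (List.ofFn pk ++ List.ofFn c ++ List.ofFn c₂)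

/-- `HE.Convert`. -/
def convert (pk : Bits (S.pkLen lam L)) (c : Bits (S.ctLen lam L)) : Bits (A.ctLen lam L) :=
  (A.convertC lam L).out _ (List.ofFn pk ++ List.ofFn c)

/-- Recovery of `(μ, r)` from `AltHE.Enc_pk(μ; r)` with the secret key and the trapdoor. -/
def recover (pk : Bits (S.pkLen lam L)) (sk : Bits (S.skLen lam L)) (td : Bits (S.tdLen lam L))
    (y : Bits (A.ctLen lam L)) : Bits (A.rLen lam L + 1) :=
  (A.recoverC lam L).out _ (List.ofFn pk ++ List.ofFn sk ++ List.ofFn td ++ List.ofFn y)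

/-- The requirements of quantum capability under the given keys, up to the error `ε`. -/
structure CapableKeys (k : Keys S lam L) (ε : ℝ) : Prop where
  /-- the superposition `∑ √(D(μ,r)) |μ,r⟩` can be created from the public key -/
  prep : traceDist
      (reduced (A.rLen lam L + 1) ((A.prepC lam L).run (ket (List.ofFn k.pk))) fun _ => True)
      (pure fun m => (Real.sqrt (A.D lam L k.pk m) : ℂ)) ≤ ε
  /-- encryptions with randomness from `D` decrypt correctly -/
  dec_enc : 1 - ε ≤ dprob (A.D lam L k.pk) fun m => A.dec k.sk (A.enc k.pk m) = m 0
  /-- message and randomness can be recovered from encryptions with randomness from `D` -/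
  recover_enc : 1 - ε ≤ dprob (A.D lam L k.pk) fun m =>
    A.recover k.pk k.sk k.td (A.enc k.pk m) = m
  /-- conversion keeps the encrypted value -/
  convert_dec : ∀ c, S.Occurs k c → A.dec k.sk (A.convert k.pk c) = S.dec k.sk c
  /-- the XOR is homomorphic -/
  hxor_dec : ∀ c, S.Occurs k c → 1 - ε ≤ dprob (A.D lam L k.pk) fun m =>
    A.dec k.sk (A.hxor k.pk (A.enc k.pk m) (A.convert k.pk c)) =
      (A.dec k.sk (A.enc k.pk m) ^^ A.dec k.sk (A.convert k.pk c))
  /-- the XOR is invertible -/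
  hxor_inv : ∀ c, S.Occurs k c → ∀ m, A.D lam L k.pk m ≠ 0 →
    A.hxorInv k.pk (A.hxor k.pk (A.enc k.pk m) (A.convert k.pk c)) (A.convert k.pk c) =
      A.enc k.pk m
  /-- encryptions from `D` hardly change under a homomorphic shift by a converted ciphertext -/
  shift : ∀ c, S.Occurs k c → hellinger
    (fun y => dprob (A.D lam L k.pk) fun m => A.enc k.pk m = y)
    (fun y => dprob (A.D lam L k.pk) fun m =>
      A.hxor k.pk (A.enc k.pk m) (A.convert k.pk c) = y) ≤ ε

/-- `S` is quantum capable for depth `Lc λ`, with `A` as alternative encryption scheme. -/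
def QuantumCapableFor (Lc : ℕ → ℕ) : Prop :=
  ∃ ε : ℕ → ℝ, Negligible ε ∧ ∀ lam : ℕ,
    1 - ε lam ≤ uprob fun r : Bits (S.genCoins lam (Lc lam)) =>
      A.CapableKeys (S.keyGen r) (ε lam)

/-- The inner product modulo 2. -/
def dot {n : ℕ} (d m : Bits n) : Bool :=
  decide (Odd (Finset.univ.filter fun j => (d j && m j) = true).card)

/-- The update of the Pauli keys `(z₁, z₂, x₁, x₂)`, given encryptions `c` of the old keys, the
converted control ciphertext `chat` and the measurement results `y`, `d`: decrypt `c`, recover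
`(μ₀,r₀)` and `(μ₁,r₁)` from `y` and from `y` shifted by `chat`, and add `d·((μ₀,r₀) ⊕ (μ₁,r₁))` to
`z₁` and `μ₀` to `x₂`. -/
def pauliUpdate (pk : Bits (S.pkLen lam L)) (sk : Bits (S.skLen lam L)) (td : Bits (S.tdLen lam L))
    (c : Fin 4 → Bits (S.ctLen lam L)) (chat y : Bits (A.ctLen lam L))
    (d : Bits (A.rLen lam L + 1)) : Fin 4 → Bool :=
  let m₀ := A.recover pk sk td y
  let m₁ := A.recover pk sk td (A.hxorInv pk y chat)
  ![S.dec sk (c 0) ^^ dot d (fun j => m₀ j ^^ m₁ j), S.dec sk (c 1),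
    S.dec sk (c 2), S.dec sk (c 3) ^^ m₀ 0]

/-- The number of input bits of the Pauli key update. -/
def updateInputs (lam L : ℕ) : ℕ :=
  S.pkLen lam L + S.skLen lam L + S.tdLen lam L + 4 * S.ctLen lam L +
    A.ctLen lam L + A.ctLen lam L + (A.rLen lam L + 1)

/-- Each bit of the Pauli key update is computed by uniform Boolean circuits of depth at most `Lc λ`. -/
def UpdateInDepth (Lc : ℕ → ℕ) : Prop :=
  ∀ a : Fin 4, ∃ U : ℕ → NandCircuit,
    NandCircuit.Uniform (fun v : Fin 1 → ℕ => U (v 0)) ∧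
    ∀ lam : ℕ,
      LeveledScheme.IsDepth (Lc lam) (A.updateInputs lam (Lc lam)) (U lam) ∧
      ∀ (pk : Bits (S.pkLen lam (Lc lam))) (sk : Bits (S.skLen lam (Lc lam)))
        (td : Bits (S.tdLen lam (Lc lam))) (c : Fin 4 → Bits (S.ctLen lam (Lc lam)))
        (chat y : Bits (A.ctLen lam (Lc lam))) (d : Bits (A.rLen lam (Lc lam) + 1)),
        (U lam).outBit (List.ofFn pk ++ List.ofFn sk ++ List.ofFn td ++
            (List.ofFn fun j => List.ofFn (c j)).flatten ++
            List.ofFn chat ++ List.ofFn y ++ List.ofFn d) =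
          A.pauliUpdate pk sk td c chat y d a

end AltScheme

/-! ### Keys of the quantum scheme -/

/-- The coins of the key generation of `QHE` with `ℓ` levels: those of `ℓ + 1` independent key
generations of `S`, and those for encrypting the bits of the secret key and of the trapdoor of each
of the first `ℓ` levels under the public key of the next level. -/
abbrev QCoins (S : LeveledScheme) (lam L ℓ : ℕ) : Type :=
  (Fin (ℓ + 1) → Bits (S.genCoins lam L)) ×
  (Fin ℓ → Fin (S.skLen lam L) → Bits (S.encCoins lam L)) ×
  (Fin ℓ → Fin (S.tdLen lam L) → Bits (S.encCoins lam L))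

namespace QCoins

variable {S : LeveledScheme} {lam L ℓ : ℕ}

/-- The keys of level `i`. -/
def keys (ω : QCoins S lam L ℓ) (i : Fin (ℓ + 1)) : Keys S lam L := S.keyGen (ω.1 i)

/-- The public key of `QHE`: that of the first level. -/
def pk (ω : QCoins S lam L ℓ) : List Bool := List.ofFn (ω.keys 0).pk

/-- The evaluation key of `QHE`: the evaluation keys of all levels and, for each level but the last, the
next public key with encryptions under it of the secret key and the trapdoor of the level. -/
def evk (ω : QCoins S lam L ℓ) : List Bool :=
  (List.ofFn fun i : Fin (ℓ + 1) => List.ofFn (ω.keys i).evk).flatten ++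
  (List.ofFn fun i : Fin ℓ =>
    List.ofFn (ω.keys i.succ).pk ++
    (List.ofFn fun j => List.ofFn
      (S.enc (ω.keys i.succ).pk ((ω.keys i.castSucc).sk j) (ω.2.1 i j))).flatten ++
    (List.ofFn fun j => List.ofFn
      (S.enc (ω.keys i.succ).pk ((ω.keys i.castSucc).td j) (ω.2.2 i j))).flatten).flatten

end QCoins

/-- Four ciphertexts (encrypting Pauli keys `z₁, z₂, x₁, x₂`). -/
abbrev KeyCts (S : LeveledScheme) (lam L : ℕ) : Type := Fin 4 → Bits (S.ctLen lam L)

/-- The unnormalized density matrix of the first two qubits, given that the measurement of the following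
qubits results in the ciphertexts `o`. -/
noncomputable def outState {S : LeveledScheme} {lam L w : ℕ} (φ : Bits w → ℂ) (o : KeyCts S lam L) :
    Matrix (Bits 2) (Bits 2) ℂ :=
  reduced 2 φ fun b => o = fun j : Fin 4 => readBits b (2 + j * S.ctLen lam L) (S.ctLen lam L)

end QHom

open QHom

/-!
A gate `CNOT^s`, where only an encryption `c` of `s` is known, is applied by a measurement. For a
fixed key, there are two ways to encrypt a message `m = (μ, r)`: by `AltHE`, or by `AltHE` followed by
the homomorphic addition of the converted ciphertext `ĉ`, which shifts the encrypted bit by `s`. The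
machine prepares the superposition of all messages with the amplitudes `√D(m)`, computes the
ciphertext `y` of `m` in the way that the first qubit says, adds the bit `μ` to the second qubit, and
measures `y`. As the laws of `y` for the two ways are close in the Hellinger distance, `y` hardly
reveals the first qubit: after the measurement, the message register holds one of the two preimages
`m₀`, `m₁` of `y`, according to the first qubit, with nearly the same amplitude for both
(`sum_amp_sub_le`). Their bits differ by `s`, so the second qubit has been changed by `CNOT^s` and an
`X^μ₀`. A measurement of the message register in the Hadamard basis, with result `d`, erases the
message and leaves the sign `Z^(d · (m₀ ⊕ m₁))` on the first qubit
(`hadamard_mul_pauli_xorSecond`). The new Pauli keys are what the Pauli key update computes from `y`,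
`d` and the secret key and trapdoor. The machine cannot compute them, but it evaluates the update
homomorphically under the keys of the next level, on fresh encryptions of what it knows and on the
encryptions of the secret key and trapdoor in the evaluation key.

The quantitative form of this argument is `traceDist_encryptedCnot_le`. The actual amplitudes are
compared in the Euclidean norm with those of an ideal state: the prepared state is close to a product
(`exists_product_approx`), correctness and the Hellinger distance give a common amplitude for both
preimages, and the Hadamard transform keeps distances. The bound passes to the mixture of all outcomes
by `traceDist_blockDiagonal_le`, and the rare failures of the evaluation are part of
`traceDist_postprocess_le`.

The machine is an explicit circuit (`Parts.machine`). Its classical steps are lists of Toffoli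
gates, which evaluate NAND circuits gate by gate on qubits that are initially one, so that they map
basis states to basis states. Since the workspace of the controlled encryption depends on the
message, it is uncomputed (`runT_controlProg`). Everything after the Hadamard transforms is a
reversible program that does not use the two qubits and whose workspace is traced out, so that it
only sorts the terms of the reduced density matrix by the outcome, and the measurements of `y` and `d`
need no gates of their own (`reduced_toffoli_mem`, `reduced_machine`). The coins of the encryptions
and evaluations come from Hadamard gates. Uniformity holds because the positions of all registers
and the gates at all positions are given by functions computable in unary polynomial time
(`Parts.Uniform.machine`).

For good keys, the results decrypt to the updated Pauli keys except with probability `(l + 4) ε`,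
where `l` is the number of inputs of the update and `ε` is the sum of the two given negligible
functions (`le_uprob_results`), which gives the trace distance `2 √(1020 ε + 18 (l + 4) ε)`
(`machine_correct`). The keys of a level are good, and the encryptions of its secret key and trapdoor
decrypt correctly, except with probability `(2 + |sk| + |td|) ε` (`le_uprob_keys`,
`le_uprob_keyCtsCorrect`). The negligible function of the theorem is the sum of the two bounds.
-/

namespace QHom

/-! ### Closure properties of unary polynomial time -/

/-- Functions bounded by a polynomial in the sum of their arguments. -/
def PolyBdd {k : ℕ} (f : (Fin k → ℕ) → ℕ) : Prop :=
  ∃ e : ℕ, ∀ v, f v ≤ (∑ i, v i + 2) ^ e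

namespace PolyBdd

variable {k : ℕ} {f g : (Fin k → ℕ) → ℕ}

theorem mono (hg : PolyBdd g) (h : ∀ v, f v ≤ g v) : PolyBdd f :=
  let ⟨e, he⟩ := hg
  ⟨e, fun v => (h v).trans (he v)⟩

theorem add (hf : PolyBdd f) (hg : PolyBdd g) : PolyBdd fun v => f v + g v := by
  obtain ⟨d, hd⟩ := hf
  obtain ⟨e, he⟩ := hg
  refine ⟨max d e + 1, fun v => ?_⟩
  have h2 : 2 ≤ ∑ i, v i + 2 := by omega
  have h1 : 1 ≤ ∑ i, v i + 2 := by omega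
  calc f v + g v ≤ (∑ i, v i + 2) ^ max d e + (∑ i, v i + 2) ^ max d e :=
        add_le_add ((hd v).trans (Nat.pow_le_pow_right h1 (le_max_left _ _)))
          ((he v).trans (Nat.pow_le_pow_right h1 (le_max_right _ _)))
    _ = (∑ i, v i + 2) ^ max d e * 2 := by ring
    _ ≤ (∑ i, v i + 2) ^ (max d e + 1) := by
        rw [pow_succ]; exact Nat.mul_le_mul_left _ h2

theorem mul (hf : PolyBdd f) (hg : PolyBdd g) : PolyBdd fun v => f v * g v := by
  obtain ⟨d, hd⟩ := hf
  obtain ⟨e, he⟩ := hg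
  exact ⟨d + e, fun v => by rw [pow_add]; exact Nat.mul_le_mul (hd v) (he v)⟩

theorem total : PolyBdd fun v : Fin k → ℕ => ∑ i, v i + 2 := ⟨1, fun v => by simp⟩

theorem one : PolyBdd fun _ : Fin k → ℕ => 1 := total.mono fun v => by omega

theorem const (n : ℕ) : PolyBdd fun _ : Fin k → ℕ => n := by
  induction n with
  | zero => exact one.mono fun _ => Nat.zero_le _
  | succ n ih => exact ih.add one

theorem proj (i : Fin k) : PolyBdd fun v : Fin k → ℕ => v i :=
  total.mono fun v => (Finset.single_le_sum (f := v) (fun _ _ => Nat.zero_le _)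
    (Finset.mem_univ i)).trans (Nat.le_add_right _ _)

theorem pow (hf : PolyBdd f) (n : ℕ) : PolyBdd fun v => f v ^ n := by
  induction n with
  | zero => simpa using one
  | succ n ih => simpa [pow_succ] using ih.mul hf

theorem sum {ι : Type} (s : Finset ι) {f : ι → (Fin k → ℕ) → ℕ} (hf : ∀ i, PolyBdd (f i)) :
    PolyBdd fun v => ∑ i ∈ s, f i v := by
  classical
  induction s using Finset.induction_on with
  | empty => simpa using const 0
  | insert a s ha ih => simpa [Finset.sum_insert ha] using (hf a).add ih

theorem comp {m : ℕ} {f : (Fin m → ℕ) → ℕ} (hf : PolyBdd f) {g : Fin m → (Fin k → ℕ) → ℕ}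
    (hg : ∀ i, PolyBdd (g i)) : PolyBdd fun v => f fun i => g i v := by
  obtain ⟨e, he⟩ := hf
  exact (((sum Finset.univ hg).add (const 2)).pow e).mono fun v => he _

end PolyBdd

/-- A program increases its arguments by at most one in every step. -/
theorem Prog.eval_le_steps {k : ℕ} (P : Prog k) :
    ∀ (v : Fin k → ℕ) (B : ℕ), (∀ i, v i ≤ B) → P.eval v ≤ P.steps v + B := by
  induction P with
  | zero => intro v B _; simp [Prog.eval]
  | succ => intro v B h; simp only [Prog.eval, Prog.steps]; have := h 0; omega
  | proj i => intro v B h; simp only [Prog.eval, Prog.steps]; have := h i; omega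
  | comp f g hf hg =>
    intro v B h
    simp only [Prog.eval, Prog.steps]
    have h1 := hf (fun i => (g i).eval v) ((∑ i, (g i).steps v) + B) fun i =>
      (hg i v B h).trans (Nat.add_le_add_right
        (Finset.single_le_sum (f := fun i => (g i).steps v) (fun _ _ => Nat.zero_le _)
          (Finset.mem_univ i)) _)
    omega
  | loop f g hf hg =>
    intro v B h
    have htail : ∀ i, Fin.tail v i ≤ B := fun i => h _
    have key : ∀ n ≤ v 0, (Prog.loop f g).eval (Fin.cons n (Fin.tail v)) ≤
        (Prog.loop f g).steps (Fin.cons n (Fin.tail v)) + B := by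
      intro n
      induction n with
      | zero =>
        intro _
        have := hf (Fin.tail v) B htail
        simp only [Prog.eval, Prog.steps, Fin.cons_zero, Fin.tail_cons, Finset.range_zero,
          Finset.sum_empty]
        exact this.trans (by omega)
      | succ n ih =>
        intro hn
        have ih' := ih (by omega)
        have h2 := hg (Fin.cons n (Fin.cons ((Prog.loop f g).eval (Fin.cons n (Fin.tail v)))
          (Fin.tail v))) ((Prog.loop f g).steps (Fin.cons n (Fin.tail v)) + B) (by
            intro i
            refine Fin.cases ?_ (fun i => ?_) i
            · have := h 0; simp only [Fin.cons_zero]; omega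
            · refine Fin.cases ?_ (fun i => ?_) i
              · simpa using ih'
              · simp only [Fin.cons_succ]; have := htail i; omega)
        have e1 : (Prog.loop f g).eval (Fin.cons (n + 1) (Fin.tail v)) =
            g.eval (Fin.cons n (Fin.cons ((Prog.loop f g).eval (Fin.cons n (Fin.tail v)))
              (Fin.tail v))) := by
          simp [Prog.eval]
        have e2 : (Prog.loop f g).steps (Fin.cons (n + 1) (Fin.tail v)) =
            (Prog.loop f g).steps (Fin.cons n (Fin.tail v)) + (1 +
            g.steps (Fin.cons n (Fin.cons ((Prog.loop f g).eval (Fin.cons n (Fin.tail v)))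
              (Fin.tail v)))) := by
          simp only [Prog.steps, Fin.cons_zero, Fin.tail_cons, Finset.sum_range_succ]
          omega
        rw [e1, e2]
        omega
    have := key (v 0) le_rfl
    rwa [show (Fin.cons (v 0) (Fin.tail v) : Fin _ → ℕ) = v from Fin.cons_self_tail v] at this

namespace PolyTime

variable {k : ℕ} {a b c d : (Fin k → ℕ) → ℕ}

theorem iff_polyBdd {f : (Fin k → ℕ) → ℕ} :
    PolyTime f ↔ ∃ P : Prog k, (∀ v, P.eval v = f v) ∧ PolyBdd P.steps := by
  constructor
  · rintro ⟨P, e, h⟩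
    exact ⟨P, fun v => (h v).1, e, fun v => (h v).2⟩
  · rintro ⟨P, h, e, he⟩
    exact ⟨P, e, fun v => ⟨h v, he v⟩⟩

theorem polyBdd {f : (Fin k → ℕ) → ℕ} (hf : PolyTime f) : PolyBdd f := by
  obtain ⟨P, h, hP⟩ := iff_polyBdd.1 hf
  refine (hP.add PolyBdd.total).mono fun v => ?_
  rw [← h v]
  refine (P.eval_le_steps v (∑ i, v i) fun i => Finset.single_le_sum (f := v)
    (fun _ _ => Nat.zero_le _) (Finset.mem_univ i)).trans (by omega)

theorem comp {m : ℕ} {f : (Fin m → ℕ) → ℕ} (hf : PolyTime f) {g : Fin m → (Fin k → ℕ) → ℕ}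
    (hg : ∀ i, PolyTime (g i)) : PolyTime fun v => f fun i => g i v := by
  have hg' := fun i => (hg i).polyBdd
  rw [iff_polyBdd] at hf ⊢
  obtain ⟨P, hP, hPs⟩ := hf
  choose Q hQ hQs using fun i => iff_polyBdd.1 (hg i)
  refine ⟨.comp P Q, fun v => by simp [Prog.eval, hP, hQ], ?_⟩
  simp only [Prog.steps, hQ]
  exact (PolyBdd.one.add (PolyBdd.sum _ hQs)).add (hPs.comp hg')

/-- Recursion on the first argument. The polynomial bound for the values is needed, since `g` runs in
time polynomial in the values only. -/
theorem recursion {f : (Fin k → ℕ) → ℕ} {g : (Fin (k + 2) → ℕ) → ℕ} {F : (Fin (k + 1) → ℕ) → ℕ}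
    (hf : PolyTime f) (hg : PolyTime g) (hF : PolyBdd F)
    (h0 : ∀ w, F (Fin.cons 0 w) = f w)
    (hs : ∀ n w, F (Fin.cons (n + 1) w) = g (Fin.cons n (Fin.cons (F (Fin.cons n w)) w))) :
    PolyTime F := by
  obtain ⟨P, hP, hPs⟩ := iff_polyBdd.1 hf
  obtain ⟨Q, hQ, hQs⟩ := iff_polyBdd.1 hg
  have ev : ∀ n w, (Prog.loop P Q).eval (Fin.cons n w) = F (Fin.cons n w) := by
    intro n w
    induction n with
    | zero => simp [Prog.eval, hP, h0]
    | succ n ih =>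
      rw [hs, ← ih, ← hQ]
      simp [Prog.eval]
  have ev' : ∀ v, (Prog.loop P Q).eval v = F v := fun v => by
    have := ev (v 0) (Fin.tail v)
    rwa [show (Fin.cons (v 0) (Fin.tail v) : Fin _ → ℕ) = v from Fin.cons_self_tail v] at this
  refine iff_polyBdd.2 ⟨.loop P Q, ev', ?_⟩
  simp only [Prog.steps, ev]
  obtain ⟨e, he⟩ := hQs
  obtain ⟨e', he'⟩ := hF
  -- In every round, the arguments of `g` are bounded by the first argument and the bound for `F`.
  have hB : PolyBdd fun v : Fin (k + 1) → ℕ =>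
      1 + P.steps (Fin.tail v) + v 0 * (1 + (∑ i, v i + (∑ i, v i + 2) ^ e' + 2) ^ e) := by
    refine ((PolyBdd.one.add ?_).add ((PolyBdd.proj 0).mul (PolyBdd.one.add ?_)))
    · exact hPs.comp (g := fun i v => v i.succ) fun i => PolyBdd.proj _
    · exact ((((PolyBdd.total.mono fun v => Nat.le_add_right _ _).add
        (PolyBdd.total.pow e')).add (PolyBdd.const 2)).pow e)
  refine hB.mono fun v => Nat.add_le_add_left ?_ _
  refine (Finset.sum_le_card_nsmul _ _ (1 + (∑ i, v i + (∑ i, v i + 2) ^ e' + 2) ^ e) ?_).trans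
    (by simp)
  intro y hy
  have hy : y < v 0 := Finset.mem_range.1 hy
  refine Nat.add_le_add_left ((he _).trans (Nat.pow_le_pow_left ?_ _)) _
  have h1 : ∑ i, v i = v 0 + ∑ i, Fin.tail v i := Fin.sum_univ_succ v
  have h2 : F (Fin.cons y (Fin.tail v)) ≤ (∑ i, v i + 2) ^ e' := by
    refine (he' _).trans (Nat.pow_le_pow_left ?_ _)
    rw [Fin.sum_univ_succ]
    simp only [Fin.cons_zero, Fin.cons_succ]
    omega
  rw [Fin.sum_univ_succ, Fin.sum_univ_succ]
  simp only [Fin.cons_zero, Fin.cons_succ]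
  omega

theorem proj (i : Fin k) : PolyTime fun v : Fin k → ℕ => v i :=
  iff_polyBdd.2 ⟨.proj i, fun v => by simp [Prog.eval], by simpa [Prog.steps] using PolyBdd.one⟩

theorem zero : PolyTime fun _ : Fin k → ℕ => 0 :=
  iff_polyBdd.2 ⟨.zero, fun v => by simp [Prog.eval], by simpa [Prog.steps] using PolyBdd.one⟩

theorem succ (ha : PolyTime a) : PolyTime fun v => a v + 1 := by
  have : PolyTime fun v : Fin 1 → ℕ => v 0 + 1 :=
    iff_polyBdd.2 ⟨.succ, fun v => by simp [Prog.eval], by simpa [Prog.steps] using PolyBdd.one⟩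
  exact this.comp (g := fun _ => a) fun _ => ha

theorem const (n : ℕ) : PolyTime fun _ : Fin k → ℕ => n := by
  induction n with
  | zero => exact zero
  | succ n ih => exact ih.succ

theorem comp₁ {f : ℕ → ℕ} (hf : PolyTime fun v : Fin 1 → ℕ => f (v 0)) (ha : PolyTime a) :
    PolyTime fun v => f (a v) :=
  hf.comp (g := fun _ => a) fun _ => ha

theorem comp₂ {f : ℕ → ℕ → ℕ} (hf : PolyTime fun v : Fin 2 → ℕ => f (v 0) (v 1))
    (ha : PolyTime a) (hb : PolyTime b) : PolyTime fun v => f (a v) (b v) :=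
  hf.comp (g := ![a, b]) fun i => by fin_cases i <;> assumption

theorem comp₃ {f : ℕ → ℕ → ℕ → ℕ} (hf : PolyTime fun v : Fin 3 → ℕ => f (v 0) (v 1) (v 2))
    (ha : PolyTime a) (hb : PolyTime b) (hc : PolyTime c) :
    PolyTime fun v => f (a v) (b v) (c v) :=
  hf.comp (g := ![a, b, c]) fun i => by fin_cases i <;> assumption

theorem add (ha : PolyTime a) (hb : PolyTime b) : PolyTime fun v => a v + b v := by
  refine comp₂ (f := fun x y => x + y) ?_ ha hb
  exact recursion (f := fun w => w 0) (g := fun w => w 1 + 1) (proj 0) (proj 1).succ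
    ((PolyBdd.proj 0).add (PolyBdd.proj 1)) (fun w => by simp) (fun n w => by simp; ring)

theorem mul (ha : PolyTime a) (hb : PolyTime b) : PolyTime fun v => a v * b v := by
  refine comp₂ (f := fun x y => x * y) ?_ ha hb
  exact recursion (f := fun _ => 0) (g := fun w => w 1 + w 2) zero ((proj 1).add (proj 2))
    ((PolyBdd.proj 0).mul (PolyBdd.proj 1)) (fun w => by simp)
    (fun n w => by
      simp only [show (2 : Fin 3) = Fin.succ (Fin.succ 0) from rfl,
        show (1 : Fin 3) = Fin.succ 0 from rfl, show (1 : Fin 2) = Fin.succ 0 from rfl,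
        Fin.cons_zero, Fin.cons_succ]
      ring)

theorem sub (ha : PolyTime a) (hb : PolyTime b) : PolyTime fun v => a v - b v := by
  have pred : PolyTime fun v : Fin 1 → ℕ => v 0 - 1 :=
    recursion (f := fun _ => 0) (g := fun w => w 0) zero (proj 0)
      ((PolyBdd.proj 0).mono fun v => Nat.sub_le _ _) (fun w => by simp) (fun n w => by simp)
  refine comp₂ (f := fun y x => x - y) ?_ hb ha
  exact recursion (f := fun w => w 0) (g := fun w => w 1 - 1) (proj 0)
    (pred.comp (g := fun _ w => w 1) fun _ => proj 1)
    ((PolyBdd.proj 1).mono fun v => Nat.sub_le _ _) (fun w => by simp) (fun n w => by simp; omega)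

/-- Case distinction on whether a number vanishes. -/
theorem cond (hc : PolyTime c) (ha : PolyTime a) (hb : PolyTime b) :
    PolyTime fun v => if c v = 0 then a v else b v := by
  refine comp₃ (f := fun x y z => if x = 0 then y else z) ?_ hc ha hb
  exact recursion (f := fun w => w 0) (g := fun w => w 3) (proj 0) (proj 3)
    (((PolyBdd.proj 1).add (PolyBdd.proj 2)).mono fun v => by split_ifs <;> omega)
    (fun w => by simp) (fun n w => by
      simp only [show (3 : Fin 4) = Fin.succ (Fin.succ (Fin.succ 0)) from rfl,
        show (2 : Fin 3) = Fin.succ (Fin.succ 0) from rfl, Fin.cons_zero, Fin.cons_succ]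
      simp)

theorem ite_lt (ha : PolyTime a) (hb : PolyTime b) (hc : PolyTime c) (hd : PolyTime d) :
    PolyTime fun v => if a v < b v then c v else d v := by
  convert cond (hb.sub ha) hd hc using 2 with v
  split_ifs <;> first | rfl | omega

theorem ite_eq (ha : PolyTime a) (hb : PolyTime b) (hc : PolyTime c) (hd : PolyTime d) :
    PolyTime fun v => if a v = b v then c v else d v := by
  convert cond ((ha.sub hb).add (hb.sub ha)) hc hd using 2 with v
  split_ifs <;> first | rfl | omega

theorem mod (ha : PolyTime a) (hb : PolyTime b) : PolyTime fun v => a v % b v := by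
  refine comp₂ (f := fun x y => x % y) ?_ ha hb
  refine recursion (f := fun _ => 0) (g := fun w => if w 1 + 1 = w 2 then 0 else w 1 + 1) zero
    (ite_eq (proj 1).succ (proj 2) zero (proj 1).succ)
    ((PolyBdd.proj 0).mono fun v => Nat.mod_le _ _) (fun w => by simp) (fun n w => ?_)
  simp only [show (2 : Fin 3) = Fin.succ (Fin.succ 0) from rfl,
    show (1 : Fin 3) = Fin.succ 0 from rfl, show (1 : Fin 2) = Fin.succ 0 from rfl,
    Fin.cons_zero, Fin.cons_succ]
  rw [Nat.add_mod_eq_ite]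
  generalize w 0 = m
  rcases Nat.lt_or_ge 1 m with hm | hm
  · have := Nat.mod_lt n (show 0 < m by omega)
    rw [Nat.mod_eq_of_lt hm]
    split_ifs <;> omega
  · interval_cases m <;> simp [Nat.mod_one]

theorem div (ha : PolyTime a) (hb : PolyTime b) : PolyTime fun v => a v / b v := by
  refine comp₂ (f := fun x y => x / y) ?_ ha hb
  refine recursion (f := fun _ => 0) (g := fun w => if w 0 % w 2 + 1 = w 2 then w 1 + 1 else w 1)
    zero (ite_eq ((proj 0).mod (proj 2)).succ (proj 2) (proj 1).succ (proj 1))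
    ((PolyBdd.proj 0).mono fun v => Nat.div_le_self _ _) (fun w => by simp) (fun n w => ?_)
  simp only [show (2 : Fin 3) = Fin.succ (Fin.succ 0) from rfl,
    show (1 : Fin 3) = Fin.succ 0 from rfl, show (1 : Fin 2) = Fin.succ 0 from rfl,
    Fin.cons_zero, Fin.cons_succ]
  generalize w 0 = m
  rcases Nat.eq_zero_or_pos m with rfl | hm
  · simp
  · have h1 := Nat.mod_lt n hm
    have h2 := Nat.div_add_mod n m
    have h3 : n / m * m = m * (n / m) := Nat.mul_comm _ _
    have h4 : (n / m + 1) * m = m * (n / m) + m := by ring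
    split_ifs with h <;> rw [Nat.div_eq_iff hm] <;> omega

end PolyTime

/-! ### Uniform families of gate lists -/

namespace PolyTime

variable {k : ℕ}

theorem tail {f : (Fin k → ℕ) → ℕ} (hf : PolyTime f) :
    PolyTime fun v : Fin (k + 1) → ℕ => f (Fin.tail v) :=
  hf.comp (g := fun i v => v i.succ) fun _ => proj _

/-- Substitution for the first argument. -/
theorem subst {m : ℕ} {F : (Fin (m + 1) → ℕ) → ℕ} (hF : PolyTime F) {h : (Fin k → ℕ) → ℕ}
    (hh : PolyTime h) {g : Fin m → (Fin k → ℕ) → ℕ} (hg : ∀ i, PolyTime (g i)) :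
    PolyTime fun v => F (Fin.cons (h v) fun i => g i v) := by
  convert hF.comp (g := fun i v => (Fin.cons (h v) fun i => g i v : Fin (m + 1) → ℕ) i)
    (fun i => ?_) using 1
  refine Fin.cases ?_ (fun i => ?_) i
  · simpa using hh
  · simpa using hg i

theorem subst_tail {F : (Fin (k + 1) → ℕ) → ℕ} (hF : PolyTime F) {h : (Fin (k + 1) → ℕ) → ℕ}
    (hh : PolyTime h) : PolyTime fun v : Fin (k + 1) → ℕ => F (Fin.cons (h v) (Fin.tail v)) :=
  hF.subst hh (g := fun i v => v i.succ) fun _ => proj _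

end PolyTime

namespace NandCircuit.Uniform

variable {k : ℕ} {C : (Fin k → ℕ) → NandCircuit}

theorem comp (hC : NandCircuit.Uniform C) {m : ℕ} {g : Fin k → (Fin m → ℕ) → ℕ}
    (hg : ∀ i, PolyTime (g i)) : NandCircuit.Uniform fun v => C fun i => g i v := by
  refine ⟨hC.1.comp hg, ?_, ?_⟩
  · exact hC.2.1.subst (PolyTime.proj 0) (g := fun i v => g i (Fin.tail v)) fun i => (hg i).tail
  · exact hC.2.2.subst (PolyTime.proj 0) (g := fun i v => g i (Fin.tail v)) fun i => (hg i).tail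

end NandCircuit.Uniform

namespace QCircuit.Uniform

theorem comp {k : ℕ} {C : (Fin k → ℕ) → QCircuit} (hC : QCircuit.Uniform C) {m : ℕ}
    {g : Fin k → (Fin m → ℕ) → ℕ} (hg : ∀ i, PolyTime (g i)) :
    QCircuit.Uniform fun v => C fun i => g i v := by
  refine ⟨hC.1.comp hg, hC.2.1.comp hg, fun a => ?_⟩
  exact (hC.2.2 a).subst (PolyTime.proj 0) (g := fun i v => g i (Fin.tail v)) fun i => (hg i).tail

end QCircuit.Uniform

/-- A polynomial-time uniform family of gate lists. -/
def UniformGates {k : ℕ} (Q : (Fin k → ℕ) → List QGate) : Prop :=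
  PolyTime (fun v => (Q v).length) ∧
  ∀ a : Fin 4, PolyTime fun v : Fin (k + 1) → ℕ => ((Q (Fin.tail v)).getD (v 0) (.h 0)).code a

namespace UniformGates

variable {k : ℕ}

theorem append {Q R : (Fin k → ℕ) → List QGate} (hQ : UniformGates Q) (hR : UniformGates R) :
    UniformGates fun v => Q v ++ R v := by
  refine ⟨by simpa using hQ.1.add hR.1, fun a => ?_⟩
  convert PolyTime.ite_lt (PolyTime.proj 0) hQ.1.tail (hQ.2 a)
    ((hR.2 a).subst_tail ((PolyTime.proj 0).sub hQ.1.tail)) using 2 with v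
  simp only [Fin.tail_cons, Fin.cons_zero]
  split_ifs with h
  · rw [List.getD_append _ _ _ _ h]
  · rw [List.getD_append_right _ _ _ _ (not_lt.1 h)]

theorem code_h_zero (a : Fin 4) : (QGate.h 0).code a = 0 := by
  fin_cases a <;> rfl

theorem range_map {n : (Fin k → ℕ) → ℕ} {g : (Fin k → ℕ) → ℕ → QGate} (hn : PolyTime n)
    (hg : ∀ a, PolyTime fun v : Fin (k + 1) → ℕ => (g (Fin.tail v) (v 0)).code a) :
    UniformGates fun v => (List.range (n v)).map (g v) := by
  refine ⟨by simpa using hn, fun a => ?_⟩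
  convert PolyTime.ite_lt (PolyTime.proj 0) hn.tail (hg a) PolyTime.zero using 2 with v
  rw [List.getD_eq_getElem?_getD, List.getElem?_map]
  split_ifs with h
  · simp [h]
  · rw [List.getElem?_eq_none (by simpa using h)]
    simp [code_h_zero]

theorem reverse {Q : (Fin k → ℕ) → List QGate} (hQ : UniformGates Q) :
    UniformGates fun v => (Q v).reverse := by
  refine ⟨by simpa using hQ.1, fun a => ?_⟩
  convert PolyTime.ite_lt (PolyTime.proj 0) hQ.1.tail
    ((hQ.2 a).subst_tail ((hQ.1.tail.sub (PolyTime.const 1)).sub (PolyTime.proj 0)))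
    PolyTime.zero using 2 with v
  simp only [Fin.tail_cons, Fin.cons_zero]
  rw [List.getD_eq_getElem?_getD, List.getD_eq_getElem?_getD]
  split_ifs with h
  · rw [List.getElem?_reverse h]
  · rw [List.getElem?_eq_none (by simpa using h)]
    simp [code_h_zero]

theorem ccx_range {n : (Fin k → ℕ) → ℕ} {p q r : (Fin k → ℕ) → ℕ → ℕ} (hn : PolyTime n)
    (hp : PolyTime fun v : Fin (k + 1) → ℕ => p (Fin.tail v) (v 0))
    (hq : PolyTime fun v : Fin (k + 1) → ℕ => q (Fin.tail v) (v 0))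
    (hr : PolyTime fun v : Fin (k + 1) → ℕ => r (Fin.tail v) (v 0)) :
    UniformGates fun v => (List.range (n v)).map fun t => .ccx (p v t) (q v t) (r v t) :=
  range_map hn fun a => by
    fin_cases a
    · exact PolyTime.const 4
    · exact hp
    · exact hq
    · exact hr

theorem x_range {n : (Fin k → ℕ) → ℕ} {p : (Fin k → ℕ) → ℕ → ℕ} (hn : PolyTime n)
    (hp : PolyTime fun v : Fin (k + 1) → ℕ => p (Fin.tail v) (v 0)) :
    UniformGates fun v => (List.range (n v)).map fun t => .x (p v t) :=
  range_map hn fun a => by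
    fin_cases a
    · exact PolyTime.const 2
    · exact hp
    · exact PolyTime.zero
    · exact PolyTime.zero

theorem h_range {n : (Fin k → ℕ) → ℕ} {p : (Fin k → ℕ) → ℕ → ℕ} (hn : PolyTime n)
    (hp : PolyTime fun v : Fin (k + 1) → ℕ => p (Fin.tail v) (v 0)) :
    UniformGates fun v => (List.range (n v)).map fun t => .h (p v t) :=
  range_map hn fun a => by
    fin_cases a
    · exact PolyTime.zero
    · exact hp
    · exact PolyTime.zero
    · exact PolyTime.zero

end UniformGates

/-- The gate with its qubits renamed. -/
def QGate.rename (ρ : ℕ → ℕ) : QGate → QGate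
  | .h q => .h (ρ q)
  | .t q => .t (ρ q)
  | .x q => .x (ρ q)
  | .cx p q => .cx (ρ p) (ρ q)
  | .ccx p q r => .ccx (ρ p) (ρ q) (ρ r)

theorem UniformGates.rename {k : ℕ} {Q : (Fin k → ℕ) → List QGate} (hQ : UniformGates Q)
    {ρ : (Fin k → ℕ) → ℕ → ℕ}
    (hρ : PolyTime fun v : Fin (k + 1) → ℕ => ρ (Fin.tail v) (v 0)) :
    UniformGates fun v => (Q v).map (QGate.rename (ρ v)) := by
  have hρ' (a : Fin 4) : PolyTime fun v : Fin (k + 1) → ℕ =>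
      ρ (Fin.tail v) (((Q (Fin.tail v)).getD (v 0) (.h 0)).code a) := by
    simpa using hρ.subst_tail (hQ.2 a)
  refine ⟨by simpa using hQ.1, fun a => ?_⟩
  -- unused entries of the code of a gate are zero and have to stay so
  convert PolyTime.ite_lt (PolyTime.proj 0) hQ.1.tail (d := fun _ => 0)
    (c := fun v => (((Q (Fin.tail v)).getD (v 0) (.h 0)).rename (ρ (Fin.tail v))).code a)
    ?_ PolyTime.zero using 2 with v
  · rw [List.getD_eq_getElem?_getD, List.getD_eq_getElem?_getD, List.getElem?_map]
    split_ifs with h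
    · simp [h]
    · rw [List.getElem?_eq_none (by simpa using h)]
      simp [code_h_zero]
  · fin_cases a
    · convert hQ.2 0 using 2 with v
      cases (Q (Fin.tail v)).getD (v 0) (.h 0) <;> rfl
    · convert hρ' 1 using 2 with v
      cases (Q (Fin.tail v)).getD (v 0) (.h 0) <;> rfl
    · convert PolyTime.ite_lt (hQ.2 0) (PolyTime.const 3) PolyTime.zero (hρ' 2) using 2 with v
      cases (Q (Fin.tail v)).getD (v 0) (.h 0) <;> rfl
    · convert PolyTime.ite_lt (hQ.2 0) (PolyTime.const 4) PolyTime.zero (hρ' 3) using 2 with v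
      cases (Q (Fin.tail v)).getD (v 0) (.h 0) <;> rfl

/-! ### Toffoli programs -/

/-- A Toffoli gate: the bit `g.2.2` is flipped if the bits `g.1` and `g.2.1` are both set (these may
coincide). -/
abbrev Toffoli : Type := ℕ × ℕ × ℕ

/-- The quantum gate. -/
def Toffoli.gate (g : Toffoli) : QGate := .ccx g.1 g.2.1 g.2.2

/-- The action of a Toffoli gate on an unbounded memory. -/
def Toffoli.step (m : ℕ → Bool) (g : Toffoli) : ℕ → Bool :=
  if g.1 ≠ g.2.2 ∧ g.2.1 ≠ g.2.2 then Function.update m g.2.2 (m g.2.2 ^^ (m g.1 && m g.2.1)) else m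

/-- The action of a list of Toffoli gates on an unbounded memory. -/
def runT (L : List Toffoli) (m : ℕ → Bool) : ℕ → Bool := L.foldl Toffoli.step m

theorem runT_append (L L' : List Toffoli) (m : ℕ → Bool) :
    runT (L ++ L') m = runT L' (runT L m) := List.foldl_append

theorem runT_cons (g : Toffoli) (L : List Toffoli) (m : ℕ → Bool) :
    runT (g :: L) m = runT L (g.step m) := rfl

theorem Toffoli.step_of_ne {g : Toffoli} {m : ℕ → Bool} {q : ℕ} (h : q ≠ g.2.2) :
    g.step m q = m q := by
  unfold Toffoli.step
  split_ifs
  · simp [Function.update_of_ne h]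
  · rfl

theorem Toffoli.step_target {g : Toffoli} {m : ℕ → Bool} (h₁ : g.1 ≠ g.2.2) (h₂ : g.2.1 ≠ g.2.2) :
    g.step m g.2.2 = (m g.2.2 ^^ (m g.1 && m g.2.1)) := by
  simp [Toffoli.step, h₁, h₂]

theorem Toffoli.step_step (g : Toffoli) (m : ℕ → Bool) : g.step (g.step m) = m := by
  funext q
  by_cases hq : q = g.2.2
  · subst hq
    by_cases h : g.1 ≠ g.2.2 ∧ g.2.1 ≠ g.2.2
    · rw [step_target h.1 h.2, step_target h.1 h.2, step_of_ne h.1, step_of_ne h.2]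
      simp
    · simp [Toffoli.step, h]
  · rw [step_of_ne hq, step_of_ne hq]

theorem runT_reverse (L : List Toffoli) (m : ℕ → Bool) : runT L.reverse (runT L m) = m := by
  induction L generalizing m with
  | nil => rfl
  | cons g L ih =>
    rw [List.reverse_cons, runT_append, runT_cons g L m, ih]
    exact g.step_step m

theorem runT_of_not_target {L : List Toffoli} {q : ℕ} (h : ∀ g ∈ L, g.2.2 ≠ q) (m : ℕ → Bool) :
    runT L m q = m q := by
  induction L generalizing m with
  | nil => rfl
  | cons g L ih =>
    rw [runT_cons, ih fun g' hg' => h g' (List.mem_cons_of_mem _ hg'),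
      Toffoli.step_of_ne (h g List.mem_cons_self).symm]

/-- A program only depends on the bits that it uses. -/
theorem runT_congr {L : List Toffoli} {P : ℕ → Prop}
    (h : ∀ g ∈ L, P g.1 ∧ P g.2.1 ∧ P g.2.2) {m m' : ℕ → Bool} (hm : ∀ q, P q → m q = m' q) :
    ∀ q, P q → runT L m q = runT L m' q := by
  induction L generalizing m m' with
  | nil => exact hm
  | cons g L ih =>
    refine ih (fun g' hg' => h g' (List.mem_cons_of_mem _ hg')) fun q hq => ?_
    obtain ⟨h₁, h₂, h₃⟩ := h g List.mem_cons_self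
    unfold Toffoli.step
    split_ifs
    · by_cases hqt : q = g.2.2
      · subst hqt; simp [hm _ h₁, hm _ h₂, hm _ h₃]
      · simp [Function.update_of_ne hqt, hm q hq]
    · exact hm q hq

/-- Straight-line programs with increasing targets between `lo` and `hi`: every gate only uses bits
below its target. -/
def StraightLine (lo hi : ℕ) (L : List Toffoli) : Prop :=
  (∀ g ∈ L, lo ≤ g.2.2 ∧ g.2.2 < hi ∧ g.1 < g.2.2 ∧ g.2.1 < g.2.2) ∧
    L.Pairwise fun g g' => g.2.2 < g'.2.2

namespace StraightLine

variable {lo mid hi : ℕ} {L L' : List Toffoli}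

theorem append (h : StraightLine lo mid L) (h' : StraightLine mid hi L') (h₁ : lo ≤ mid)
    (h₂ : mid ≤ hi) : StraightLine lo hi (L ++ L') := by
  refine ⟨fun g hg => ?_, List.pairwise_append.2 ⟨h.2, h'.2, fun g hg g' hg' => ?_⟩⟩
  · rcases List.mem_append.1 hg with hg | hg
    · have := h.1 g hg; omega
    · have := h'.1 g hg; omega
  · have := h.1 g hg; have := h'.1 g' hg'; omega

theorem mono {lo' hi' : ℕ} (h : StraightLine lo hi L) (h₁ : lo' ≤ lo) (h₂ : hi ≤ hi') :
    StraightLine lo' hi' L :=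
  ⟨fun g hg => by have := h.1 g hg; omega, h.2⟩

theorem range_map {n : ℕ} {p q : ℕ → ℕ} (hp : ∀ k < n, p k < lo + k) (hq : ∀ k < n, q k < lo + k) :
    StraightLine lo (lo + n) ((List.range n).map fun k => (p k, q k, lo + k)) := by
  refine ⟨fun g hg => ?_, ?_⟩
  · obtain ⟨k, hk, rfl⟩ := List.mem_map.1 hg
    have hk := List.mem_range.1 hk
    have := hp k hk
    have := hq k hk
    simp only
    omega
  · rw [List.pairwise_map]
    exact List.pairwise_lt_range.imp fun h => by simpa using h

theorem run_of_lt (h : StraightLine lo hi L) (m : ℕ → Bool) {q : ℕ} (hq : q < lo) :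
    runT L m q = m q :=
  runT_of_not_target (fun g hg => by have := h.1 g hg; omega) m

theorem run_of_ge (h : StraightLine lo hi L) (m : ℕ → Bool) {q : ℕ} (hq : hi ≤ q) :
    runT L m q = m q :=
  runT_of_not_target (fun g hg => by have := h.1 g hg; omega) m

/-- The final memory satisfies the equation of every gate, whatever the order of computation. -/
theorem run_target (h : StraightLine lo hi L) (m : ℕ → Bool) {g : Toffoli} (hg : g ∈ L) :
    runT L m g.2.2 = (m g.2.2 ^^ (runT L m g.1 && runT L m g.2.1)) := by
  induction L generalizing m with
  | nil => simp at hg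
  | cons a L ih =>
    have hL : StraightLine lo hi L :=
      ⟨fun g hg => h.1 g (List.mem_cons_of_mem _ hg), (List.pairwise_cons.1 h.2).2⟩
    have hlt := (List.pairwise_cons.1 h.2).1
    rw [runT_cons]
    rcases List.mem_cons.1 hg with rfl | hg
    · have hg' := h.1 g List.mem_cons_self
      rw [runT_of_not_target (q := g.1) fun g' hg' => by have := hlt g' hg'; omega,
        runT_of_not_target (q := g.2.1) fun g' hg' => by have := hlt g' hg'; omega,
        runT_of_not_target (q := g.2.2) fun g' hg' => by have := hlt g' hg'; omega,
        Toffoli.step_of_ne (q := g.1) (by omega), Toffoli.step_of_ne (q := g.2.1) (by omega),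
        Toffoli.step_target (by omega) (by omega)]
    · rw [ih hL _ hg, Toffoli.step_of_ne (q := g.2.2) (by have := hlt g hg; omega)]

end StraightLine

/-- Adding (conjunctions of) bits to a range of bits that is not used otherwise. -/
theorem runT_range_target {n T : ℕ} {p q : ℕ → ℕ}
    (hp : ∀ k < n, p k < T ∨ T + n ≤ p k) (hq : ∀ k < n, q k < T ∨ T + n ≤ q k)
    (m : ℕ → Bool) {j : ℕ} (hj : j < n) :
    runT ((List.range n).map fun k => (p k, q k, T + k)) m (T + j) =
      (m (T + j) ^^ (m (p j) && m (q j))) := by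
  have key : ∀ n' ≤ n, ∀ r, runT ((List.range n').map fun k => (p k, q k, T + k)) m r =
      if T ≤ r ∧ r < T + n' then (m r ^^ (m (p (r - T)) && m (q (r - T)))) else m r := by
    intro n'
    induction n' with
    | zero => intro _ r; rw [if_neg (by omega)]; rfl
    | succ i ih =>
      intro hi r
      rw [List.range_succ, List.map_append, runT_append]
      have hpi := hp i (by omega)
      have hqi := hq i (by omega)
      change Toffoli.step _ (p i, q i, T + i) r = _
      by_cases hr : r = T + i
      · subst hr
        have := Toffoli.step_target (g := (p i, q i, T + i))
          (m := runT ((List.range i).map fun k => (p k, q k, T + k)) m)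
          (by simp only; omega) (by simp only; omega)
        simp only at this
        rw [this, ih (by omega), ih (by omega), ih (by omega), if_neg (by omega), if_neg (by omega),
          if_neg (by omega), if_pos (by omega)]
        simp
      · rw [Toffoli.step_of_ne (by simpa using hr), ih (by omega)]
        by_cases h : T ≤ r ∧ r < T + i
        · rw [if_pos h, if_pos (by omega)]
        · rw [if_neg h, if_neg (by omega)]
  rw [key n le_rfl, if_pos (by omega)]
  simp

theorem runT_range_of_not_mem {n T : ℕ} {p q : ℕ → ℕ} (m : ℕ → Bool) {r : ℕ}
    (hr : r < T ∨ T + n ≤ r) :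
    runT ((List.range n).map fun k => (p k, q k, T + k)) m r = m r := by
  refine runT_of_not_target (fun g hg => ?_) m
  obtain ⟨k, hk, rfl⟩ := List.mem_map.1 hg
  have hk := List.mem_range.1 hk
  simp only
  omega

/-! ### Bit strings in memory -/

/-- The memory holds the string `x` in the places `f 0, f 1, …`. -/
def HoldsAt (m : ℕ → Bool) (f : ℕ → ℕ) (x : List Bool) : Prop :=
  ∀ j < x.length, m (f j) = x.getD j false

/-- Places of a concatenation. -/
def appendLoc (len : ℕ) (f g : ℕ → ℕ) (j : ℕ) : ℕ := if j < len then f j else g (j - len)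

/-- Places of a concatenation of strings of the same length. -/
def blockLoc (len : ℕ) (f : ℕ → ℕ → ℕ) (j : ℕ) : ℕ := f (j / len) (j % len)

namespace HoldsAt

variable {m m' : ℕ → Bool} {f g : ℕ → ℕ} {x y : List Bool}

theorem congr (h : HoldsAt m f x) (hm : ∀ j < x.length, m' (f j) = m (f j)) : HoldsAt m' f x :=
  fun j hj => (hm j hj).trans (h j hj)

theorem append_iff :
    HoldsAt m f (x ++ y) ↔ HoldsAt m f x ∧ HoldsAt m (fun j => f (x.length + j)) y := by
  constructor
  · intro h
    refine ⟨fun j hj => ?_, fun j hj => ?_⟩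
    · rw [h j (by simp; omega), List.getD_append _ _ _ _ hj]
    · rw [h _ (by simp; omega), List.getD_append_right _ _ _ _ (by omega)]
      simp
  · rintro ⟨h₁, h₂⟩ j hj
    rcases lt_or_ge j x.length with h | h
    · rw [h₁ j h, List.getD_append _ _ _ _ h]
    · have := h₂ (j - x.length) (by simp at hj; omega)
      simp only [Nat.add_sub_cancel' h] at this
      rw [this, List.getD_append_right _ _ _ _ h]

theorem append {len : ℕ} (hlen : x.length = len) (hx : HoldsAt m f x) (hy : HoldsAt m g y) :
    HoldsAt m (appendLoc len f g) (x ++ y) := by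
  subst hlen
  refine append_iff.2 ⟨fun j hj => ?_, fun j hj => ?_⟩
  · rw [appendLoc, if_pos hj, hx j hj]
  · simp only [appendLoc]
    rw [if_neg (by omega), Nat.add_sub_cancel_left, hy j hj]

theorem ofFn_iff {n : ℕ} {b : Bits n} :
    HoldsAt m f (List.ofFn b) ↔ ∀ j : Fin n, m (f j) = b j := by
  simp only [HoldsAt, List.length_ofFn]
  constructor
  · intro h j
    rw [h j j.2]
    simp [List.getD_eq_getElem?_getD]
  · intro h j hj
    rw [h ⟨j, hj⟩]
    simp [List.getD_eq_getElem?_getD, hj]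

theorem singleton_iff {b : Bool} : HoldsAt m f [b] ↔ m (f 0) = b := by
  simp [HoldsAt]

end HoldsAt

theorem flatten_length {α : Type} {L : List (List α)} {len : ℕ} (h : ∀ l ∈ L, l.length = len) :
    L.flatten.length = L.length * len := by
  induction L with
  | nil => simp
  | cons a L ih =>
    rw [List.flatten_cons, List.length_append, ih fun l hl => h l (List.mem_cons_of_mem _ hl),
      h a List.mem_cons_self, List.length_cons]
    ring

theorem flatten_getD {α : Type} {L : List (List α)} {len : ℕ} (h : ∀ l ∈ L, l.length = len)
    {j r : ℕ} (hj : j < L.length) (hr : r < len) (d : α) :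
    L.flatten.getD (j * len + r) d = L[j].getD r d := by
  induction L generalizing j with
  | nil => simp at hj
  | cons a L ih =>
    have ha := h a List.mem_cons_self
    rw [List.flatten_cons]
    cases j with
    | zero =>
      rw [List.getD_append _ _ _ _ (by simpa [ha] using hr)]
      simp
    | succ j =>
      have e : (j + 1) * len + r = len + (j * len + r) := by ring
      rw [List.getD_append_right _ _ _ _ (by rw [ha, e]; omega), ha, e, Nat.add_sub_cancel_left,
        ih (fun l hl => h l (List.mem_cons_of_mem _ hl)) (by simpa using hj)]
      simp

namespace HoldsAt

variable {m : ℕ → Bool} {f : ℕ → ℕ}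

theorem flatten_iff {n len : ℕ} {x : Fin n → List Bool} (h : ∀ i, (x i).length = len) :
    HoldsAt m f (List.ofFn x).flatten ↔ ∀ i : Fin n, HoldsAt m (fun r => f (i * len + r)) (x i) := by
  have h' : ∀ l ∈ List.ofFn x, l.length = len := fun l hl => by
    obtain ⟨i, rfl⟩ := (List.mem_ofFn' x l).1 hl
    exact h i
  have hg : ∀ (i : Fin n) r, r < len →
      (List.ofFn x).flatten.getD (i * len + r) false = (x i).getD r false := fun i r hr => by
    rw [flatten_getD h' (by simp) hr]
    simp
  constructor
  · intro H i r hr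
    rw [h i] at hr
    simp only
    rw [H, hg i r hr]
    rw [flatten_length h', List.length_ofFn]
    calc (i : ℕ) * len + r < i * len + len := by omega
      _ = (i + 1) * len := by ring
      _ ≤ n * len := Nat.mul_le_mul_right _ i.2
  · intro H j hj
    rw [flatten_length h', List.length_ofFn] at hj
    have hlen : 0 < len := Nat.pos_of_ne_zero fun h0 => by simp [h0] at hj
    have h1 : j / len < n := Nat.div_lt_of_lt_mul (by rwa [Nat.mul_comm])
    have h2 := Nat.mod_lt j hlen
    have e : j / len * len + j % len = j := by rw [Nat.mul_comm]; exact Nat.div_add_mod j len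
    have := H ⟨j / len, h1⟩ (j % len) (by rw [h]; exact h2)
    simp only [e] at this
    rw [this, ← hg ⟨j / len, h1⟩ _ h2]
    simp only [e]

theorem flatten {n len : ℕ} {x : Fin n → List Bool} (h : ∀ i, (x i).length = len)
    {f : ℕ → ℕ → ℕ} (hx : ∀ i : Fin n, HoldsAt m (f i) (x i)) :
    HoldsAt m (blockLoc len f) (List.ofFn x).flatten := by
  refine (flatten_iff h).2 fun i r hr => ?_
  rw [h] at hr
  simp only [blockLoc]
  rw [Nat.mul_add_mod_self_right, Nat.mod_eq_of_lt hr, show ((i : ℕ) * len + r) / len = i by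
    rw [Nat.mul_comm, Nat.mul_add_div (by omega), Nat.div_eq_of_lt hr, Nat.add_zero]]
  exact hx i r (by rw [h]; exact hr)

end HoldsAt

/-! ### NAND circuits as Toffoli programs -/

namespace NandCircuit

/-- The place of the wire `idx` when the `k`-th gate is computed: the inputs are at the places
`inLoc`, the values of the gates from `base` on; wires that do not exist yet are found at `blank`. -/
def ref (n : ℕ) (inLoc : ℕ → ℕ) (base blank k idx : ℕ) : ℕ :=
  if idx < n then inLoc idx else if idx < n + k then base + (idx - n) else blank

/-- The place of the `j`-th of `o` output bits. -/
def outLoc (C : NandCircuit) (n o : ℕ) (inLoc : ℕ → ℕ) (base blank j : ℕ) : ℕ :=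
  ref n inLoc base blank C.length (n + C.length - o + j)

/-- The program which runs a circuit `l` times, for the inputs at the places `inLoc 0, inLoc 1, …`.
The places of the gate values are supposed to be set initially. -/
def prog (C : NandCircuit) (l n : ℕ) (inLoc : ℕ → ℕ → ℕ) (base blank : ℕ) : List Toffoli :=
  (List.range (l * C.length)).map fun t =>
    (ref n (inLoc (t / C.length)) (base + t / C.length * C.length) blank (t % C.length)
      (C.getD (t % C.length) (0, 0)).1,
    ref n (inLoc (t / C.length)) (base + t / C.length * C.length) blank (t % C.length)
      (C.getD (t % C.length) (0, 0)).2,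
    base + t)

theorem wires_append_singleton (C : NandCircuit) (g : ℕ × ℕ) (x : List Bool) :
    wires (C ++ [g]) x = C.wires x ++ [!((C.wires x).getD g.1 false && (C.wires x).getD g.2 false)] := by
  simp [wires]

theorem wires_length (C : NandCircuit) (x : List Bool) :
    (C.wires x).length = x.length + C.length := by
  induction C using List.reverseRecOn with
  | nil => simp [wires]
  | append_singleton C g ih => rw [wires_append_singleton]; simp [ih]; omega

theorem ref_lt {n : ℕ} {inLoc : ℕ → ℕ} {base blank k idx : ℕ} {B : ℕ} (h : ∀ j < n, inLoc j < B)
    (hz : blank < B) (hb : base + k ≤ B) : ref n inLoc base blank k idx < B := by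
  unfold ref
  split_ifs with h1 h2
  · exact h _ h1
  · omega
  · exact hz

theorem prog_straightLine (C : NandCircuit) {l n : ℕ} {inLoc : ℕ → ℕ → ℕ} {base blank : ℕ}
    (h : ∀ i < l, ∀ j < n, inLoc i j < base) (hz : blank < base) :
    StraightLine base (base + l * C.length) (C.prog l n inLoc base blank) := by
  have hk : ∀ t < l * C.length, t / C.length < l ∧
      t / C.length * C.length + t % C.length = t := fun t ht =>
    ⟨Nat.div_lt_of_lt_mul (by rwa [Nat.mul_comm]), by
      rw [Nat.mul_comm]; exact Nat.div_add_mod t _⟩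
  refine StraightLine.range_map (fun t ht => ?_) (fun t ht => ?_) <;>
  · obtain ⟨h1, h2⟩ := hk t ht
    exact ref_lt (fun j hj => (h _ h1 j hj).trans_le (by omega)) (by omega) (by omega)

/-- A memory that satisfies the equations of all gates holds the values of all wires. -/
theorem ref_eq_wires (C : NandCircuit) {m : ℕ → Bool} {n : ℕ} {inLoc : ℕ → ℕ} {base blank : ℕ}
    {x : List Bool} (hx : x.length = n) (hin : HoldsAt m inLoc x) (hz : m blank = false)
    (hC : ∀ k < C.length, m (base + k) =
      !(m (ref n inLoc base blank k (C.getD k (0, 0)).1) &&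
        m (ref n inLoc base blank k (C.getD k (0, 0)).2))) (idx : ℕ) :
    m (ref n inLoc base blank C.length idx) = (C.wires x).getD idx false := by
  induction C using List.reverseRecOn generalizing idx with
  | nil =>
    simp only [ref, wires, List.length_nil, List.foldl_nil]
    split_ifs with h1 h2
    · exact hin idx (by omega)
    · omega
    · rw [hz, List.getD_eq_default _ _ (by omega)]
  | append_singleton C g ih =>
    have ih' := ih fun k hk => by
      have := hC k (by simp; omega)
      rwa [List.getD_append _ _ _ _ hk] at this
    have hlast := hC C.length (by simp)
    rw [List.getD_append_right _ _ _ _ le_rfl, Nat.sub_self] at hlast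
    change m _ = !(m (ref n inLoc base blank C.length g.1) &&
      m (ref n inLoc base blank C.length g.2)) at hlast
    rw [ih', ih'] at hlast
    have hlen := wires_length C x
    rw [wires_append_singleton]
    rcases lt_trichotomy idx (n + C.length) with h | h | h
    · rw [List.getD_append _ _ _ _ (by omega), ← ih']
      simp only [ref, List.length_append, List.length_singleton]
      split_ifs <;> first | rfl | omega
    · rw [List.getD_append_right _ _ _ _ (by omega),
        show idx - (wires C x).length = 0 by omega]
      simp only [ref, List.length_append, List.length_singleton]
      rw [if_neg (by omega), if_pos (by omega), show idx - n = C.length by omega, hlast]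
      rfl
    · rw [List.getD_eq_default _ _ (by simp; omega)]
      simp only [ref, List.length_append, List.length_singleton]
      rw [if_neg (by omega), if_neg (by omega), hz]

/-- After running the program of a circuit, the outputs are found at `outLoc`. The hypotheses speak
of a later memory `m` in which the equations of all gates of the program hold. -/
theorem holdsAt_out (C : NandCircuit) {m : ℕ → Bool} {l n : ℕ} {inLoc : ℕ → ℕ → ℕ} {base blank : ℕ}
    (hC : ∀ g ∈ C.prog l n inLoc base blank, m g.2.2 = !(m g.1 && m g.2.1)) (hz : m blank = false)
    {i : ℕ} (hi : i < l) {x : List Bool} (hx : x.length = n) (hin : HoldsAt m (inLoc i) x) (o : ℕ) :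
    HoldsAt m (C.outLoc n o (inLoc i) (base + i * C.length) blank) (List.ofFn (C.out o x)) := by
  refine HoldsAt.ofFn_iff.2 fun j => ?_
  rw [outLoc, ref_eq_wires C hx hin hz, out, wires_length, hx]
  intro k hk
  have hlt : i * C.length + k < l * C.length := by
    calc i * C.length + k < i * C.length + C.length := by omega
      _ = (i + 1) * C.length := by ring
      _ ≤ l * C.length := Nat.mul_le_mul_right _ hi
  have := hC _ (List.mem_map.2 ⟨i * C.length + k, List.mem_range.2 hlt, rfl⟩)
  simp only at this
  rw [Nat.mul_add_mod_self_right, Nat.mod_eq_of_lt hk,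
    show (i * C.length + k) / C.length = i by
      rw [Nat.mul_comm, Nat.mul_add_div (by omega), Nat.div_eq_of_lt hk, Nat.add_zero]] at this
  rw [← this, Nat.add_assoc]

/-- Places of the bits of the description of a circuit. -/
def codeLoc (C : NandCircuit) (n one blank : ℕ) : ℕ → ℕ :=
  blockLoc (2 * (n + C.length)) fun t =>
    appendLoc (n + C.length) (fun w => if w = (C.getD t (0, 0)).1 then one else blank)
      fun w => if w = (C.getD t (0, 0)).2 then one else blank

theorem code_eq (C : NandCircuit) (n : ℕ) :
    C.code n = (List.ofFn fun t : Fin C.length =>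
      (List.range (n + C.length)).map (fun w => decide (w = C[t].1)) ++
      (List.range (n + C.length)).map (fun w => decide (w = C[t].2))).flatten := by
  rw [code, List.flatMap_def]
  congr 1
  refine List.ext_getElem (by simp) fun t h1 h2 => by simp

theorem code_length (C : NandCircuit) (n : ℕ) :
    (C.code n).length = C.length * (2 * (n + C.length)) := by
  rw [code_eq, flatten_length (len := 2 * (n + C.length)), List.length_ofFn]
  intro l hl
  obtain ⟨t, rfl⟩ := (List.mem_ofFn' _ l).1 hl
  simp; ring

theorem holdsAt_code (C : NandCircuit) (n : ℕ) {m : ℕ → Bool} {one blank : ℕ} (h1 : m one = true)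
    (h0 : m blank = false) : HoldsAt m (C.codeLoc n one blank) (C.code n) := by
  rw [code_eq]
  have aux : ∀ a : ℕ, HoldsAt m (fun w => if w = a then one else blank)
      ((List.range (n + C.length)).map fun w => decide (w = a)) := by
    intro a j hj
    simp only [List.length_map, List.length_range] at hj
    simp only [List.getD_eq_getElem?_getD, List.getElem?_map, List.getElem?_range hj,
      Option.map_some, Option.getD_some]
    split_ifs with h <;> simp [h, h1, h0]
  refine HoldsAt.flatten (fun i => by simp; ring) fun t => ?_
  refine HoldsAt.append (by simp) ?_ ?_
  · simpa [List.getD_eq_getElem?_getD] using aux C[t].1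
  · simpa [List.getD_eq_getElem?_getD] using aux C[t].2

end NandCircuit

/-! ### Bit registers -/

section Bits

variable {w : ℕ}

theorem getBit_of_lt (b : Bits w) {q : ℕ} (h : q < w) : getBit b q = b ⟨q, h⟩ := dif_pos h

theorem getBit_of_ge (b : Bits w) {q : ℕ} (h : w ≤ q) : getBit b q = false :=
  dif_neg (not_lt.2 h)

@[simp] theorem getBit_fin (b : Bits w) (j : Fin w) : getBit b j = b j := getBit_of_lt b j.2

theorem bits_ext {b b' : Bits w} (h : ∀ q, q < w → getBit b q = getBit b' q) : b = b' :=
  funext fun j => by simpa using h j j.2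

theorem getBit_setBit (b : Bits w) (p q : ℕ) (v : Bool) :
    getBit (setBit b p v) q = if q = p ∧ q < w then v else getBit b q := by
  by_cases h : q < w
  · rw [getBit_of_lt _ h, getBit_of_lt _ h]
    simp [setBit, h]
  · rw [getBit_of_ge _ (not_lt.1 h), getBit_of_ge _ (not_lt.1 h), if_neg (by omega)]

theorem getBit_readBits (b : Bits w) (off len q : ℕ) :
    getBit (readBits b off len) q = if q < len then getBit b (off + q) else false := by
  conv_lhs => unfold getBit
  split_ifs <;> simp [readBits]

/-- The first `w` bits of a memory. -/
def ofMem (w : ℕ) (m : ℕ → Bool) : Bits w := fun j => m j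

theorem getBit_ofMem (m : ℕ → Bool) (q : ℕ) : getBit (ofMem w m) q = if q < w then m q else false := by
  unfold getBit ofMem
  split_ifs <;> rfl

/-- Overwrite the bits from position `off` on with `d`. -/
def setBits {n : ℕ} (b : Bits w) (off : ℕ) (d : Bits n) : Bits w :=
  fun j => if off ≤ (j : ℕ) ∧ (j : ℕ) < off + n then getBit d (j - off) else b j

theorem getBit_setBits {n : ℕ} (b : Bits w) (off : ℕ) (d : Bits n) (q : ℕ) :
    getBit (setBits b off d) q =
      if off ≤ q ∧ q < off + n ∧ q < w then getBit d (q - off) else getBit b q := by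
  by_cases h : q < w
  · rw [getBit_of_lt _ h, getBit_of_lt _ h]
    simp [setBits, h]
  · rw [getBit_of_ge _ (not_lt.1 h), getBit_of_ge _ (not_lt.1 h)]
    simp [h]

theorem flipBit_of_ge (b : Bits w) {q : ℕ} (h : w ≤ q) : flipBit b q = b :=
  bits_ext fun r hr => by
    rw [flipBit, getBit_setBit, if_neg (by omega)]

theorem getBit_flipBit (b : Bits w) (p q : ℕ) :
    getBit (flipBit b p) q = if q = p ∧ q < w then !getBit b q else getBit b q := by
  rw [flipBit, getBit_setBit]
  split_ifs with h
  · rw [h.1]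
  · rfl

theorem flipBit_flipBit (b : Bits w) (q : ℕ) : flipBit (flipBit b q) q = b :=
  bits_ext fun r hr => by
    rw [getBit_flipBit, getBit_flipBit]
    split_ifs <;> simp

theorem readBits_setBits {n : ℕ} (b : Bits w) (off : ℕ) (d : Bits n) (h : off + n ≤ w) :
    readBits (setBits b off d) off n = d :=
  bits_ext fun q hq => by
    rw [getBit_readBits, if_pos hq, getBit_setBits, if_pos (by omega), Nat.add_sub_cancel_left]

theorem setBits_readBits (b : Bits w) (off n : ℕ) : setBits b off (readBits b off n) = b :=
  bits_ext fun q hq => by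
    rw [getBit_setBits]
    split_ifs with h
    · rw [getBit_readBits, if_pos (by omega), Nat.add_sub_cancel' h.1]
    · rfl

end Bits

/-! ### Path sums -/

/-- The superposition `∑ α j |f j⟩`. -/
noncomputable def pathSum {J : Type} [Fintype J] {w : ℕ} (α : J → ℂ) (f : J → Bits w) : Bits w → ℂ :=
  fun b => ∑ j, if f j = b then α j else 0

/-- The action of a list of gates. -/
noncomputable def runGates {w : ℕ} (L : List QGate) (φ : Bits w → ℂ) : Bits w → ℂ :=
  L.foldl (fun χ g => g.apply χ) φ

section PathSum

variable {w : ℕ} {J J' : Type} [Fintype J] [Fintype J']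

theorem runGates_append (L L' : List QGate) (φ : Bits w → ℂ) :
    runGates (L ++ L') φ = runGates L' (runGates L φ) := List.foldl_append

theorem runGates_cons (g : QGate) (L : List QGate) (φ : Bits w → ℂ) :
    runGates (g :: L) φ = runGates L (g.apply φ) := rfl

theorem runGates_singleton (g : QGate) (φ : Bits w → ℂ) : runGates [g] φ = g.apply φ := rfl

theorem pathSum_equiv (e : J ≃ J') (α : J' → ℂ) (f : J' → Bits w) :
    pathSum (fun j => α (e j)) (fun j => f (e j)) = pathSum α f :=
  funext fun b => Equiv.sum_comp e fun j => if f j = b then α j else 0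

/-- Paths that end in the same place can be collected. -/
theorem pathSum_comp [DecidableEq J'] (h : J → J') (α : J → ℂ) (f : J' → Bits w) :
    pathSum α (fun j => f (h j)) = pathSum (fun j' => ∑ j, if h j = j' then α j else 0) f := by
  funext b
  have h1 : ∀ j, (if f (h j) = b then α j else 0) =
      ∑ j', if f j' = b then (if h j = j' then α j else 0) else 0 := fun j => by
    rw [Finset.sum_eq_single (h j) (fun j' _ hj' => by simp [Ne.symm hj']) (by simp)]
    simp
  simp only [pathSum, h1]
  rw [Finset.sum_comm]
  refine Finset.sum_congr rfl fun j' _ => ?_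
  split_ifs <;> simp

/-- A gate that permutes the basis states by an involution. -/
theorem apply_pathSum_of_involution {g : QGate} {c : Bits w → Bits w}
    (hg : ∀ (φ : Bits w → ℂ) b, g.apply φ b = φ (c b)) (hc : ∀ b, c (c b) = b) (α : J → ℂ)
    (f : J → Bits w) : g.apply (pathSum α f) = pathSum α fun j => c (f j) := by
  funext b
  rw [hg]
  refine Finset.sum_congr rfl fun j _ => if_congr ⟨fun h => ?_, fun h => ?_⟩ rfl rfl
  · change c (f j) = b
    rw [h, hc]
  · rw [← h, hc]

theorem apply_x_pathSum (q : ℕ) (α : J → ℂ) (f : J → Bits w) :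
    (QGate.x q).apply (pathSum α f) = pathSum α fun j => flipBit (f j) q :=
  apply_pathSum_of_involution (c := fun b => flipBit b q) (fun _ _ => rfl) (fun b => flipBit_flipBit b q) α f

theorem apply_toffoli_pathSum {g : Toffoli} (hg : g.2.2 < w) (α : J → ℂ) (f : J → Bits w) :
    g.gate.apply (pathSum α f) = pathSum α fun j => ofMem w (g.step (getBit (f j))) := by
  have hstep : ∀ b : Bits w, getBit (ofMem w (g.step (getBit b))) = g.step (getBit b) := by
    intro b
    funext q
    rw [getBit_ofMem]
    split_ifs with h
    · rfl
    · rw [Toffoli.step_of_ne (by omega), getBit_of_ge _ (not_lt.1 h)]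
  refine apply_pathSum_of_involution (c := fun b => ofMem w (g.step (getBit b)))
    (fun φ b => ?_) (fun b => ?_) α f
  · obtain ⟨p, q, r⟩ := g
    change (if p ≠ r ∧ q ≠ r ∧ getBit b p = true ∧ getBit b q = true then φ (flipBit b r) else φ b) = _
    have : (if p ≠ r ∧ q ≠ r ∧ getBit b p = true ∧ getBit b q = true then flipBit b r else b) =
        ofMem w (Toffoli.step (getBit b) (p, q, r)) := by
      refine bits_ext fun s hs => ?_
      rw [hstep]
      by_cases hpq : p ≠ r ∧ q ≠ r
      · by_cases hsr : s = r
        · subst hsr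
          rw [Toffoli.step_target hpq.1 hpq.2]
          simp only at hpq ⊢
          cases h1 : getBit b p <;> cases h2 : getBit b q <;>
            simp [hpq, getBit_flipBit, hs]
        · rw [Toffoli.step_of_ne hsr]
          split_ifs
          · rw [getBit_flipBit, if_neg (by omega)]
          · rfl
      · rw [if_neg fun h => hpq ⟨h.1, h.2.1⟩]
        simp [Toffoli.step, hpq]
    rw [← this]
    split_ifs <;> rfl
  · refine bits_ext fun s hs => ?_
    simp only [hstep, Toffoli.step_step]
    rw [getBit_ofMem, if_pos hs]

theorem getBit_ofMem_runT {L : List Toffoli} (hL : ∀ g ∈ L, g.2.2 < w) (b : Bits w) :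
    getBit (ofMem w (runT L (getBit b))) = runT L (getBit b) := by
  funext q
  rw [getBit_ofMem]
  split_ifs with h
  · rfl
  · rw [runT_of_not_target fun g hg => by have := hL g hg; omega, getBit_of_ge _ (not_lt.1 h)]

theorem runGates_toffoli_pathSum {L : List Toffoli} (hL : ∀ g ∈ L, g.2.2 < w) (α : J → ℂ)
    (f : J → Bits w) : runGates (L.map Toffoli.gate) (pathSum α f) =
      pathSum α fun j => ofMem w (runT L (getBit (f j))) := by
  induction L generalizing f with
  | nil =>
    refine congrArg (pathSum α) (funext fun j => bits_ext fun q hq => ?_)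
    rw [getBit_ofMem, if_pos hq]
    rfl
  | cons g L ih =>
    rw [List.map_cons, runGates_cons, apply_toffoli_pathSum (hL g List.mem_cons_self),
      ih fun g' hg' => hL g' (List.mem_cons_of_mem _ hg')]
    congr 1
    funext j
    congr 1
    have := getBit_ofMem_runT (L := [g]) (w := w) (by simpa using hL g List.mem_cons_self) (f j)
    rw [runT_cons]
    exact congrArg (runT L) this

/-- NOT gates on a range of qubits. -/
theorem runGates_x_pathSum {n lo : ℕ} (α : J → ℂ) (f : J → Bits w) :
    runGates ((List.range n).map fun t => .x (lo + t)) (pathSum α f) =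
      pathSum α fun j => ofMem w fun q =>
        if lo ≤ q ∧ q < lo + n then !getBit (f j) q else getBit (f j) q := by
  induction n with
  | zero =>
    refine congrArg (pathSum α) (funext fun j => bits_ext fun q hq => ?_)
    rw [getBit_ofMem, if_pos hq, if_neg (by omega)]
  | succ n ih =>
    rw [List.range_succ, List.map_append, runGates_append, ih, List.map_singleton, runGates_singleton,
      apply_x_pathSum]
    congr 1
    funext j
    refine bits_ext fun q hq => ?_
    rw [getBit_flipBit, getBit_ofMem, getBit_ofMem, if_pos hq, if_pos hq]
    by_cases h : q = lo + n
    · rw [if_pos ⟨h, hq⟩, if_neg (by omega), if_pos (by omega)]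
    · rw [if_neg (by omega)]
      exact if_congr (by omega) rfl rfl

theorem apply_h_pathSum {q : ℕ} (hq : q < w) (α : J → ℂ) (f : J → Bits w) :
    (QGate.h q).apply (pathSum α f) = pathSum (J := J × Bool)
      (fun j => α j.1 * (((Real.sqrt 2 : ℝ) : ℂ)⁻¹ * if j.2 && getBit (f j.1) q then -1 else 1))
      fun j => setBit (f j.1) q j.2 := by
  funext b
  simp only [QGate.apply, pathSum, if_pos hq, Fintype.sum_prod_type, Finset.mul_sum]
  rw [Finset.sum_comm]
  refine Finset.sum_congr rfl fun j _ => ?_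
  have key : ∀ u v : Bool, f j = setBit b q u → setBit (f j) q v = b →
      getBit b q = v ∧ getBit (f j) q = u := by
    intro u v h1 h2
    constructor
    · rw [← h2, getBit_setBit, if_pos ⟨rfl, hq⟩]
    · rw [h1, getBit_setBit, if_pos ⟨rfl, hq⟩]
  by_cases h : ∀ r, r ≠ q → getBit b r = getBit (f j) r
  · have e1 : ∀ u, f j = setBit b q u ↔ getBit (f j) q = u := fun u => by
      constructor
      · intro h1; rw [h1, getBit_setBit, if_pos ⟨rfl, hq⟩]
      · intro h1
        refine bits_ext fun r hr => ?_
        rw [getBit_setBit]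
        by_cases hrq : r = q
        · subst hrq; rw [if_pos ⟨rfl, hr⟩, h1]
        · rw [if_neg (by tauto), h r hrq]
    have e2 : ∀ v, setBit (f j) q v = b ↔ getBit b q = v := fun v => by
      constructor
      · intro h1; rw [← h1, getBit_setBit, if_pos ⟨rfl, hq⟩]
      · intro h1
        refine bits_ext fun r hr => ?_
        rw [getBit_setBit]
        by_cases hrq : r = q
        · subst hrq; rw [if_pos ⟨rfl, hr⟩, h1]
        · rw [if_neg (by tauto), h r hrq]
    simp only [e1, e2]
    generalize getBit b q = v
    obtain ⟨u, hu⟩ : ∃ u, getBit (f j) q = u := ⟨_, rfl⟩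
    simp only [hu]
    cases u <;> cases v <;> simp [mul_comm]
  · push Not at h
    obtain ⟨r, hr, hne⟩ := h
    have e1 : ∀ u, f j ≠ setBit b q u := fun u hu => hne (by
      rw [hu, getBit_setBit, if_neg (by tauto)])
    have e2 : ∀ v, setBit (f j) q v ≠ b := fun v hv => hne (by
      rw [← hv, getBit_setBit, if_neg (by tauto)])
    simp [e1, e2]

/-- The matrix of the Hadamard transform of `n` qubits. -/
noncomputable def hadamard {n : ℕ} (d m : Bits n) : ℂ :=
  (((Real.sqrt 2 : ℝ) : ℂ)⁻¹) ^ n * ∏ t, if d t && m t then -1 else 1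

/-- Hadamard gates on a register branch each path into one for every new value of the register. -/
theorem runGates_h_pathSum {n lo : ℕ} (h : lo + n ≤ w) (α : J → ℂ) (f : J → Bits w) :
    runGates ((List.range n).map fun t => .h (lo + t)) (pathSum α f) =
      pathSum (J := J × Bits n) (fun j => α j.1 * hadamard j.2 (readBits (f j.1) lo n))
        fun j => setBits (f j.1) lo j.2 := by
  induction n with
  | zero =>
    rw [← pathSum_equiv (Equiv.prodUnique J (Bits 0)).symm]
    change pathSum α f = _
    congr 1
    · funext j; simp [hadamard]
    · funext j
      exact bits_ext fun q hq => by rw [getBit_setBits, if_neg (by omega)]; rfl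
  | succ n ih =>
    rw [List.range_succ, List.map_append, runGates_append, ih (by omega),
      List.map_singleton, runGates_singleton, apply_h_pathSum (by omega),
      ← pathSum_equiv ((Equiv.prodAssoc J (Bits n) Bool).trans (Equiv.prodCongr (Equiv.refl J)
        ((Equiv.prodComm _ _).trans (Fin.snocEquiv fun _ => Bool))))]
    congr 1
    · funext ⟨⟨j, d⟩, v⟩
      simp only [Equiv.trans_apply, Equiv.prodAssoc_apply, Equiv.prodCongr_apply, Prod.map,
        Equiv.refl_apply, Equiv.prodComm_apply, Prod.swap, Fin.snocEquiv, Equiv.coe_fn_mk]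
      have e : getBit (setBits (f j) lo d) (lo + n) = readBits (f j) lo (n + 1) (Fin.last n) := by
        rw [getBit_setBits, if_neg (by omega)]; rfl
      rw [e]
      unfold hadamard
      rw [Fin.prod_univ_castSucc]
      simp only [Fin.snoc_castSucc, Fin.snoc_last]
      have e' : ∀ t : Fin n, readBits (f j) lo (n + 1) t.castSucc = readBits (f j) lo n t :=
        fun t => rfl
      simp only [e']
      ring
    · funext ⟨⟨j, d⟩, v⟩
      simp only [Equiv.trans_apply, Equiv.prodAssoc_apply, Equiv.prodCongr_apply, Prod.map,
        Equiv.refl_apply, Equiv.prodComm_apply, Prod.swap, Fin.snocEquiv, Equiv.coe_fn_mk]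
      refine bits_ext fun q hq => ?_
      rw [getBit_setBit, getBit_setBits, getBit_setBits]
      by_cases h1 : q = lo + n
      · subst h1
        rw [if_pos ⟨rfl, hq⟩, if_pos (by omega), Nat.add_sub_cancel_left,
          getBit_of_lt _ (by omega)]
        exact (Fin.snoc_last (α := fun _ => Bool) v d).symm
      · rw [if_neg (by omega)]
        by_cases h2 : lo ≤ q ∧ q < lo + n ∧ q < w
        · rw [if_pos h2, if_pos (by omega), getBit_of_lt _ (by omega),
            getBit_of_lt (w := n + 1) _ (by omega)]
          exact (Fin.snoc_castSucc (α := fun _ => Bool) v d ⟨q - lo, by omega⟩).symm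
        · rw [if_neg h2, if_neg (by omega)]

/-! ### Running a circuit inside a register -/

/-- A gate sequence on `w₀` qubits, moved to position `off` of a larger register; qubits that do not
exist are renamed to qubits that do not exist. -/
theorem runGates_rename_pathSum {w₀ off : ℕ} (h : off + w₀ ≤ w) (L : List QGate) (χ : Bits w₀ → ℂ)
    (α : J → ℂ) (f : J → Bits w) :
    runGates (L.map (QGate.rename fun q => if q < w₀ then off + q else w))
      (pathSum (J := J × Bits w₀) (fun j => α j.1 * χ j.2) fun j => setBits (f j.1) off j.2) =
      pathSum (J := J × Bits w₀) (fun j => α j.1 * runGates L χ j.2)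
        fun j => setBits (f j.1) off j.2 := by
  set c : Bits w → ℂ := fun b =>
    ∑ j, if ∀ q < w, ¬(off ≤ q ∧ q < off + w₀) → getBit (f j) q = getBit b q then α j else 0 with hc
  have hsum : ∀ (χ : Bits w₀ → ℂ) b,
      pathSum (J := J × Bits w₀) (fun j => α j.1 * χ j.2) (fun j => setBits (f j.1) off j.2) b =
        c b * χ (readBits b off w₀) := by
    intro χ b
    simp only [pathSum, Fintype.sum_prod_type, hc, Finset.sum_mul]
    refine Finset.sum_congr rfl fun j _ => ?_
    rw [Finset.sum_eq_single (readBits b off w₀)]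
    · rw [ite_mul, zero_mul]
      refine if_congr ⟨fun h1 q hq hq' => ?_, fun h1 => bits_ext fun q hq => ?_⟩ rfl rfl
      · rw [← h1, getBit_setBits, if_neg (by omega)]
      · rw [getBit_setBits]
        split_ifs with h2
        · rw [getBit_readBits, if_pos (by omega), Nat.add_sub_cancel' h2.1]
        · exact h1 q hq (by omega)
    · intro r _ hr
      refine if_neg fun h1 => hr ?_
      rw [← h1, readBits_setBits _ _ _ h]
    · simp
  have hcset : ∀ b q v, q < w₀ → c (setBit b (off + q) v) = c b := by
    intro b q v hq
    refine Finset.sum_congr rfl fun j _ => if_congr ?_ rfl rfl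
    refine forall_congr' fun r => forall_congr' fun hr => forall_congr' fun hr' => ?_
    rw [getBit_setBit, if_neg (by omega)]
  have hget : ∀ (b : Bits w) q, getBit b (if q < w₀ then off + q else w) =
      getBit (readBits b off w₀) q := by
    intro b q
    rw [getBit_readBits]
    split_ifs
    · rfl
    · exact getBit_of_ge _ le_rfl
  have hread : ∀ (b : Bits w) q v, q < w₀ →
      readBits (setBit b (off + q) v) off w₀ = setBit (readBits b off w₀) q v := by
    intro b q v hq
    refine bits_ext fun r hr => ?_
    rw [getBit_readBits, if_pos hr, getBit_setBit, getBit_setBit, getBit_readBits, if_pos hr]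
    exact if_congr (by omega) rfl rfl
  have hflip : ∀ (χ : Bits w₀ → ℂ) (b : Bits w) q,
      c (flipBit b (if q < w₀ then off + q else w)) *
        χ (readBits (flipBit b (if q < w₀ then off + q else w)) off w₀) =
      c b * χ (flipBit (readBits b off w₀) q) := by
    intro χ b q
    have h1 := hget b q
    split_ifs at h1 ⊢ with hq
    · rw [flipBit, hcset _ _ _ hq, hread _ _ _ hq, h1]; rfl
    · rw [flipBit_of_ge _ le_rfl, flipBit_of_ge _ (not_lt.1 hq)]
  induction L generalizing χ with
  | nil => rfl
  | cons g L ih =>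
    rw [List.map_cons, runGates_cons, runGates_cons, ← ih]
    congr 1
    funext b
    rw [hsum]
    cases g with
    | h q =>
      simp only [QGate.rename, QGate.apply, hget, hsum]
      by_cases hq : q < w₀
      · simp only [if_pos hq, if_pos (show off + q < w by omega), hcset _ _ _ hq, hread _ _ _ hq]
        rw [Finset.mul_sum, Finset.mul_sum, Finset.mul_sum]
        exact Finset.sum_congr rfl fun v _ => by ring
      · simp only [if_neg hq, lt_irrefl, if_false]
    | t q =>
      simp only [QGate.rename, QGate.apply, hget, hsum]
      ring
    | x q =>
      simp only [QGate.rename, QGate.apply, hsum]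
      exact hflip χ b q
    | cx p q =>
      simp only [QGate.rename, QGate.apply, hget, hsum, hflip]
      rw [mul_ite]
      by_cases hq : q < w₀
      · by_cases hp : p < w₀
        · refine if_congr (and_congr_left' (by simp only [if_pos hp, if_pos hq]; omega)) rfl rfl
        · simp [getBit_of_ge (readBits b off w₀) (not_lt.1 hp)]
      · simp [flipBit_of_ge (readBits b off w₀) (not_lt.1 hq)]
    | ccx p q r =>
      simp only [QGate.rename, QGate.apply, hget, hsum, hflip]
      rw [mul_ite]
      by_cases hr : r < w₀
      · by_cases hp : p < w₀
        · by_cases hq : q < w₀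
          · refine if_congr ?_ rfl rfl
            rw [if_pos hp, if_pos hq, if_pos hr, Ne, Ne, Nat.add_left_cancel_iff,
              Nat.add_left_cancel_iff]
          · simp [getBit_of_ge (readBits b off w₀) (not_lt.1 hq)]
        · simp [getBit_of_ge (readBits b off w₀) (not_lt.1 hp)]
      · simp [flipBit_of_ge (readBits b off w₀) (not_lt.1 hr)]

/-! ### Reduced density matrices -/

/-- The reduced density matrix of the first `k` qubits is a mixture of the states that belong to the
values of the other qubits. -/
theorem reduced_pathSum {k : ℕ} {K : Type} [Fintype K] [DecidableEq K] (Ψ : Bits k × K → ℂ)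
    (f : Bits k × K → Bits w) (S : Bits w → Prop) [DecidablePred fun κ => S (f (fun _ => false, κ))]
    (h₁ : ∀ j, readBits (f j) 0 k = j.1)
    (h₂ : ∀ j j' : Bits k × K, (∀ i : Fin w, k ≤ i → f j i = f j' i) ↔ j.2 = j'.2)
    (h₃ : ∀ x κ, S (f (x, κ)) ↔ S (f (fun _ => false, κ))) (x y : Bits k) :
    reduced k (pathSum Ψ f) S x y =
      ∑ κ, if S (f (fun _ => false, κ)) then Ψ (x, κ) * star (Ψ (y, κ)) else 0 := by
  classical
  have hinj : Function.Injective f := fun j j' h =>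
    Prod.ext (by rw [← h₁ j, ← h₁ j', h]) ((h₂ j j').1 fun i _ => by rw [h])
  have hval : ∀ j, pathSum Ψ f (f j) = Ψ j := fun j => by
    unfold pathSum
    rw [Finset.sum_eq_single j (fun j' _ hj' => if_neg fun h => hj' (hinj h)) (by simp), if_pos rfl]
  have hzero : ∀ b, (∀ j, f j ≠ b) → pathSum Ψ f b = 0 := fun b hb =>
    Finset.sum_eq_zero fun j _ => if_neg (hb j)
  have hsum : ∀ F : Bits w → ℂ, (∀ b, (∀ j, f j ≠ b) → F b = 0) → ∑ b, F b = ∑ j, F (f j) := by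
    intro F hF
    rw [← Finset.sum_image (s := Finset.univ) (g := f) (f := F) fun a _ b _ h => hinj h]
    refine (Finset.sum_subset (Finset.subset_univ _) fun b _ hb => hF b fun j hj => hb ?_).symm
    exact Finset.mem_image.2 ⟨j, Finset.mem_univ _, hj⟩
  unfold reduced
  rw [hsum _ fun b hb => by simp [hzero b hb]]
  simp_rw [fun j => hsum (fun b' => if readBits (f j) 0 k = x ∧ readBits b' 0 k = y ∧
    (∀ i : Fin w, k ≤ i → f j i = b' i) ∧ S (f j) then
      pathSum Ψ f (f j) * star (pathSum Ψ f b') else 0) fun b hb => by simp [hzero b hb]]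
  simp only [hval, h₁, h₂, Fintype.sum_prod_type]
  rw [Finset.sum_eq_single x (fun x' _ hx' => by simp [hx']) (by simp)]
  refine Finset.sum_congr rfl fun κ _ => ?_
  rw [Finset.sum_eq_single y (fun y' _ hy' => by simp [hy']) (by simp),
    Finset.sum_eq_single κ (fun κ' _ hκ' => by simp [Ne.symm hκ']) (by simp)]
  simp [h₃ x κ]

/-- The amplitude of the value `x` of the first `k` qubits, when the others have the value `g`. -/
noncomputable def splitAmp (k : ℕ) (χ : Bits w → ℂ) (x : Bits k) (g : Bits (w - k)) : ℂ :=
  ∑ b, if (readBits b 0 k, readBits b k (w - k)) = (x, g) then χ b else 0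

/-- Tracing out all qubits but the first `k`, without a condition on the outcome. -/
theorem reduced_true (k : ℕ) (χ : Bits w → ℂ) (x y : Bits k) :
    reduced k χ (fun _ => True) x y = ∑ g, splitAmp k χ x g * star (splitAmp k χ y g) := by
  classical
  have htail : ∀ b b' : Bits w, (∀ j : Fin w, k ≤ j → b j = b' j) ↔
      readBits b k (w - k) = readBits b' k (w - k) := by
    intro b b'
    constructor
    · intro h
      funext j
      have hj : k + j < w := by omega
      simp only [readBits, getBit_of_lt _ hj]
      exact h _ (Nat.le_add_right _ _)
    · intro h j hj
      have := congrArg (fun b => getBit b (j - k)) h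
      simp only [getBit_readBits] at this
      rwa [if_pos (by omega), if_pos (by omega), Nat.add_sub_cancel' hj, getBit_fin,
        getBit_fin] at this
  have hstar : ∀ g, star (splitAmp k χ y g) =
      ∑ b, if (readBits b 0 k, readBits b k (w - k)) = (y, g) then star (χ b) else 0 := fun g => by
    rw [splitAmp, star_sum]
    exact Finset.sum_congr rfl fun b _ => by split_ifs <;> simp
  unfold reduced
  simp only [htail, hstar, and_true]
  simp only [splitAmp, Finset.sum_mul_sum, Prod.mk.injEq]
  conv_rhs => rw [Finset.sum_comm]
  refine Finset.sum_congr rfl fun b _ => ?_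
  conv_rhs => rw [Finset.sum_comm]
  refine Finset.sum_congr rfl fun b' _ => ?_
  rw [Finset.sum_eq_single (readBits b k (w - k)) (fun g _ hg => by simp [Ne.symm hg]) (by simp)]
  by_cases h1 : readBits b 0 k = x <;> by_cases h2 : readBits b' 0 k = y <;>
    by_cases h3 : readBits b k (w - k) = readBits b' k (w - k) <;> simp [h1, h2, h3, eq_comm]

end PathSum

/-! ### The trace distance -/

theorem isHermitian_of_sum {X K : Type} [Fintype K] {ρ : Matrix X X ℂ} {u : K → X → ℂ}
    (hρ : ∀ x y, ρ x y = ∑ κ, u κ x * star (u κ y)) : ρ.IsHermitian := by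
  refine Matrix.IsHermitian.ext fun x y => ?_
  rw [hρ, hρ, star_sum]
  exact Finset.sum_congr rfl fun κ _ => by rw [star_mul, star_star]

section TraceDist

variable {X : Type} [Fintype X]

/-- The Euclidean norm. -/
noncomputable def l2norm (u : X → ℂ) : ℝ := ‖(WithLp.toLp 2 u : EuclideanSpace ℂ X)‖

theorem l2norm_nonneg (u : X → ℂ) : 0 ≤ l2norm u := norm_nonneg _

theorem l2norm_sq (u : X → ℂ) : l2norm u ^ 2 = ∑ x, ‖u x‖ ^ 2 := by
  rw [l2norm, EuclideanSpace.norm_sq_eq]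

theorem l2norm_eq_sqrt (u : X → ℂ) : l2norm u = √(∑ x, ‖u x‖ ^ 2) := by
  rw [← l2norm_sq, Real.sqrt_sq (l2norm_nonneg u)]

theorem l2norm_add_le (u v : X → ℂ) : l2norm (u + v) ≤ l2norm u + l2norm v := norm_add_le _ _

theorem l2norm_smul (c : ℂ) (u : X → ℂ) : l2norm (c • u) = ‖c‖ * l2norm u :=
  norm_smul c (WithLp.toLp 2 u : EuclideanSpace ℂ X)

theorem sum_norm_mul_norm_le (u v : X → ℂ) : ∑ x, ‖u x‖ * ‖v x‖ ≤ l2norm u * l2norm v := by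
  rw [l2norm_eq_sqrt, l2norm_eq_sqrt]
  exact Real.sum_mul_le_sqrt_mul_sqrt _ _ _

/-- The expectation value of a mixture of pure states. -/
theorem star_dotProduct_mulVec_of_sum {K : Type} [Fintype K] {ρ : Matrix X X ℂ} {u : K → X → ℂ}
    (hρ : ∀ x y, ρ x y = ∑ κ, u κ x * star (u κ y)) (v : X → ℂ) :
    star v ⬝ᵥ ρ.mulVec v = ((∑ κ, ‖star v ⬝ᵥ u κ‖ ^ 2 : ℝ) : ℂ) := by
  push_cast
  simp only [← Complex.mul_conj', ← RCLike.star_def]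
  simp only [dotProduct, Matrix.mulVec, hρ, Finset.mul_sum, Finset.sum_mul, star_sum]
  conv_lhs => rw [Finset.sum_comm]
  conv_rhs => rw [Finset.sum_comm]
  refine Finset.sum_congr rfl fun x _ => ?_
  conv_rhs => rw [Finset.sum_comm]
  refine Finset.sum_congr rfl fun y _ => Finset.sum_congr rfl fun κ _ => ?_
  simp only [Pi.star_apply, star_mul, star_star]
  ring

variable [DecidableEq X]

/-- A change to an orthonormal basis keeps norms. -/
theorem l2norm_unitary (U : Matrix.unitaryGroup X ℂ) (u : X → ℂ) :
    l2norm ((star (U : Matrix X X ℂ)).mulVec u) = l2norm u := by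
  have h : ∀ v : X → ℂ, ((l2norm v ^ 2 : ℝ) : ℂ) = star v ⬝ᵥ v := fun v => by
    rw [l2norm_sq, dotProduct]
    push_cast
    refine Finset.sum_congr rfl fun x _ => ?_
    rw [Pi.star_apply, RCLike.star_def, Complex.conj_mul']
  have h2 : ((l2norm ((star (U : Matrix X X ℂ)).mulVec u) ^ 2 : ℝ) : ℂ) = ((l2norm u ^ 2 : ℝ) : ℂ) := by
    rw [h, h, Matrix.star_mulVec, Matrix.dotProduct_mulVec, Matrix.vecMul_vecMul,
      ← Matrix.star_eq_conjTranspose, star_star, Unitary.mul_star_self_of_mem U.2, Matrix.vecMul_one]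
  exact (sq_eq_sq₀ (l2norm_nonneg _) (l2norm_nonneg _)).1 (by exact_mod_cast h2)

/-- The trace distance of Hermitian matrices is half the sum of the absolute values of the eigenvalues
of their difference. -/
theorem traceDist_eq_sum_eigenvalues {ρ σ : Matrix X X ℂ} (h : (ρ - σ).IsHermitian) :
    traceDist ρ σ = (1 / 2) * ∑ i, |h.eigenvalues i| := by
  have h1 : cfc Real.sqrt (Matrix.conjTranspose (ρ - σ) * (ρ - σ)) = cfc (fun x : ℝ => |x|) (ρ - σ) := by
    have hs : IsSelfAdjoint (ρ - σ) := h
    rw [h.eq, ← pow_two, ← cfc_pow_id (R := ℝ) (ρ - σ) 2 hs, ← cfc_comp Real.sqrt _ (ρ - σ) hs]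
    refine congrArg (fun f => cfc f (ρ - σ)) ?_
    funext x
    exact Real.sqrt_sq_eq_abs x
  rw [traceDist, h1, h.cfc_eq, Matrix.IsHermitian.cfc, Unitary.conjStarAlgAut_apply,
    Matrix.trace_mul_comm, ← mul_assoc, Unitary.star_mul_self_of_mem (SetLike.coe_mem _), one_mul,
    Matrix.trace_diagonal]
  simp

theorem eigenvalues_eq_expectation {A : Matrix X X ℂ} (h : A.IsHermitian) (i : X) :
    (h.eigenvalues i : ℂ) = star (fun x => (h.eigenvectorUnitary : Matrix X X ℂ) x i) ⬝ᵥ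
      A.mulVec fun x => (h.eigenvectorUnitary : Matrix X X ℂ) x i := by
  have h1 := h.mulVec_eigenvectorBasis i
  have h2 : (fun x => (h.eigenvectorUnitary : Matrix X X ℂ) x i) = ⇑(h.eigenvectorBasis i) := by
    funext x; rw [h.eigenvectorUnitary_apply]
  have h3 := Unitary.star_mul_self_of_mem h.eigenvectorUnitary.2
  have h4 := congrFun (congrFun h3 i) i
  rw [h2, h1, dotProduct_smul, ← h2]
  rw [Matrix.mul_apply, Matrix.one_apply_eq] at h4
  have h5 : star (fun x => (h.eigenvectorUnitary : Matrix X X ℂ) x i) ⬝ᵥ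
      (fun x => (h.eigenvectorUnitary : Matrix X X ℂ) x i) = 1 := h4
  rw [h5]
  simp

/-- The trace distance of two mixtures of pure states is bounded by the distances of the states. -/
theorem traceDist_le_of_sum {K : Type} [Fintype K] {ρ σ : Matrix X X ℂ} {u v : K → X → ℂ}
    (hρ : ∀ x y, ρ x y = ∑ κ, u κ x * star (u κ y))
    (hσ : ∀ x y, σ x y = ∑ κ, v κ x * star (v κ y)) :
    traceDist ρ σ ≤ (1 / 2) * ∑ κ, (l2norm (u κ) + l2norm (v κ)) * l2norm (u κ - v κ) := by
  have h : (ρ - σ).IsHermitian := (isHermitian_of_sum hρ).sub (isHermitian_of_sum hσ)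
  rw [traceDist_eq_sum_eigenvalues h]
  refine mul_le_mul_of_nonneg_left ?_ (by norm_num)
  set U := h.eigenvectorUnitary with hU
  have hp : ∀ (w : X → ℂ) i, star (fun x => (U : Matrix X X ℂ) x i) ⬝ᵥ w =
      (star (U : Matrix X X ℂ)).mulVec w i := fun w i => rfl
  have heig : ∀ i, h.eigenvalues i = ∑ κ, (‖(star (U : Matrix X X ℂ)).mulVec (u κ) i‖ ^ 2 -
      ‖(star (U : Matrix X X ℂ)).mulVec (v κ) i‖ ^ 2) := by
    intro i
    have h1 := eigenvalues_eq_expectation h i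
    rw [← hU, Matrix.sub_mulVec, dotProduct_sub, star_dotProduct_mulVec_of_sum hρ,
      star_dotProduct_mulVec_of_sum hσ] at h1
    rw [Finset.sum_sub_distrib]
    simp only [hp] at h1
    exact_mod_cast h1
  have habs : ∀ i, |h.eigenvalues i| ≤ ∑ κ,
      (‖(star (U : Matrix X X ℂ)).mulVec (u κ) i‖ * ‖(star (U : Matrix X X ℂ)).mulVec (u κ - v κ) i‖ +
        ‖(star (U : Matrix X X ℂ)).mulVec (v κ) i‖ *
          ‖(star (U : Matrix X X ℂ)).mulVec (u κ - v κ) i‖) := by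
    intro i
    rw [heig]
    refine (Finset.abs_sum_le_sum_abs _ _).trans (Finset.sum_le_sum fun κ _ => ?_)
    rw [sq_sub_sq, abs_mul, abs_of_nonneg (by positivity), ← add_mul]
    refine mul_le_mul_of_nonneg_left ?_ (by positivity)
    rw [Matrix.mulVec_sub]
    exact abs_norm_sub_norm_le _ _
  refine (Finset.sum_le_sum fun i _ => habs i).trans ?_
  rw [Finset.sum_comm]
  refine Finset.sum_le_sum fun κ _ => ?_
  rw [Finset.sum_add_distrib, add_mul]
  have := fun a b : X → ℂ => sum_norm_mul_norm_le ((star (U : Matrix X X ℂ)).mulVec a)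
    ((star (U : Matrix X X ℂ)).mulVec b)
  simp only [l2norm_unitary] at this
  exact add_le_add (this _ _) (this _ _)

theorem abs_trace_sub_le {ρ σ : Matrix X X ℂ} (h : (ρ - σ).IsHermitian) :
    |(ρ - σ).trace.re| ≤ 2 * traceDist ρ σ := by
  rw [traceDist_eq_sum_eigenvalues h, h.trace_eq_sum_eigenvalues]
  simp only [Complex.re_sum, RCLike.ofReal_eq_complex_ofReal, Complex.ofReal_re]
  linarith [Finset.abs_sum_le_sum_abs h.eigenvalues Finset.univ]

/-- Expectations in a subnormalized state differ by at most twice the trace distance. -/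
theorem abs_expectation_sub_le {ρ σ : Matrix X X ℂ} (h : (ρ - σ).IsHermitian) {v : X → ℂ}
    (hv : l2norm v ≤ 1) : |(star v ⬝ᵥ (ρ - σ).mulVec v).re| ≤ 2 * traceDist ρ σ := by
  rw [traceDist_eq_sum_eigenvalues h]
  set U := h.eigenvectorUnitary with hU
  have h1 : star v ⬝ᵥ (ρ - σ).mulVec v =
      ((∑ i, h.eigenvalues i * ‖(star (U : Matrix X X ℂ)).mulVec v i‖ ^ 2 : ℝ) : ℂ) := by
    have h2 := h.spectral_theorem
    rw [Unitary.conjStarAlgAut_apply] at h2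
    conv_lhs => rw [h2]
    rw [← Matrix.mulVec_mulVec, ← Matrix.mulVec_mulVec, Matrix.dotProduct_mulVec, ← hU]
    have h3 : Matrix.vecMul (star v) (U : Matrix X X ℂ) = star ((star (U : Matrix X X ℂ)).mulVec v) := by
      rw [Matrix.star_mulVec, ← Matrix.star_eq_conjTranspose, star_star]
    rw [h3, dotProduct]
    push_cast
    refine Finset.sum_congr rfl fun i _ => ?_
    rw [Matrix.mulVec_diagonal, Pi.star_apply, RCLike.star_def, ← Complex.conj_mul']
    simp only [Function.comp, RCLike.ofReal_eq_complex_ofReal]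
    ring
  rw [h1, Complex.ofReal_re]
  have h4 : ∀ i, ‖(star (U : Matrix X X ℂ)).mulVec v i‖ ^ 2 ≤ 1 := fun i => by
    refine (Finset.single_le_sum (f := fun i => ‖(star (U : Matrix X X ℂ)).mulVec v i‖ ^ 2)
      (fun _ _ => by positivity) (Finset.mem_univ i)).trans ?_
    rw [← l2norm_sq, l2norm_unitary]
    exact pow_le_one₀ (l2norm_nonneg v) hv
  have h5 : |∑ i, h.eigenvalues i * ‖(star (U : Matrix X X ℂ)).mulVec v i‖ ^ 2| ≤
      ∑ i, |h.eigenvalues i| := by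
    refine (Finset.abs_sum_le_sum_abs _ _).trans (Finset.sum_le_sum fun i _ => ?_)
    rw [abs_mul, abs_of_nonneg (by positivity : (0 : ℝ) ≤ ‖(star (U : Matrix X X ℂ)).mulVec v i‖ ^ 2)]
    exact mul_le_of_le_one_right (abs_nonneg _) (h4 i)
  linarith

end TraceDist

theorem exists_phase (a : ℂ) : ∃ c : ℂ, ‖c‖ = 1 ∧ a = ‖a‖ * c :=
  ⟨Complex.exp (Complex.arg a * Complex.I), Complex.norm_exp_ofReal_mul_I _,
    (Complex.norm_mul_exp_arg_mul_I a).symm⟩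

/-- If the states which make up a mixture are close to multiples of the states `e o` (where `o` is a
classical outcome), then the mixture is close to the ideal mixture of the states `e o`. -/
theorem traceDist_blockDiagonal_le {X K O : Type} [Fintype X] [DecidableEq X] [Fintype K] [Fintype O]
    [DecidableEq O] {ρ : O → Matrix X X ℂ} {u : K → X → ℂ} {out : K → O}
    (hρ : ∀ o x y, ρ o x y = ∑ κ, if out κ = o then u κ x * star (u κ y) else 0)
    {e : O → X → ℂ} (he : ∀ o, l2norm (e o) = 1) (a : K → ℂ) :
    traceDist (Matrix.blockDiagonal ρ)
      (Matrix.blockDiagonal fun o => (ρ o).trace • pure (e o)) ≤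
      2 * √(∑ κ, l2norm (u κ) ^ 2) * √(∑ κ, l2norm (u κ - a κ • e (out κ)) ^ 2) := by
  choose c hc ha using fun κ => exists_phase (a κ)
  -- the ideal states, with the norms of the actual ones
  let v : K → X → ℂ := fun κ => ((l2norm (u κ) : ℂ) * c κ) • e (out κ)
  let block : (K → X → ℂ) → K → X × O → ℂ := fun u κ p => if p.2 = out κ then u κ p.1 else 0
  have hblock : ∀ (u : K → X → ℂ) κ, l2norm (block u κ) = l2norm (u κ) := by
    intro u κ
    rw [l2norm_eq_sqrt, l2norm_eq_sqrt, Fintype.sum_prod_type]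
    congr 1
    refine Finset.sum_congr rfl fun x _ => ?_
    rw [Finset.sum_eq_single (out κ) (fun o _ ho => by simp [block, ho]) (by simp)]
    simp [block]
  have hv : ∀ κ, l2norm (v κ) = l2norm (u κ) := fun κ => by
    rw [l2norm_smul, he, norm_mul, hc, Complex.norm_real, Real.norm_of_nonneg (l2norm_nonneg _)]
    ring
  have htr : ∀ o, (ρ o).trace = ∑ κ, if out κ = o then ((l2norm (u κ) : ℂ)) ^ 2 else 0 := by
    intro o
    simp only [Matrix.trace, Matrix.diag_apply, hρ]
    rw [Finset.sum_comm]
    refine Finset.sum_congr rfl fun κ _ => ?_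
    split_ifs
    · rw [← Complex.ofReal_pow, l2norm_sq]
      push_cast
      exact Finset.sum_congr rfl fun x _ => by rw [RCLike.star_def, Complex.mul_conj']
    · simp
  have h := traceDist_le_of_sum (ρ := Matrix.blockDiagonal ρ)
    (σ := Matrix.blockDiagonal fun o => (ρ o).trace • pure (e o)) (u := block u) (v := block v)
    (fun ⟨x, o⟩ ⟨y, o'⟩ => ?_) (fun ⟨x, o⟩ ⟨y, o'⟩ => ?_)
  · have hsub : ∀ κ, block u κ - block v κ = block (fun κ => u κ - v κ) κ := fun κ => by
      funext p
      simp only [block, Pi.sub_apply]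
      split_ifs <;> simp
    simp only [hsub, hblock, hv] at h
    have hdist : ∀ κ, l2norm (u κ - v κ) ≤ 2 * l2norm (u κ - a κ • e (out κ)) := by
      intro κ
      have e1 : u κ - v κ = (u κ - a κ • e (out κ)) +
          (((‖a κ‖ - l2norm (u κ) : ℝ) : ℂ) * c κ) • e (out κ) := by
        have hak := ha κ
        simp only [v]
        generalize ‖a κ‖ = A at hak ⊢
        rw [hak]
        push_cast
        rw [sub_mul, sub_smul]
        abel
      have e2 := l2norm_add_le (u κ - a κ • e (out κ))
        ((((‖a κ‖ - l2norm (u κ) : ℝ) : ℂ) * c κ) • e (out κ))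
      rw [← e1, l2norm_smul, he, norm_mul, hc, Complex.norm_real, Real.norm_eq_abs] at e2
      have e3 : l2norm (a κ • e (out κ)) = ‖a κ‖ := by rw [l2norm_smul, he, mul_one]
      have e4 : |‖a κ‖ - l2norm (u κ)| ≤ l2norm (u κ - a κ • e (out κ)) := by
        rw [← e3, abs_sub_comm]
        exact abs_norm_sub_norm_le (WithLp.toLp 2 (u κ)) (WithLp.toLp 2 (a κ • e (out κ)))
      linarith
    have hcs := Real.sum_mul_le_sqrt_mul_sqrt Finset.univ (fun κ => l2norm (u κ))
      fun κ => l2norm (u κ - a κ • e (out κ))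
    refine h.trans ?_
    calc (1 / 2) * ∑ κ, (l2norm (u κ) + l2norm (u κ)) * l2norm (u κ - v κ)
        ≤ (1 / 2) * ∑ κ, (l2norm (u κ) + l2norm (u κ)) *
          (2 * l2norm (u κ - a κ • e (out κ))) := by
          refine mul_le_mul_of_nonneg_left (Finset.sum_le_sum fun κ _ =>
            mul_le_mul_of_nonneg_left (hdist κ) ?_) (by norm_num)
          linarith [l2norm_nonneg (u κ)]
      _ = 2 * ∑ κ, l2norm (u κ) * l2norm (u κ - a κ • e (out κ)) := by
          rw [Finset.mul_sum, Finset.mul_sum]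
          exact Finset.sum_congr rfl fun κ _ => by ring
      _ ≤ _ := by rw [mul_assoc]; exact mul_le_mul_of_nonneg_left hcs (by norm_num)
  · rw [Matrix.blockDiagonal_apply]
    by_cases ho : o = o'
    · subst ho
      rw [if_pos rfl, hρ]
      refine Finset.sum_congr rfl fun κ _ => ?_
      by_cases h : out κ = o
      · simp [block, h]
      · simp [block, h, Ne.symm h]
    · rw [if_neg ho]
      refine (Finset.sum_eq_zero fun κ _ => ?_).symm
      by_cases h : o = out κ
      · simp [block, show o' ≠ out κ from fun h' => ho (h.trans h'.symm)]
      · simp [block, h]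
  · rw [Matrix.blockDiagonal_apply]
    by_cases ho : o = o'
    · subst ho
      rw [if_pos rfl, Matrix.smul_apply, htr, smul_eq_mul, Finset.sum_mul]
      refine Finset.sum_congr rfl fun κ _ => ?_
      by_cases h : out κ = o
      · subst h
        simp only [block, v, pure, Matrix.vecMulVec_apply, if_true, Pi.smul_apply, smul_eq_mul,
          Pi.star_apply, star_mul', RCLike.star_def, Complex.conj_ofReal]
        have hcc : c κ * (starRingEnd ℂ) (c κ) = 1 := by
          rw [Complex.mul_conj', hc]; norm_num
        linear_combination (-((l2norm (u κ) : ℂ) ^ 2 * (e (out κ) x * (starRingEnd ℂ) (e (out κ) y)))) * hcc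
      · simp [block, h, Ne.symm h]
    · rw [if_neg ho]
      refine (Finset.sum_eq_zero fun κ _ => ?_).symm
      by_cases h : o = out κ
      · simp [block, show o' ≠ out κ from fun h' => ho (h.trans h'.symm)]
      · simp [block, h]

/-! ### Hellinger distance and the two preimages of a ciphertext -/

section Preimages

variable {M Y : Type}

/-- Two ways `enc false`, `enc true` of encrypting, ways `inv false`, `inv true` of inverting them, and
a decryption function `dec`: the ciphertext `y` is consistent for the way `a` if inversion succeeds and
decryption gives the encrypted bit, shifted by `s` for the second way. -/
def Consistent (enc : Bool → M → Y) (inv : Bool → Y → M) (bit : M → Bool) (dec : Y → Bool) (s : Bool)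
    (a : Bool) (y : Y) : Prop :=
  enc a (inv a y) = y ∧ dec y = (bit (inv a y) ^^ (a && s))

/-- The message `m` is handled correctly by the way `a`. -/
def Correct (enc : Bool → M → Y) (inv : Bool → Y → M) (bit : M → Bool) (dec : Y → Bool) (s : Bool)
    (a : Bool) (m : M) : Prop :=
  inv a (enc a m) = m ∧ dec (enc a m) = (bit m ^^ (a && s))

theorem correct_and_iff {enc : Bool → M → Y} {inv : Bool → Y → M} {bit : M → Bool} {dec : Y → Bool}
    {s a : Bool} {m : M} {y : Y} :
    (Correct enc inv bit dec s a m ∧ enc a m = y) ↔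
      (Consistent enc inv bit dec s a y ∧ m = inv a y) := by
  constructor
  · rintro ⟨⟨h1, h2⟩, rfl⟩
    exact ⟨⟨by rw [h1], by rw [h1]; exact h2⟩, h1.symm⟩
  · rintro ⟨⟨h1, h2⟩, rfl⟩
    exact ⟨⟨by rw [h1], by rw [h1]; exact h2⟩, h1⟩

variable [Fintype M]

/-- The distribution of `f m` for `m ← D`. -/
noncomputable def pushforward (D : M → ℝ) (f : M → Y) (y : Y) : ℝ := dprob D fun m => f m = y

theorem pushforward_eq [DecidableEq Y] (D : M → ℝ) (f : M → Y) (y : Y) :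
    pushforward D f y = ∑ m, if f m = y then D m else 0 :=
  Finset.sum_congr rfl fun m _ => by congr

variable (enc : Bool → M → Y) (inv : Bool → Y → M) (bit : M → Bool) (dec : Y → Bool) (s : Bool)

open Classical in
/-- The common amplitude of the two preimages of a ciphertext. -/
noncomputable def commonAmp (D : M → ℝ) (y : Y) : ℝ :=
  if Consistent enc inv bit dec s false y ∧ Consistent enc inv bit dec s true y
  then √(D (inv false y)) else 0

open Classical in
/-- The amplitude of the preimage of a ciphertext for the way `a`. -/
noncomputable def wayAmp (D : M → ℝ) (a : Bool) (y : Y) : ℝ :=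
  if Consistent enc inv bit dec s a y then √(D (inv a y)) else 0

variable {enc inv bit dec s}

/-- Among the messages with ciphertext `y` is the preimage found by inversion. -/
theorem wayAmp_sq_le {D : M → ℝ} (hD : ∀ m, 0 ≤ D m) (a : Bool) (y : Y) :
    wayAmp enc inv bit dec s D a y ^ 2 ≤ pushforward D (enc a) y := by
  classical
  rw [pushforward_eq]
  unfold wayAmp
  split_ifs with h
  · rw [Real.sq_sqrt (hD _)]
    have := Finset.single_le_sum (f := fun m => if enc a m = y then D m else 0)
      (fun m _ => by split_ifs <;> simp [hD]) (Finset.mem_univ (inv a y))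
    simpa [h.1] using this
  · rw [zero_pow two_ne_zero]
    exact Finset.sum_nonneg fun m _ => by split_ifs <;> simp [hD]

variable [Fintype Y]

theorem sum_pushforward (D : M → ℝ) (f : M → Y) : ∑ y, pushforward D f y = ∑ m, D m := by
  classical
  simp only [pushforward_eq]
  rw [Finset.sum_comm]
  simp

theorem sum_sq_sqrt_sub_sqrt {p q : Y → ℝ} (hp : ∀ y, 0 ≤ p y) (hq : ∀ y, 0 ≤ q y)
    (hp1 : ∑ y, p y = 1) (hq1 : ∑ y, q y = 1) :
    ∑ y, (√(p y) - √(q y)) ^ 2 = 2 * hellinger p q := by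
  have : ∀ y, (√(p y) - √(q y)) ^ 2 = p y + q y - 2 * √(p y * q y) := fun y => by
    rw [sub_sq, Real.sq_sqrt (hp y), Real.sq_sqrt (hq y), Real.sqrt_mul (hp y)]
    ring
  simp only [this, hellinger, Finset.sum_sub_distrib, Finset.sum_add_distrib, hp1, hq1,
    ← Finset.mul_sum]
  ring

open Classical in
/-- The amplitudes of the way `a` lose only the messages that it does not handle correctly. -/
theorem sum_wayAmp_sq {D : M → ℝ} (hD : ∀ m, 0 ≤ D m) (a : Bool) :
    ∑ y, wayAmp enc inv bit dec s D a y ^ 2 = dprob D (Correct enc inv bit dec s a) := by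
  have h1 : ∀ y, wayAmp enc inv bit dec s D a y ^ 2 =
      ∑ m, if Correct enc inv bit dec s a m ∧ enc a m = y then D m else 0 := by
    intro y
    simp only [correct_and_iff]
    rw [Finset.sum_eq_single (inv a y) (fun m _ hm => by simp [hm]) (by simp)]
    unfold wayAmp
    split_ifs with h h' h'
    · exact Real.sq_sqrt (hD _)
    · exact absurd ⟨h, rfl⟩ h'
    · exact absurd h'.1 h
    · simp
  simp only [h1, dprob]
  rw [Finset.sum_comm]
  refine Finset.sum_congr rfl fun m _ => ?_
  by_cases h : Correct enc inv bit dec s a m <;> simp [h]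

/-- The amplitudes of the preimages for the two ways are close. -/
theorem sum_wayAmp_sub_sq_le {D : M → ℝ} (hD : ∀ m, 0 ≤ D m) (hD1 : ∑ m, D m = 1) {ε : ℝ}
    (hcorr : ∀ a, 1 - 3 * ε ≤ dprob D (Correct enc inv bit dec s a))
    (hhell : hellinger (pushforward D (enc false)) (pushforward D (enc true)) ≤ ε) :
    ∑ y, (wayAmp enc inv bit dec s D false y - wayAmp enc inv bit dec s D true y) ^ 2 ≤ 24 * ε := by
  set w := wayAmp enc inv bit dec s D with hw
  have hw0 : ∀ a y, 0 ≤ w a y := fun a y => by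
    rw [hw]; unfold wayAmp; split_ifs <;> simp
  have hP0 : ∀ a y, 0 ≤ pushforward D (enc a) y := fun a y =>
    (sq_nonneg _).trans (wayAmp_sq_le (enc := enc) (inv := inv) (bit := bit) (dec := dec) (s := s) hD a y)
  have hP1 : ∀ a, ∑ y, pushforward D (enc a) y = 1 := fun a => by rw [sum_pushforward, hD1]
  have hdiff : ∀ a, ∑ y, (√(pushforward D (enc a) y) - w a y) ^ 2 ≤ 3 * ε := by
    intro a
    have h1 : ∀ y, (√(pushforward D (enc a) y) - w a y) ^ 2 ≤
        pushforward D (enc a) y - w a y ^ 2 := fun y => by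
      have h2 := wayAmp_sq_le (enc := enc) (inv := inv) (bit := bit) (dec := dec) (s := s) hD a y
      have h3 : w a y ≤ √(pushforward D (enc a) y) := Real.le_sqrt_of_sq_le h2
      have h4 := Real.sq_sqrt (hP0 a y)
      nlinarith [hw0 a y]
    refine (Finset.sum_le_sum fun y _ => h1 y).trans ?_
    rw [Finset.sum_sub_distrib, hP1, sum_wayAmp_sq hD]
    linarith [hcorr a]
  have hmid := sum_sq_sqrt_sub_sqrt (hP0 false) (hP0 true) (hP1 false) (hP1 true)
  -- from one amplitude to the other by way of the roots of the two laws: `3 (3ε + 2ε + 3ε) = 24ε`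
  have hpt : ∀ y, (w false y - w true y) ^ 2 ≤
      3 * ((√(pushforward D (enc false) y) - w false y) ^ 2 +
        (√(pushforward D (enc false) y) - √(pushforward D (enc true) y)) ^ 2 +
        (√(pushforward D (enc true) y) - w true y) ^ 2) := fun y => by
    generalize √(pushforward D (enc false) y) = p
    generalize √(pushforward D (enc true) y) = q
    nlinarith [sq_nonneg ((p - w false y) + (p - q)), sq_nonneg ((p - q) - (q - w true y)),
      sq_nonneg ((p - w false y) + (q - w true y)), sq_nonneg (2 * p - w false y - q)]
  refine (Finset.sum_le_sum fun y _ => hpt y).trans ?_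
  rw [← Finset.mul_sum, Finset.sum_add_distrib, Finset.sum_add_distrib]
  linarith [hdiff false, hdiff true]

theorem sum_commonAmp_sq_le {D : M → ℝ} (hD : ∀ m, 0 ≤ D m) (hD1 : ∑ m, D m = 1) :
    ∑ y, commonAmp enc inv bit dec s D y ^ 2 ≤ 1 := by
  classical
  calc ∑ y, commonAmp enc inv bit dec s D y ^ 2
      ≤ ∑ y, wayAmp enc inv bit dec s D false y ^ 2 := by
        refine Finset.sum_le_sum fun y _ => ?_
        unfold commonAmp wayAmp
        split_ifs with h1 h2 h2
        · exact le_rfl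
        · exact absurd h1.1 h2
        · simp
        · exact le_rfl
    _ = dprob D (Correct enc inv bit dec s false) := sum_wayAmp_sq hD false
    _ ≤ ∑ m, D m := Finset.sum_le_sum fun m _ => by split_ifs <;> simp [hD]
    _ = 1 := hD1

/-- For each way, the amplitudes of the pairs of a message and its ciphertext are close to the common
amplitudes of the pairs of a ciphertext and its preimage. -/
theorem sum_amp_sub_le [DecidableEq M] [DecidableEq Y] {D : M → ℝ} (hD : ∀ m, 0 ≤ D m) (hD1 : ∑ m, D m = 1) {ε : ℝ}
    (hcorr : ∀ a, 1 - 3 * ε ≤ dprob D (Correct enc inv bit dec s a))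
    (hhell : hellinger (pushforward D (enc false)) (pushforward D (enc true)) ≤ ε) (a : Bool) :
    ∑ m, ∑ y, ((if enc a m = y then √(D m) else 0) -
      (if inv a y = m then commonAmp enc inv bit dec s D y else 0)) ^ 2 ≤ 27 * ε := by
  classical
  set w := wayAmp enc inv bit dec s D with hw
  -- either `m` is not handled correctly, or the error is the difference of the two ways
  have hpt : ∀ m y, ((if enc a m = y then √(D m) else 0) -
      (if inv a y = m then commonAmp enc inv bit dec s D y else 0)) ^ 2 ≤
      (if ¬ Correct enc inv bit dec s a m ∧ enc a m = y then D m else 0) +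
      (if m = inv a y then (w false y - w true y) ^ 2 else 0) := by
    intro m y
    by_cases hc : Correct enc inv bit dec s a m ∧ enc a m = y
    · have hc' := correct_and_iff.1 hc
      rw [if_pos hc.2, if_pos hc'.2.symm, if_neg (fun h => h.1 hc.1), if_pos hc'.2, zero_add,
        hc'.2]
      have hcons := hc'.1
      simp only [hw, wayAmp, commonAmp]
      cases a
      · by_cases h : Consistent enc inv bit dec s true y
        · simp [h, hcons, sq_nonneg]
        · simp [h, hcons]
      · by_cases h : Consistent enc inv bit dec s false y
        · simp only [h, hcons, and_self, if_true]
          exact le_of_eq (by ring)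
        · simp [h, hcons]
    · have hcons : m = inv a y → commonAmp enc inv bit dec s D y = 0 := fun hm => by
        refine if_neg fun h => hc (correct_and_iff.2 ⟨?_, hm⟩)
        cases a
        · exact h.1
        · exact h.2
      have h2 : (0 : ℝ) ≤ if m = inv a y then (w false y - w true y) ^ 2 else 0 := by
        split_ifs <;> positivity
      have h3 : (if inv a y = m then commonAmp enc inv bit dec s D y else 0) = 0 := by
        split_ifs with h
        · exact hcons h.symm
        · rfl
      rw [h3, sub_zero]
      by_cases h : enc a m = y
      · rw [if_pos h, if_pos ⟨fun h' => hc ⟨h', h⟩, h⟩, Real.sq_sqrt (hD m)]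
        linarith
      · rw [if_neg h, if_neg fun h' => h h'.2]
        simpa using h2
  refine (Finset.sum_le_sum fun m _ => Finset.sum_le_sum fun y _ => hpt m y).trans ?_
  simp only [Finset.sum_add_distrib]
  have e1 : ∑ m, ∑ y, (if ¬ Correct enc inv bit dec s a m ∧ enc a m = y then D m else 0) =
      1 - dprob D (Correct enc inv bit dec s a) := by
    rw [← hD1, dprob, ← Finset.sum_sub_distrib]
    refine Finset.sum_congr rfl fun m _ => ?_
    by_cases h : Correct enc inv bit dec s a m <;> simp [h]
  have e2 : ∑ m, ∑ y, (if m = inv a y then (w false y - w true y) ^ 2 else 0) =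
      ∑ y, (w false y - w true y) ^ 2 := by
    rw [Finset.sum_comm]
    simp
  rw [e1, e2]
  linarith [hcorr a, sum_wayAmp_sub_sq_le hD hD1 hcorr hhell]

end Preimages

/-! ### Hadamard transform and Pauli operators -/

/-- The sign `(-1)^b`. -/
def sgn (b : Bool) : ℂ := if b then -1 else 1

theorem sgn_xor (a b : Bool) : sgn (a ^^ b) = sgn a * sgn b := by
  cases a <;> cases b <;> simp [sgn]

theorem sgn_mul_self (a : Bool) : sgn a * sgn a = 1 := by
  cases a <;> simp [sgn]

theorem norm_sgn (a : Bool) : ‖sgn a‖ = 1 := by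
  cases a <;> simp [sgn]

theorem hadamard_eq {n : ℕ} (d m : Bits n) :
    hadamard d m = (((Real.sqrt 2 : ℝ) : ℂ)⁻¹) ^ n * sgn (AltScheme.dot d m) := by
  have h : ∏ t, (if d t && m t then (-1 : ℂ) else 1) = sgn (AltScheme.dot d m) := by
    rw [Finset.prod_ite, Finset.prod_const, Finset.prod_const_one, mul_one, AltScheme.dot, sgn]
    rcases Nat.even_or_odd (Finset.univ.filter fun j => (d j && m j) = true).card with h | h
    · rw [h.neg_one_pow, if_neg]
      simpa using h
    · rw [h.neg_one_pow, if_pos]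
      simpa using h
  rw [hadamard, h]

theorem sgn_dot_xor {n : ℕ} (d m m' : Bits n) :
    sgn (AltScheme.dot d fun j => m j ^^ m' j) =
      sgn (AltScheme.dot d m) * sgn (AltScheme.dot d m') := by
  have hc : (((Real.sqrt 2 : ℝ) : ℂ)⁻¹) ^ n ≠ 0 := by simp
  have h : ∀ m : Bits n, sgn (AltScheme.dot d m) = ∏ t, (if d t && m t then (-1 : ℂ) else 1) :=
    fun m => (mul_left_cancel₀ hc (hadamard_eq d m)).symm
  rw [h, h, h, ← Finset.prod_mul_distrib]
  refine Finset.prod_congr rfl fun t _ => ?_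
  cases d t <;> cases m t <;> cases m' t <;> simp

theorem norm_hadamard_sq {n : ℕ} (d m : Bits n) : ‖hadamard d m‖ ^ 2 = (2 ^ n : ℝ)⁻¹ := by
  rw [hadamard_eq, norm_mul, norm_sgn, mul_one, norm_pow, norm_inv, Complex.norm_real,
    Real.norm_of_nonneg (Real.sqrt_nonneg 2), ← pow_mul, mul_comm n 2, pow_mul, inv_pow,
    Real.sq_sqrt (by norm_num), inv_pow]

theorem sum_hadamard_mul {n : ℕ} (m m' : Bits n) :
    ∑ d, hadamard m d * hadamard d m' = if m = m' then 1 else 0 := by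
  have h : ∀ d : Bits n, hadamard m d * hadamard d m' =
      ∏ t, ((1 / 2 : ℂ) * ((if m t && d t then -1 else 1) * if d t && m' t then -1 else 1)) := by
    intro d
    have h2 : (((Real.sqrt 2 : ℝ) : ℂ)⁻¹) * (((Real.sqrt 2 : ℝ) : ℂ)⁻¹) = 1 / 2 := by
      rw [← mul_inv, ← Complex.ofReal_mul, Real.mul_self_sqrt (by norm_num)]
      norm_num
    rw [Finset.prod_mul_distrib, Finset.prod_mul_distrib, Finset.prod_const, Finset.card_univ,
      Fintype.card_fin, ← h2, mul_pow, hadamard, hadamard]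
    ring
  simp only [h]
  have h3 := (Finset.prod_univ_sum (fun _ : Fin n => (Finset.univ : Finset Bool)) fun t v =>
      ((1 / 2 : ℂ) * ((if m t && v then -1 else 1) * if v && m' t then -1 else 1))).symm
  rw [Fintype.piFinset_univ] at h3
  rw [h3]
  split_ifs with hm
  · subst hm
    refine Finset.prod_eq_one fun t _ => ?_
    rw [Fintype.sum_bool]
    cases m t <;> norm_num
  · obtain ⟨t, ht⟩ := Function.ne_iff.1 hm
    refine Finset.prod_eq_zero (Finset.mem_univ t) ?_
    rw [Fintype.sum_bool]
    revert ht
    cases m t <;> cases m' t <;> norm_num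

/-- The Hadamard transform is unitary. -/
theorem sum_norm_hadamard_sq {n : ℕ} (f : Bits n → ℂ) :
    ∑ d, ‖∑ m, hadamard d m * f m‖ ^ 2 = ∑ m, ‖f m‖ ^ 2 := by
  have hstar : ∀ d m : Bits n, star (hadamard d m) = hadamard m d := by
    intro d m
    rw [hadamard, hadamard, star_mul', star_pow, star_prod]
    congr 1
    · rw [RCLike.star_def, map_inv₀, Complex.conj_ofReal]
    · exact Finset.prod_congr rfl fun t _ => by cases d t <;> cases m t <;> simp
  let H : Matrix (Bits n) (Bits n) ℂ := hadamard
  have hH : star H = H := by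
    funext d m
    exact hstar m d
  have hHH : H * H = 1 := by
    funext m m'
    rw [Matrix.mul_apply, Matrix.one_apply]
    exact sum_hadamard_mul m m'
  have hU : H ∈ Matrix.unitaryGroup (Bits n) ℂ :=
    Matrix.mem_unitaryGroup_iff.2 (by rw [hH, hHH])
  have := l2norm_unitary ⟨H, hU⟩ f
  rw [← l2norm_sq f, ← this, l2norm_sq]
  simp only [hH]
  rfl

/-- Add `v` to the second bit. -/
def xorSecond (v : Bool) (x : Bits 2) : Bits 2 := ![x 0, x 1 ^^ v]

theorem xorSecond_xorSecond (v : Bool) (x : Bits 2) : xorSecond v (xorSecond v x) = x := by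
  funext j
  fin_cases j <;> simp [xorSecond]

theorem sum_xorSecond (v : Bool) (F : Bits 2 → ℝ) : ∑ x, F (xorSecond v x) = ∑ x, F x :=
  Equiv.sum_comp (Function.Involutive.toPerm (xorSecond v) (xorSecond_xorSecond v)) F

theorem pauli_mulVec (z x : Bits 2) (ψ : Bits 2 → ℂ) (b : Bits 2) :
    (pauli z x).mulVec ψ b = sgn (z 0 && b 0) * sgn (z 1 && b 1) * ψ ![b 0 ^^ x 0, b 1 ^^ x 1] := by
  have h : ∀ b' : Bits 2, (b = fun j => b' j ^^ x j) ↔ b' = ![b 0 ^^ x 0, b 1 ^^ x 1] := by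
    intro b'
    constructor
    · intro h
      rw [h]
      funext j
      fin_cases j <;> simp
    · intro h
      rw [h]
      funext j
      fin_cases j <;> simp
  rw [pauli, ← Matrix.mulVec_mulVec, pauliZ, Matrix.mulVec_diagonal, Fin.prod_univ_two]
  congr 1
  simp only [Matrix.mulVec, dotProduct, pauliX, h]
  simp

theorem cnot_pow_mulVec (s : Bool) (ψ : Bits 2 → ℂ) (b : Bits 2) :
    (cnot ^ s.toNat).mulVec ψ b = ψ (xorSecond (b 0 && s) b) := by
  have h : ∀ b' : Bits 2, (b = ![b' 0, b' 0 ^^ b' 1]) ↔ b' = ![b 0, b 1 ^^ b 0] := by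
    intro b'
    constructor
    · intro h
      rw [h]
      funext j
      fin_cases j <;> simp [Bool.xor_comm]
    · intro h
      rw [h]
      funext j
      fin_cases j <;> simp [Bool.xor_comm]
  cases s
  · simp only [Bool.toNat_false, pow_zero, Matrix.one_mulVec, Bool.and_false]
    congr 1
    funext j
    fin_cases j <;> simp [xorSecond]
  · simp only [Bool.toNat_true, pow_one, Bool.and_true]
    simp only [Matrix.mulVec, dotProduct, cnot, h]
    simp [xorSecond]

theorem sum_norm_pauli_sq (z x : Bits 2) (ψ : Bits 2 → ℂ) :
    ∑ b, ‖(pauli z x).mulVec ψ b‖ ^ 2 = ∑ b, ‖ψ b‖ ^ 2 := by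
  have hinv : Function.Involutive fun b : Bits 2 => (![b 0 ^^ x 0, b 1 ^^ x 1] : Bits 2) := by
    intro b
    funext j
    fin_cases j <;> simp
  simp only [pauli_mulVec, norm_mul, norm_sgn, one_mul]
  exact Equiv.sum_comp hinv.toPerm fun b => ‖ψ b‖ ^ 2

theorem sum_norm_cnot_pauli_sq (s : Bool) (z x : Bits 2) (ψ : Bits 2 → ℂ) :
    ∑ b, ‖(cnot ^ s.toNat * pauli z x).mulVec ψ b‖ ^ 2 = ∑ b, ‖ψ b‖ ^ 2 := by
  have hinv : Function.Involutive fun b : Bits 2 => xorSecond (b 0 && s) b := by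
    intro b
    funext j
    fin_cases j <;> simp [xorSecond]
  rw [← sum_norm_pauli_sq z x ψ]
  simp only [← Matrix.mulVec_mulVec, cnot_pow_mulVec]
  exact Equiv.sum_comp hinv.toPerm fun b => ‖(pauli z x).mulVec ψ b‖ ^ 2

/-- The encrypted CNOT: if `m₀` and `m₁` are the two preimages, whose first bits differ by `s`, then
adding the first bit of `m_a` to the second qubit (where `a` is the value of the first one) and
measuring `m_a` in the Hadamard basis amounts to a CNOT and an update of the Pauli keys. -/
theorem hadamard_mul_pauli_xorSecond {r : ℕ} (s : Bool) (z x : Bits 2) (ψ : Bits 2 → ℂ)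
    (d : Bits (r + 1)) (m : Bool → Bits (r + 1)) (hm : m true 0 = (m false 0 ^^ s)) (b : Bits 2) :
    hadamard d (m (b 0)) * (pauli z x).mulVec ψ (xorSecond (m (b 0) 0) b) =
      hadamard d (m false) * sgn (z 1 && m false 0) *
        (cnot ^ s.toNat * pauli
          ![z 0 ^^ AltScheme.dot d (fun j => m false j ^^ m true j), z 1]
          ![x 0, x 1 ^^ m false 0]).mulVec ψ b := by
  have h1 : m (b 0) 0 = (m false 0 ^^ (b 0 && s)) := by
    cases b 0 <;> simp [hm]
  have h2 : hadamard d (m (b 0)) = hadamard d (m false) *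
      sgn (AltScheme.dot d (fun j => m false j ^^ m true j) && b 0) := by
    rw [hadamard_eq, hadamard_eq]
    cases b 0
    · simp [sgn]
    · rw [Bool.and_true, sgn_dot_xor, mul_assoc, ← mul_assoc (sgn (AltScheme.dot d (m false))),
        sgn_mul_self, one_mul]
  rw [← Matrix.mulVec_mulVec, cnot_pow_mulVec, pauli_mulVec, pauli_mulVec, h1, h2]
  have h3 : (![xorSecond (m false 0 ^^ (b 0 && s)) b 0 ^^ x 0,
      xorSecond (m false 0 ^^ (b 0 && s)) b 1 ^^ x 1] : Bits 2) =
      ![xorSecond (b 0 && s) b 0 ^^ (![x 0, x 1 ^^ m false 0] : Bits 2) 0,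
        xorSecond (b 0 && s) b 1 ^^ (![x 0, x 1 ^^ m false 0] : Bits 2) 1] := by
    funext j
    fin_cases j
    · simp [xorSecond]
    · simp only [xorSecond, Matrix.cons_val_zero, Matrix.cons_val_one, Fin.mk_one]
      cases b 1 <;> cases m false 0 <;> cases (b 0 && s) <;> cases x 1 <;> rfl
  rw [h3]
  have h4 : sgn (z 1 && xorSecond (m false 0 ^^ (b 0 && s)) b 1) =
      sgn (z 1 && m false 0) * sgn (z 1 && xorSecond (b 0 && s) b 1) := by
    rw [← sgn_xor, ← Bool.and_xor_distrib_left]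
    congr 2
    simp only [xorSecond, Matrix.cons_val_one]
    cases b 1 <;> cases m false 0 <;> cases (b 0 && s) <;> rfl
  have h5 : sgn ((![z 0 ^^ AltScheme.dot d (fun j => m false j ^^ m true j), z 1] : Bits 2) 0 &&
      xorSecond (b 0 && s) b 0) =
      sgn (z 0 && b 0) * sgn (AltScheme.dot d (fun j => m false j ^^ m true j) && b 0) := by
    rw [← sgn_xor, ← Bool.and_xor_distrib_right]
    rfl
  rw [h4, h5]
  simp only [xorSecond, Matrix.cons_val_zero, Matrix.cons_val_one]
  ring

/-! ### The state after the encrypted CNOT -/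

theorem norm_add_sq_le (a b : ℂ) : ‖a + b‖ ^ 2 ≤ 2 * ‖a‖ ^ 2 + 2 * ‖b‖ ^ 2 := by
  have := norm_add_le a b
  nlinarith [norm_nonneg (a + b), sq_nonneg (‖a‖ - ‖b‖), norm_nonneg a, norm_nonneg b]

theorem l2norm_add_sq_le {X : Type} [Fintype X] (u v : X → ℂ) :
    l2norm (u + v) ^ 2 ≤ 2 * l2norm u ^ 2 + 2 * l2norm v ^ 2 := by
  have := l2norm_add_le u v
  nlinarith [l2norm_nonneg (u + v), sq_nonneg (l2norm u - l2norm v), l2norm_nonneg u,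
    l2norm_nonneg v]

/-- A state whose reduced density matrix is close to a pure state `v` is close to a product of `v`
with some state of the other qubits. -/
theorem exists_product_approx {M G : Type} [Fintype M] [DecidableEq M] [Fintype G] {v : M → ℂ}
    (hv : ∑ m, ‖v m‖ ^ 2 = 1) {τ : M → G → ℂ} {R : Matrix M M ℂ}
    (hR : ∀ x y, R x y = ∑ g, τ x g * star (τ y g)) {ε : ℝ} (hε : traceDist R (pure v) ≤ ε) :
    ∃ γ : G → ℂ, ∑ m, ∑ g, ‖τ m g - v m * γ g‖ ^ 2 ≤ 4 * ε ∧ ∑ g, ‖γ g‖ ^ 2 ≤ 1 + 2 * ε ∧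
      ∑ m, ∑ g, ‖τ m g‖ ^ 2 ≤ 1 + 2 * ε := by
  have hv1 : l2norm v = 1 := by rw [l2norm_eq_sqrt, hv, Real.sqrt_one]
  have hpure : ∀ x y, pure v x y = ∑ _i : Unit, v x * star (v y) := fun x y => by
    simp [pure, Matrix.vecMulVec_apply]
  have hH : (R - pure v).IsHermitian :=
    (isHermitian_of_sum (u := fun g m => τ m g) hR).sub (isHermitian_of_sum (u := fun _ => v) hpure)
  have hvv : star v ⬝ᵥ v = 1 := by
    rw [dotProduct]
    simp only [Pi.star_apply, RCLike.star_def, Complex.conj_mul']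
    exact_mod_cast hv
  -- the partial inner product with `v`
  let γ : G → ℂ := fun g => star v ⬝ᵥ fun m => τ m g
  have htr := (abs_le.1 (abs_trace_sub_le hH))
  have hex := (abs_le.1 (abs_expectation_sub_le hH hv1.le))
  have hT : (R - pure v).trace.re = ∑ m, ∑ g, ‖τ m g‖ ^ 2 - 1 := by
    rw [Matrix.trace_sub, Complex.sub_re]
    congr 1
    · simp only [Matrix.trace, Matrix.diag_apply, hR, RCLike.star_def, Complex.mul_conj']
      norm_cast
    · rw [← hv]
      simp only [Matrix.trace, Matrix.diag_apply, pure, Matrix.vecMulVec_apply, Pi.star_apply,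
        RCLike.star_def, Complex.mul_conj']
      norm_cast
  have hE : (star v ⬝ᵥ (R - pure v).mulVec v).re = ∑ g, ‖γ g‖ ^ 2 - 1 := by
    rw [Matrix.sub_mulVec, dotProduct_sub,
      star_dotProduct_mulVec_of_sum (u := fun g m => τ m g) hR,
      star_dotProduct_mulVec_of_sum (u := fun _ => v) hpure, Complex.sub_re, Complex.ofReal_re,
      Complex.ofReal_re, hvv]
    simp [γ]
  have hsplit : ∀ g, ∑ m, ‖τ m g - v m * γ g‖ ^ 2 = ∑ m, ‖τ m g‖ ^ 2 - ‖γ g‖ ^ 2 := by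
    intro g
    have h1 : ∀ m, ‖τ m g - v m * γ g‖ ^ 2 = ‖τ m g‖ ^ 2 + ‖v m‖ ^ 2 * ‖γ g‖ ^ 2 -
        2 * ((starRingEnd ℂ (v m) * τ m g) * starRingEnd ℂ (γ g)).re := by
      intro m
      rw [← Complex.normSq_eq_norm_sq, Complex.normSq_sub, Complex.normSq_eq_norm_sq,
        Complex.normSq_eq_norm_sq, norm_mul, mul_pow, map_mul]
      ring_nf
    simp only [h1, Finset.sum_sub_distrib, Finset.sum_add_distrib, ← Finset.sum_mul,
      ← Finset.mul_sum, hv]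
    rw [← Complex.re_sum, ← Finset.sum_mul]
    have h2 : ∑ m, starRingEnd ℂ (v m) * τ m g = γ g := rfl
    rw [h2, Complex.mul_conj', ← Complex.ofReal_pow, Complex.ofReal_re]
    ring
  refine ⟨γ, ?_, by linarith, by linarith⟩
  rw [Finset.sum_comm]
  simp only [hsplit, Finset.sum_sub_distrib]
  rw [Finset.sum_comm]
  linarith

section EncryptedCnot

variable {r : ℕ} {Y G : Type} [Fintype Y] [Fintype G]

/-- The Hadamard transform of the message register keeps distances. -/
theorem sum_hadamard_amp (F : G → Y → Bits 2 → Bits (r + 1) → ℂ) :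
    ∑ g, ∑ y, ∑ d, l2norm (fun x => ∑ m, hadamard d m * F g y x m) ^ 2 =
      ∑ g, ∑ y, ∑ x, ∑ m, ‖F g y x m‖ ^ 2 := by
  refine Finset.sum_congr rfl fun g _ => Finset.sum_congr rfl fun y _ => ?_
  simp only [l2norm_sq]
  rw [Finset.sum_comm]
  exact Finset.sum_congr rfl fun x _ => sum_norm_hadamard_sq _

variable [DecidableEq Y]

/-- The amplitudes after the controlled encryption, for the two qubits `x`, the message register `m`,
the rest `g` of the preparation register and the ciphertext `y`. -/
noncomputable def cipherAmp (enc : Bool → Bits (r + 1) → Y) (τ : Bits (r + 1) → G → ℂ)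
    (φ : Bits 2 → ℂ) (g : G) (y : Y) (x : Bits 2) (m : Bits (r + 1)) : ℂ :=
  if enc (x 0) m = y then φ (xorSecond (m 0) x) * τ m g else 0

/-- An approximation of `cipherAmp`, given the preimages and the amplitudes of the ciphertexts. -/
noncomputable def idealAmp (inv : Bool → Y → Bits (r + 1)) (q : Y → ℝ) (γ : G → ℂ)
    (φ : Bits 2 → ℂ) (g : G) (y : Y) (x : Bits 2) (m : Bits (r + 1)) : ℂ :=
  if inv (x 0) y = m then φ (xorSecond (m 0) x) * (q y * γ g) else 0

/-- Adding the message bit to the second qubit keeps the first qubit and the weights of the state. -/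
theorem sum_weighted_xorSecond {φ : Bits 2 → ℂ} (hφ : ∑ x, ‖φ x‖ ^ 2 = 1)
    (F : Bool → Bits (r + 1) → ℝ) {B : ℝ} (hF : ∀ a, ∑ m, F a m ≤ B) :
    ∑ x, ∑ m : Bits (r + 1), ‖φ (xorSecond (m 0) x)‖ ^ 2 * F (x 0) m ≤ B := by
  rw [Finset.sum_comm]
  have h : ∀ m : Bits (r + 1), ∑ x, ‖φ (xorSecond (m 0) x)‖ ^ 2 * F (x 0) m =
      ∑ x, ‖φ x‖ ^ 2 * F (x 0) m := fun m =>
    sum_xorSecond (m 0) fun x => ‖φ x‖ ^ 2 * F (x 0) m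
  simp only [h]
  rw [Finset.sum_comm]
  simp only [← Finset.mul_sum]
  calc ∑ x, ‖φ x‖ ^ 2 * ∑ m, F (x 0) m ≤ ∑ x, ‖φ x‖ ^ 2 * B :=
        Finset.sum_le_sum fun x _ => mul_le_mul_of_nonneg_left (hF _) (by positivity)
    _ = B := by rw [← Finset.sum_mul, hφ, one_mul]

theorem sum_cipherAmp_sq_le {enc : Bool → Bits (r + 1) → Y} {τ : Bits (r + 1) → G → ℂ}
    {φ : Bits 2 → ℂ} (hφ : ∑ x, ‖φ x‖ ^ 2 = 1) :
    ∑ g, ∑ y, ∑ x, ∑ m, ‖cipherAmp enc τ φ g y x m‖ ^ 2 ≤ ∑ m, ∑ g, ‖τ m g‖ ^ 2 := by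
  have h : ∀ g x m, ∑ y, ‖cipherAmp enc τ φ g y x m‖ ^ 2 =
      ‖φ (xorSecond (m 0) x)‖ ^ 2 * ‖τ m g‖ ^ 2 := fun g x m => by
    rw [Finset.sum_eq_single (enc (x 0) m)]
    · rw [cipherAmp, if_pos rfl, norm_mul, mul_pow]
    · intro y _ hy
      rw [cipherAmp, if_neg hy.symm, norm_zero, zero_pow two_ne_zero]
    · simp
  rw [Finset.sum_comm (s := (Finset.univ : Finset (Bits (r + 1))))]
  refine Finset.sum_le_sum fun g _ => ?_
  rw [Finset.sum_comm]
  refine le_trans (le_of_eq ?_) (sum_weighted_xorSecond hφ (fun _ m => ‖τ m g‖ ^ 2) fun _ => le_rfl)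
  refine Finset.sum_congr rfl fun x _ => ?_
  rw [Finset.sum_comm]
  exact Finset.sum_congr rfl fun m _ => h g x m

/-- The errors of the preparation (`B₁`) and of the replacement of the amplitudes of messages by those of
ciphertexts (`B₂`) add up. -/
theorem sum_cipherAmp_sub_idealAmp_le {enc : Bool → Bits (r + 1) → Y}
    {inv : Bool → Y → Bits (r + 1)} {τ : Bits (r + 1) → G → ℂ} {φ : Bits 2 → ℂ}
    (hφ : ∑ x, ‖φ x‖ ^ 2 = 1) {v : Bits (r + 1) → ℝ} {q : Y → ℝ} {γ : G → ℂ} {B₁ B₂ B₃ : ℝ}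
    (h₁ : ∑ m, ∑ g, ‖τ m g - v m * γ g‖ ^ 2 ≤ B₁)
    (h₂ : ∀ a, ∑ m, ∑ y, ((if enc a m = y then v m else 0) - (if inv a y = m then q y else 0)) ^ 2 ≤ B₂)
    (h₃ : ∑ g, ‖γ g‖ ^ 2 ≤ B₃) :
    ∑ g, ∑ y, ∑ x, ∑ m, ‖cipherAmp enc τ φ g y x m - idealAmp inv q γ φ g y x m‖ ^ 2 ≤
      2 * B₁ + 2 * (B₃ * B₂) := by
  have hB₂ : 0 ≤ B₂ := (h₂ false).trans' (Finset.sum_nonneg fun _ _ => Finset.sum_nonneg fun _ _ =>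
    sq_nonneg _)
  let e : Y → Bool → Bits (r + 1) → ℝ := fun y a m =>
    (if enc a m = y then v m else 0) - (if inv a y = m then q y else 0)
  have hpt : ∀ g y x m, ‖cipherAmp enc τ φ g y x m - idealAmp inv q γ φ g y x m‖ ^ 2 ≤
      2 * ‖cipherAmp enc (fun m g => τ m g - v m * γ g) φ g y x m‖ ^ 2 +
      2 * (‖γ g‖ ^ 2 * (‖φ (xorSecond (m 0) x)‖ ^ 2 * e y (x 0) m ^ 2)) := by
    intro g y x m
    have h := norm_add_sq_le (cipherAmp enc (fun m g => τ m g - v m * γ g) φ g y x m)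
      (γ g * (φ (xorSecond (m 0) x) * (e y (x 0) m : ℂ)))
    rw [norm_mul, norm_mul, mul_pow, mul_pow, Complex.norm_real, Real.norm_eq_abs, sq_abs] at h
    convert h using 3
    simp only [cipherAmp, idealAmp, e]
    split_ifs <;> push_cast <;> ring
  refine (Finset.sum_le_sum fun g _ => Finset.sum_le_sum fun y _ => Finset.sum_le_sum fun x _ =>
    Finset.sum_le_sum fun m _ => hpt g y x m).trans ?_
  simp only [Finset.sum_add_distrib, ← Finset.mul_sum]
  refine add_le_add (mul_le_mul_of_nonneg_left ((sum_cipherAmp_sq_le hφ).trans h₁) (by norm_num))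
    (mul_le_mul_of_nonneg_left ?_ (by norm_num))
  have hy : ∑ y, ∑ x, ∑ m : Bits (r + 1), ‖φ (xorSecond (m 0) x)‖ ^ 2 * e y (x 0) m ^ 2 ≤ B₂ := by
    refine le_trans (le_of_eq ?_) (sum_weighted_xorSecond hφ (fun a m => ∑ y, e y a m ^ 2) h₂)
    rw [Finset.sum_comm]
    refine Finset.sum_congr rfl fun x _ => ?_
    rw [Finset.sum_comm]
    exact Finset.sum_congr rfl fun m _ => by rw [Finset.mul_sum]
  rw [← Finset.sum_mul]
  exact mul_le_mul h₃ hy (Finset.sum_nonneg fun y _ => Finset.sum_nonneg fun x _ =>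
    Finset.sum_nonneg fun m _ => by positivity) (h₃.trans' (Finset.sum_nonneg fun _ _ => by positivity))

/-- Randomized post-processing `out` of the measurement results: if it nearly always yields the outcome
`good` and the states belonging to the measurement results are close to multiples of the states `e` of
the good outcomes, then the resulting mixture is close to ideal. -/
theorem traceDist_postprocess_le {X K C O : Type} [Fintype X] [DecidableEq X] [Fintype K] [Fintype C]
    [Nonempty C] [Fintype O] [DecidableEq O] {ρ : O → Matrix X X ℂ} {u : K → X → ℂ} {κ : ℂ}
    (hκ : ‖κ‖ ^ 2 * Fintype.card C = 1) {out : K → C → O}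
    (hρ : ∀ o x y, ρ o x y =
      ∑ p : K × C, if out p.1 p.2 = o then (κ * u p.1 x) * star (κ * u p.1 y) else 0)
    {E : Type} {e : E → X → ℂ} (he : ∀ o, l2norm (e o) = 1) (lab : O → E) (good : K → E) {δ : ℝ}
    (hgood : ∀ k, 1 - δ ≤ uprob fun c => lab (out k c) = good k) {a : K → ℂ} {A B T : ℝ}
    (hA : ∑ k, ‖a k‖ ^ 2 ≤ A) (hB : ∑ k, l2norm (u k - a k • e (good k)) ^ 2 ≤ B)
    (hT : ∑ k, l2norm (u k) ^ 2 ≤ T) (hδ : 0 ≤ δ) :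
    traceDist (Matrix.blockDiagonal ρ)
      (Matrix.blockDiagonal fun o => (ρ o).trace • pure (e (lab o))) ≤
      2 * √T * √(2 * B + 2 * (δ * A)) := by
  classical
  have hC : (0 : ℝ) < Fintype.card C := by exact_mod_cast Fintype.card_pos
  have hκ' : ‖κ‖ ^ 2 = (Fintype.card C : ℝ)⁻¹ := eq_inv_of_mul_eq_one_left hκ
  have hfun : ∀ k, (fun x => κ * u k x) = κ • u k := fun k => rfl
  refine (traceDist_blockDiagonal_le (u := fun (p : K × C) x => κ * u p.1 x)
    (out := fun p => out p.1 p.2) hρ (e := fun o => e (lab o)) (fun o => he _)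
    (fun p => if lab (out p.1 p.2) = good p.1 then κ * a p.1 else 0)).trans ?_
  refine mul_le_mul (mul_le_mul_of_nonneg_left (Real.sqrt_le_sqrt ?_) (by norm_num))
    (Real.sqrt_le_sqrt ?_) (Real.sqrt_nonneg _) (by positivity)
  · refine le_trans (le_of_eq ?_) hT
    rw [Fintype.sum_prod_type]
    refine Finset.sum_congr rfl fun k _ => ?_
    simp only [hfun, l2norm_smul, mul_pow, Finset.sum_const, Finset.card_univ, nsmul_eq_mul]
    linear_combination (l2norm (u k) ^ 2) * hκ
  · rw [Fintype.sum_prod_type]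
    have hk : ∀ k, ∑ c, l2norm ((fun x => κ * u k x) -
        (if lab (out k c) = good k then κ * a k else 0) • e (lab (out k c))) ^ 2 ≤
        2 * l2norm (u k - a k • e (good k)) ^ 2 + 2 * (δ * ‖a k‖ ^ 2) := by
      intro k
      have hpt : ∀ c, l2norm ((fun x => κ * u k x) -
          (if lab (out k c) = good k then κ * a k else 0) • e (lab (out k c))) ^ 2 ≤
          ‖κ‖ ^ 2 * (2 * l2norm (u k - a k • e (good k)) ^ 2 +
            if lab (out k c) = good k then 0 else 2 * ‖a k‖ ^ 2) := by
        intro c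
        have h0 : (fun x => κ * u k x) = κ • u k := rfl
        rw [h0]
        split_ifs with h
        · rw [h, mul_smul, ← smul_sub, l2norm_smul, mul_pow]
          refine mul_le_mul_of_nonneg_left ?_ (by positivity)
          linarith [sq_nonneg (l2norm (u k - a k • e (good k)))]
        · rw [zero_smul, sub_zero, l2norm_smul, mul_pow]
          refine mul_le_mul_of_nonneg_left ?_ (by positivity)
          have := l2norm_add_sq_le (u k - a k • e (good k)) (a k • e (good k))
          rw [sub_add_cancel, l2norm_smul (a k), he, mul_one] at this
          exact this
      refine (Finset.sum_le_sum fun c _ => hpt c).trans ?_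
      rw [← Finset.mul_sum, Finset.sum_add_distrib, Finset.sum_const, Finset.card_univ,
        nsmul_eq_mul, mul_add, ← mul_assoc, hκ, one_mul]
      refine add_le_add le_rfl ?_
      have h2 : ∑ c, (if lab (out k c) = good k then 0 else 2 * ‖a k‖ ^ 2) =
          (Fintype.card C - (Finset.univ.filter fun c => lab (out k c) = good k).card : ℝ) *
            (2 * ‖a k‖ ^ 2) := by
        rw [Finset.sum_ite, Finset.sum_const_zero, zero_add, Finset.sum_const, nsmul_eq_mul,
          ← Finset.card_univ (α := C), ← Finset.card_filter_add_card_filter_not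
            (s := Finset.univ) (fun c => lab (out k c) = good k)]
        push_cast
        ring
      have h3 := hgood k
      rw [uprob, le_div_iff₀ hC] at h3
      have h3' : (1 - δ) * Fintype.card C ≤
          ((Finset.univ.filter fun c => lab (out k c) = good k).card : ℝ) := by
        convert h3
      rw [h2, hκ', inv_mul_le_iff₀ hC]
      nlinarith [sq_nonneg ‖a k‖]
    refine (Finset.sum_le_sum fun k _ => hk k).trans ?_
    rw [Finset.sum_add_distrib, ← Finset.mul_sum, ← Finset.mul_sum, ← Finset.mul_sum]
    have := mul_le_mul_of_nonneg_left hA hδ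
    linarith

end EncryptedCnot

section UpdatedKeys

variable {r : ℕ} {Y G : Type}

/-- The approximation of the state for the ciphertext `y` and the result `d` of the measurement of the
message register is a multiple of the CNOT of the original state, with updated Pauli keys. -/
theorem sum_hadamard_mul_idealAmp (D : Bits (r + 1) → ℝ) (enc : Bool → Bits (r + 1) → Y)
    (inv : Bool → Y → Bits (r + 1)) (dec : Y → Bool) (s : Bool) (z x : Bits 2) (ψ : Bits 2 → ℂ)
    (γ : G → ℂ) (g : G) (y : Y) (d : Bits (r + 1)) (b : Bits 2) :
    ∑ m, hadamard d m * idealAmp inv (commonAmp enc inv (fun m => m 0) dec s D) γ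
        ((pauli z x).mulVec ψ) g y b m =
      (commonAmp enc inv (fun m => m 0) dec s D y * γ g *
        (hadamard d (inv false y) * sgn (z 1 && inv false y 0))) *
        (cnot ^ s.toNat * pauli
          ![z 0 ^^ AltScheme.dot d (fun j => inv false y j ^^ inv true y j), z 1]
          ![x 0, x 1 ^^ inv false y 0]).mulVec ψ b := by
  have h5 : ∑ m, hadamard d m * idealAmp inv (commonAmp enc inv (fun m => m 0) dec s D) γ
        ((pauli z x).mulVec ψ) g y b m =
      (commonAmp enc inv (fun m => m 0) dec s D y * γ g) * (hadamard d (inv (b 0) y) *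
        (pauli z x).mulVec ψ (xorSecond (inv (b 0) y 0) b)) := by
    rw [Finset.sum_eq_single (inv (b 0) y)]
    · rw [idealAmp, if_pos rfl]
      ring
    · intro m _ hm
      rw [idealAmp, if_neg hm.symm, mul_zero]
    · simp
  rw [h5]
  by_cases hc : Consistent enc inv (fun m => m 0) dec s false y ∧
      Consistent enc inv (fun m => m 0) dec s true y
  · have hbit : inv true y 0 = (inv false y 0 ^^ s) := by
      have e1 := hc.1.2
      have e2 := hc.2.2
      simp only [Bool.false_and, Bool.xor_false, Bool.true_and] at e1 e2
      rw [← e1, e2]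
      simp
    rw [hadamard_mul_pauli_xorSecond s z x ψ d (fun a => inv a y) hbit b]
    ring
  · rw [commonAmp, if_neg hc]
    simp

variable [Fintype Y] [Fintype G] [DecidableEq Y]

/-- The quantum part of the analysis: after the controlled encryption of the superposition `τ`, the
measurement of the ciphertext `y` and of the message register in the Hadamard basis (with result `d`)
and randomized post-processing, the two qubits are close to the CNOT of the original ones, with
updated Pauli keys. -/
theorem traceDist_encryptedCnot_le {C O : Type} [Fintype C] [Nonempty C] [Fintype O] [DecidableEq O]
    {D : Bits (r + 1) → ℝ} (hD : ∀ m, 0 ≤ D m) (hD1 : ∑ m, D m = 1)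
    {enc : Bool → Bits (r + 1) → Y} {inv : Bool → Y → Bits (r + 1)} {dec : Y → Bool} {s : Bool}
    {ε : ℝ} (hε0 : 0 ≤ ε) (hε1 : ε ≤ 1)
    (hcorr : ∀ a, 1 - 3 * ε ≤ dprob D (Correct enc inv (fun m => m 0) dec s a))
    (hhell : hellinger (pushforward D (enc false)) (pushforward D (enc true)) ≤ ε)
    {τ : Bits (r + 1) → G → ℂ} {R : Matrix (Bits (r + 1)) (Bits (r + 1)) ℂ}
    (hR : ∀ x y, R x y = ∑ g, τ x g * star (τ y g))
    (hprep : traceDist R (pure fun m => (√(D m) : ℂ)) ≤ ε)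
    {ψ : Bits 2 → ℂ} (hψ : ∑ b, ‖ψ b‖ ^ 2 = 1) (z x : Bits 2) {κ : ℂ}
    (hκ : ‖κ‖ ^ 2 * Fintype.card C = 1) {out : G × Y × Bits (r + 1) → C → O}
    {zo xo : O → Bits 2} {δ : ℝ} (hδ : 0 ≤ δ)
    (hgood : ∀ g y d, 1 - δ ≤ uprob fun c =>
      (zo (out (g, y, d) c), xo (out (g, y, d) c)) =
        ((![z 0 ^^ AltScheme.dot d (fun j => inv false y j ^^ inv true y j), z 1] : Bits 2),
          (![x 0, x 1 ^^ inv false y 0] : Bits 2)))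
    {ρ : O → Matrix (Bits 2) (Bits 2) ℂ}
    (hρ : ∀ o b b', ρ o b b' = ∑ p : (G × Y × Bits (r + 1)) × C, if out p.1 p.2 = o then
      (κ * ∑ m, hadamard p.1.2.2 m *
        cipherAmp enc τ ((pauli z x).mulVec ψ) p.1.1 p.1.2.1 b m) *
      star (κ * ∑ m, hadamard p.1.2.2 m *
        cipherAmp enc τ ((pauli z x).mulVec ψ) p.1.1 p.1.2.1 b' m) else 0) :
    traceDist (Matrix.blockDiagonal ρ)
      (Matrix.blockDiagonal fun o => (ρ o).trace •
        pure ((cnot ^ s.toNat * pauli (zo o) (xo o)).mulVec ψ)) ≤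
      2 * √(1020 * ε + 18 * δ) := by
  classical
  set φ := (pauli z x).mulVec ψ with hφdef
  have hφ : ∑ b, ‖φ b‖ ^ 2 = 1 := by rw [hφdef, sum_norm_pauli_sq, hψ]
  have hv : ∑ m, ‖((√(D m) : ℝ) : ℂ)‖ ^ 2 = 1 := by
    rw [← hD1]
    exact Finset.sum_congr rfl fun m _ => by
      rw [Complex.norm_real, Real.norm_eq_abs, sq_abs, Real.sq_sqrt (hD m)]
  obtain ⟨γ, h1, h2, h3⟩ := exists_product_approx hv hR hprep
  set q := commonAmp enc inv (fun m => m 0) dec s D with hq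
  have hq1 : ∑ y, q y ^ 2 ≤ 1 := sum_commonAmp_sq_le hD hD1
  have h4 := sum_cipherAmp_sub_idealAmp_le hφ h1 (sum_amp_sub_le hD hD1 hcorr hhell) h2
  rw [← hq] at h4
  let u : G × Y × Bits (r + 1) → Bits 2 → ℂ := fun k b =>
    ∑ m, hadamard k.2.2 m * cipherAmp enc τ φ k.1 k.2.1 b m
  let e : Bits 2 × Bits 2 → Bits 2 → ℂ := fun p => (cnot ^ s.toNat * pauli p.1 p.2).mulVec ψ
  let good : G × Y × Bits (r + 1) → Bits 2 × Bits 2 := fun k =>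
    (![z 0 ^^ AltScheme.dot k.2.2 (fun j => inv false k.2.1 j ^^ inv true k.2.1 j), z 1],
      ![x 0, x 1 ^^ inv false k.2.1 0])
  let a : G × Y × Bits (r + 1) → ℂ := fun k =>
    (q k.2.1 * γ k.1) * (hadamard k.2.2 (inv false k.2.1) * sgn (z 1 && inv false k.2.1 0))
  have he : ∀ p, l2norm (e p) = 1 := fun p => by
    rw [l2norm_eq_sqrt, sum_norm_cnot_pauli_sq, hψ, Real.sqrt_one]
  have hideal : ∀ k, a k • e (good k) =
      fun b => ∑ m, hadamard k.2.2 m * idealAmp inv q γ φ k.1 k.2.1 b m := by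
    rintro ⟨g, y, d⟩
    funext b
    exact (sum_hadamard_mul_idealAmp D enc inv dec s z x ψ γ g y d b).symm
  have hsum : ∀ F : G × Y × Bits (r + 1) → ℝ, ∑ k, F k = ∑ g, ∑ y, ∑ d, F (g, y, d) := fun F => by
    simp only [Fintype.sum_prod_type]
  have hA : ∑ k, ‖a k‖ ^ 2 ≤ 1 + 2 * ε := by
    rw [hsum]
    simp only [a, norm_mul, mul_pow, norm_sgn, norm_hadamard_sq, mul_one, Finset.sum_const,
      Finset.card_univ, Fintype.card_fun, Fintype.card_fin, Fintype.card_bool, nsmul_eq_mul,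
      Complex.norm_real, Real.norm_eq_abs, sq_abs]
    calc _ = (∑ y, q y ^ 2) * ∑ g, ‖γ g‖ ^ 2 := by
          rw [Finset.sum_mul_sum, Finset.sum_comm]
          refine Finset.sum_congr rfl fun y _ => Finset.sum_congr rfl fun g _ => ?_
          push_cast
          field_simp
      _ ≤ 1 * ∑ g, ‖γ g‖ ^ 2 := mul_le_mul_of_nonneg_right hq1
          (Finset.sum_nonneg fun _ _ => by positivity)
      _ ≤ _ := by rwa [one_mul]
  have hB : ∑ k, l2norm (u k - a k • e (good k)) ^ 2 ≤
      2 * (4 * ε) + 2 * ((1 + 2 * ε) * (27 * ε)) := by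
    rw [hsum]
    refine le_trans (le_of_eq ?_) h4
    rw [← sum_hadamard_amp]
    refine Finset.sum_congr rfl fun g _ => Finset.sum_congr rfl fun y _ =>
      Finset.sum_congr rfl fun d _ => ?_
    rw [hideal]
    congr 2
    funext b
    simp only [u, Pi.sub_apply, mul_sub, Finset.sum_sub_distrib]
  have hT : ∑ k, l2norm (u k) ^ 2 ≤ 1 + 2 * ε := by
    rw [hsum]
    refine le_trans (le_of_eq ?_) ((sum_cipherAmp_sq_le (enc := enc) hφ).trans h3)
    rw [← sum_hadamard_amp]
  have hfin := traceDist_postprocess_le (u := u) (e := e) (a := a) hκ hρ he (fun o => (zo o, xo o)) good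
    (fun k => hgood k.1 k.2.1 k.2.2) hA hB hT hδ
  refine hfin.trans ?_
  rw [mul_assoc, ← Real.sqrt_mul (by linarith)]
  refine mul_le_mul_of_nonneg_left (Real.sqrt_le_sqrt ?_) (by norm_num)
  -- `1 + 2ε ≤ 3` makes the second radicand at most `2 (8 + 162) ε + 6δ`
  have h7 : 1 + 2 * ε ≤ 3 := by linarith
  have h8 : 2 * (2 * (4 * ε) + 2 * ((1 + 2 * ε) * (27 * ε))) + 2 * (δ * (1 + 2 * ε)) ≤
      340 * ε + 6 * δ := by nlinarith
  calc (1 + 2 * ε) * _ ≤ 3 * (340 * ε + 6 * δ) :=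
        mul_le_mul h7 h8 (by positivity) (by norm_num)
    _ = _ := by ring

end UpdatedKeys

/-! ### Probability -/

section Probability

variable {α β : Type} [Fintype α] [Fintype β]

open Classical in
theorem uprob_eq_sum (P : α → Prop) : uprob P = (∑ a, if P a then (1 : ℝ) else 0) / Fintype.card α := by
  rw [uprob, Finset.sum_boole]

theorem uprob_nonneg (P : α → Prop) : 0 ≤ uprob P := div_nonneg (Nat.cast_nonneg _) (Nat.cast_nonneg _)

theorem uprob_le_one (P : α → Prop) : uprob P ≤ 1 := by
  classical
  refine div_le_one_of_le₀ ?_ (Nat.cast_nonneg _)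
  exact_mod_cast Finset.card_filter_le _ _

theorem uprob_mono {P Q : α → Prop} (h : ∀ a, P a → Q a) : uprob P ≤ uprob Q := by
  classical
  refine div_le_div_of_nonneg_right ?_ (Nat.cast_nonneg _)
  exact_mod_cast Finset.card_le_card fun a => by simpa using h a

theorem uprob_of_forall [Nonempty α] {P : α → Prop} (h : ∀ a, P a) : uprob P = 1 := by
  classical
  rw [uprob, Finset.filter_true_of_mem fun a _ => h a, Finset.card_univ,
    div_self (by exact_mod_cast Fintype.card_ne_zero)]

theorem le_uprob_and [Nonempty α] {P Q : α → Prop} {δ ε : ℝ} (hP : 1 - δ ≤ uprob P)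
    (hQ : 1 - ε ≤ uprob Q) : 1 - (δ + ε) ≤ uprob fun a => P a ∧ Q a := by
  classical
  have hpos : (0 : ℝ) < Fintype.card α := by exact_mod_cast Fintype.card_pos
  have h : uprob P + uprob Q ≤ uprob (fun a => P a ∧ Q a) + 1 := by
    rw [uprob_eq_sum, uprob_eq_sum, uprob_eq_sum, ← div_self hpos.ne', ← add_div, ← add_div]
    refine div_le_div_of_nonneg_right ?_ hpos.le
    have hc : (Fintype.card α : ℝ) = ∑ _a : α, (1 : ℝ) := by simp
    rw [hc, ← Finset.sum_add_distrib, ← Finset.sum_add_distrib]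
    refine Finset.sum_le_sum fun a _ => ?_
    by_cases h1 : P a <;> by_cases h2 : Q a <;> simp [h1, h2]
  linarith

theorem le_uprob_forall [Nonempty α] {n : ℕ} {P : Fin n → α → Prop} {ε : ℝ}
    (h : ∀ i, 1 - ε ≤ uprob (P i)) : 1 - n * ε ≤ uprob fun a => ∀ i, P i a := by
  induction n with
  | zero => rw [uprob_of_forall fun a i => i.elim0]; simp
  | succ n ih =>
    have := le_uprob_and (h 0) (ih fun i => h i.succ)
    simp only [Fin.forall_fin_succ]
    refine le_trans (le_of_eq ?_) this
    push_cast
    ring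

/-- A bound that holds for a random choice of one part of `a`, whatever the other parts are, holds for
random `a`. The part is described by how to read and how to replace it. -/
theorem le_uprob_of_part [Nonempty α] (get : α → β) (set : α → β → α)
    (h₁ : ∀ a b, get (set a b) = b) (h₂ : ∀ a, set a (get a) = a)
    (h₃ : ∀ a b b', set (set a b) b' = set a b') {P : α → Prop} {ε : ℝ}
    (h : ∀ a, 1 - ε ≤ uprob fun b => P (set a b)) : 1 - ε ≤ uprob P := by
  classical
  have hα : (0 : ℝ) < Fintype.card α := by exact_mod_cast Fintype.card_pos
  have : Nonempty β := ⟨get (Classical.arbitrary α)⟩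
  have hβ : (0 : ℝ) < Fintype.card β := by exact_mod_cast Fintype.card_pos
  -- exchanging the part with an independent one is a bijection
  have hinv : Function.Involutive fun p : α × β => (set p.1 p.2, get p.1) := fun p => by
    simp [h₁, h₂, h₃]
  have hsum : ∑ a, ∑ b, (if P (set a b) then (1 : ℝ) else 0) =
      Fintype.card β * ∑ a, if P a then (1 : ℝ) else 0 := by
    have h5 := Equiv.sum_comp hinv.toPerm (fun p : α × β => if P p.1 then (1 : ℝ) else 0)
    rw [← Fintype.sum_prod_type' fun a b => if P (set a b) then (1 : ℝ) else 0]
    refine Eq.trans h5 ?_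
    rw [Fintype.sum_prod_type, Finset.mul_sum]
    refine Finset.sum_congr rfl fun a _ => ?_
    exact (Finset.sum_const (if P a then (1 : ℝ) else 0)).trans (by
      rw [Finset.card_univ, nsmul_eq_mul])
  have h' : ∀ a, (1 - ε) * Fintype.card β ≤ ∑ b, (if P (set a b) then (1 : ℝ) else 0) := fun a => by
    have := h a
    rwa [uprob_eq_sum, le_div_iff₀ hβ] at this
  have h4 := Finset.sum_le_sum fun a (_ : a ∈ Finset.univ) => h' a
  rw [hsum, Finset.sum_const, Finset.card_univ, nsmul_eq_mul] at h4
  rw [uprob_eq_sum, le_div_iff₀ hα]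
  nlinarith

/-- A bound for random contents of a register, whatever the other bits are, holds for random bits. -/
theorem le_uprob_readBits {n off w : ℕ} (h : off + n ≤ w) {P : Bits w → Prop} {ε : ℝ}
    (hP : ∀ b : Bits w, 1 - ε ≤ uprob fun c : Bits n => P (setBits b off c)) : 1 - ε ≤ uprob P :=
  le_uprob_of_part (fun b => readBits b off n) (fun b c => setBits b off c)
    (fun b c => readBits_setBits b off c h) (fun b => setBits_readBits b off n)
    (fun b c c' => bits_ext fun q hq => by
      rw [getBit_setBits, getBit_setBits, getBit_setBits]
      split_ifs <;> rfl) hP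

theorem le_dprob_and {D : α → ℝ} (hD : ∀ a, 0 ≤ D a) (hD1 : ∑ a, D a = 1) {P Q : α → Prop}
    {δ ε : ℝ} (hP : 1 - δ ≤ dprob D P) (hQ : 1 - ε ≤ dprob D Q) :
    1 - (δ + ε) ≤ dprob D fun a => P a ∧ Q a := by
  classical
  have h : dprob D P + dprob D Q ≤ dprob D (fun a => P a ∧ Q a) + 1 := by
    rw [← hD1, dprob, dprob, dprob, ← Finset.sum_add_distrib, ← Finset.sum_add_distrib]
    refine Finset.sum_le_sum fun a _ => ?_
    have := hD a
    by_cases h1 : P a <;> by_cases h2 : Q a <;> simp [h1, h2, this]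
  linarith

theorem dprob_mono {D : α → ℝ} (hD : ∀ a, 0 ≤ D a) {P Q : α → Prop}
    (h : ∀ a, D a ≠ 0 → P a → Q a) : dprob D P ≤ dprob D Q := by
  classical
  refine Finset.sum_le_sum fun a _ => ?_
  by_cases h0 : D a = 0
  · simp [h0]
  · by_cases h1 : P a
    · simp [h1, h a h0 h1]
    · rw [if_neg h1]
      split_ifs <;> simp [hD]

end Probability

/-! ### Negligible functions -/

namespace Negligible

variable {f g : ℕ → ℝ}

theorem add (hf : Negligible f) (hg : Negligible g) : Negligible fun n => f n + g n :=
  Asymptotics.SuperpolynomialDecay.add hf hg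

theorem const_mul (hf : Negligible f) (c : ℝ) : Negligible fun n => c * f n :=
  Asymptotics.SuperpolynomialDecay.const_mul hf c

/-- Functions computable in unary polynomial time grow at most polynomially. -/
theorem mul_polyTime (hf : Negligible f) {p : ℕ → ℕ} (hp : PolyTime fun v : Fin 1 → ℕ => p (v 0)) :
    Negligible fun n => p n * f n := by
  obtain ⟨e, he⟩ := hp.polyBdd
  have h := Asymptotics.SuperpolynomialDecay.polynomial_mul hf
    ((Polynomial.X + Polynomial.C 2) ^ e : Polynomial ℝ)
  refine h.trans_abs_le fun n => ?_
  have h2 := he fun _ => n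
  simp only [Finset.univ_unique, Finset.sum_const, Finset.card_singleton, one_smul] at h2
  rw [abs_mul, abs_mul]
  refine mul_le_mul_of_nonneg_right ?_ (abs_nonneg _)
  simp only [Polynomial.eval_pow, Polynomial.eval_add, Polynomial.eval_X, Polynomial.eval_C]
  rw [abs_of_nonneg (Nat.cast_nonneg _), abs_of_nonneg (by positivity)]
  exact_mod_cast h2

theorem sqrt (hf : Negligible f) : Negligible fun n => √(f n) := by
  intro k
  have h := (Real.continuous_sqrt.tendsto 0).comp (hf (2 * k))
  rw [Real.sqrt_zero] at h
  refine h.congr fun n => ?_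
  simp only [Function.comp]
  rw [Real.sqrt_mul (by positivity), mul_comm 2 k, pow_mul, Real.sqrt_sq (by positivity)]

end Negligible

/-! ### Registers in memory -/

/-- Overwrite the bits of a memory from position `off` on with `d`. -/
def setMem {n : ℕ} (m : ℕ → Bool) (off : ℕ) (d : Bits n) : ℕ → Bool :=
  fun q => if off ≤ q ∧ q < off + n then getBit d (q - off) else m q

theorem setMem_of_lt {n : ℕ} (m : ℕ → Bool) {off : ℕ} (d : Bits n) {q : ℕ} (h : q < off) :
    setMem m off d q = m q := if_neg (by omega)

theorem setMem_of_ge {n : ℕ} (m : ℕ → Bool) {off : ℕ} (d : Bits n) {q : ℕ} (h : off + n ≤ q) :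
    setMem m off d q = m q := if_neg (by omega)

theorem setMem_add {n : ℕ} (m : ℕ → Bool) (off : ℕ) (d : Bits n) {t : ℕ} (h : t < n) :
    setMem m off d (off + t) = d ⟨t, h⟩ := by
  rw [setMem, if_pos (by omega), Nat.add_sub_cancel_left, getBit_of_lt _ h]

/-- A program that does not use a register works in the same way for all its contents. -/
theorem runT_setMem {L : List Toffoli} {n off : ℕ}
    (h : ∀ g ∈ L, (g.1 < off ∨ off + n ≤ g.1) ∧ (g.2.1 < off ∨ off + n ≤ g.2.1) ∧
      (g.2.2 < off ∨ off + n ≤ g.2.2)) (m : ℕ → Bool) (d : Bits n) :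
    runT L (setMem m off d) = setMem (runT L m) off d := by
  funext q
  by_cases hq : off ≤ q ∧ q < off + n
  · rw [runT_of_not_target fun g hg => by have := h g hg; omega, setMem, setMem, if_pos hq, if_pos hq]
  · have e := runT_congr (L := L) (P := fun q => ¬(off ≤ q ∧ q < off + n)) (m := setMem m off d)
      (m' := m) (fun g hg => by have := h g hg; omega) (fun q hq => if_neg hq) q hq
    rw [e, setMem, if_neg hq]

section PathSum

variable {N : ℕ} {J : Type} [Fintype J]

theorem runGates_toffoli_mem {L : List Toffoli} (hL : ∀ g ∈ L, g.1 < N ∧ g.2.1 < N ∧ g.2.2 < N)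
    (α : J → ℂ) (f : J → ℕ → Bool) :
    runGates (L.map Toffoli.gate) (pathSum α fun j => ofMem N (f j)) =
      pathSum α fun j => ofMem N (runT L (f j)) := by
  rw [runGates_toffoli_pathSum fun g hg => (hL g hg).2.2]
  congr 1
  funext j
  refine bits_ext fun q hq => ?_
  rw [getBit_ofMem, getBit_ofMem, if_pos hq, if_pos hq]
  exact runT_congr (P := fun q => q < N) hL
    (fun q hq => by rw [getBit_ofMem, if_pos hq]) q hq

theorem setBits_ofMem {n : ℕ} (m : ℕ → Bool) (off : ℕ) (d : Bits n) :
    setBits (ofMem N m) off d = ofMem N (setMem m off d) :=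
  bits_ext fun q hq => by
    rw [getBit_setBits, getBit_ofMem, getBit_ofMem, if_pos hq, if_pos hq, setMem]
    exact if_congr (by omega) rfl rfl

theorem readBits_ofMem {n off : ℕ} (h : off + n ≤ N) (m : ℕ → Bool) :
    readBits (ofMem N m) off n = fun t : Fin n => m (off + t) := by
  funext t
  rw [readBits, getBit_ofMem, if_pos (by omega)]

theorem runGates_h_mem {n lo : ℕ} (h : lo + n ≤ N) (α : J → ℂ) (f : J → ℕ → Bool) :
    runGates ((List.range n).map fun t => .h (lo + t)) (pathSum α fun j => ofMem N (f j)) =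
      pathSum (J := J × Bits n) (fun j => α j.1 * hadamard j.2 fun t : Fin n => f j.1 (lo + t))
        fun j => ofMem N (setMem (f j.1) lo j.2) := by
  rw [runGates_h_pathSum h]
  simp only [setBits_ofMem, readBits_ofMem h]

/-- A circuit that runs inside a register whose contents are fixed. -/
theorem runGates_rename_mem {w off : ℕ} (h : off + w ≤ N) (L : List QGate) {b₀ : Bits w} (α : J → ℂ)
    {f : J → ℕ → Bool} (hf : ∀ j (t : Fin w), f j (off + t) = b₀ t) :
    runGates (L.map (QGate.rename fun q => if q < w then off + q else N))
      (pathSum α fun j => ofMem N (f j)) =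
      pathSum (J := J × Bits w)
        (fun j => α j.1 * runGates L (fun b => if b = b₀ then 1 else 0) j.2)
        fun j => ofMem N (setMem (f j.1) off j.2) := by
  have h0 : pathSum α (fun j => ofMem N (f j)) = pathSum (J := J × Bits w)
      (fun j => α j.1 * (fun b => if b = b₀ then (1 : ℂ) else 0) j.2)
      fun j => setBits (ofMem N (f j.1)) off j.2 := by
    funext b
    simp only [pathSum, Fintype.sum_prod_type]
    refine Finset.sum_congr rfl fun j _ => ?_
    rw [Finset.sum_eq_single b₀ (fun b' _ hb' => by simp [hb']) (by simp)]
    have : b₀ = readBits (ofMem N (f j)) off w := by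
      rw [readBits_ofMem h]
      exact funext fun t => (hf j t).symm
    rw [this, setBits_readBits]
    simp
  rw [h0, runGates_rename_pathSum h L (fun b => if b = b₀ then (1 : ℂ) else 0) α fun j => ofMem N (f j)]
  simp only [setBits_ofMem]

/-! ### The encrypted CNOT -/

/-- The memory with the two qubits `x`, the rest `g` of the preparation register and the message
register `m`. -/
def prepMem {r v : ℕ} (μ : ℕ → Bool) (Bp : ℕ) (x : Bits 2) (g : Bits v) (m : Bits (r + 1)) : ℕ → Bool :=
  setMem (setMem (setMem μ 0 x) (Bp + (r + 1)) g) Bp m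

/-- The state of the preparation register, split into the message register and the rest. If the
preparation circuit has less than `r + 1` qubits, the rest of the message register is zero. -/
theorem pathSum_splitAmp {r w Bp : ℕ} {μ : ℕ → Bool}
    (hμ : ∀ q, Bp + w ≤ q → q < Bp + (r + 1) → μ q = false) (hBp : 2 ≤ Bp)
    (φ : Bits 2 → ℂ) (χ : Bits w → ℂ) :
    pathSum (J := Bits 2 × Bits w) (fun j => φ j.1 * χ j.2)
      (fun j => ofMem N (setMem (setMem μ 0 j.1) Bp j.2)) =
    pathSum (J := Bits 2 × Bits (r + 1) × Bits (w - (r + 1)))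
      (fun j => φ j.1 * splitAmp (r + 1) χ j.2.1 j.2.2)
      fun j => ofMem N (prepMem μ Bp j.1 j.2.2 j.2.1) := by
  have h1 : ∀ j : Bits 2 × Bits w, setMem (setMem μ 0 j.1) Bp j.2 =
      prepMem μ Bp j.1 (readBits j.2 (r + 1) (w - (r + 1))) (readBits j.2 0 (r + 1)) := by
    intro j
    funext q
    simp only [prepMem, setMem]
    by_cases h1 : Bp ≤ q ∧ q < Bp + (r + 1)
    · rw [if_pos h1, getBit_readBits, if_pos (show q - Bp < r + 1 by omega), Nat.zero_add (q - Bp)]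
      by_cases h2 : Bp ≤ q ∧ q < Bp + w
      · rw [if_pos h2]
      · rw [if_neg h2, if_neg (by omega), hμ q (by omega) h1.2, getBit_of_ge _ (by omega)]
    · rw [if_neg h1]
      by_cases h2 : Bp + (r + 1) ≤ q ∧ q < Bp + (r + 1) + (w - (r + 1))
      · rw [if_pos h2, if_pos (by omega), getBit_readBits, if_pos (by omega)]
        exact congrArg _ (by omega)
      · rw [if_neg h2, if_neg (by omega)]
  simp only [h1]
  rw [pathSum_comp (fun j : Bits 2 × Bits w =>
    (j.1, readBits j.2 0 (r + 1), readBits j.2 (r + 1) (w - (r + 1))))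
    (fun j => φ j.1 * χ j.2) fun j => ofMem N (prepMem μ Bp j.1 j.2.2 j.2.1)]
  congr 1
  funext ⟨x, m, g⟩
  rw [Fintype.sum_prod_type, Finset.sum_eq_single x (fun x' _ hx' => by simp [hx']) (by simp),
    splitAmp, Finset.mul_sum]
  refine Finset.sum_congr rfl fun b _ => ?_
  simp

/-- The state before the homomorphic evaluation: superposition over the preparation register by `L`,
controlled encryption by `T`, Hadamard transforms of the message register (whose value is then
`d`) and of the coins. -/
theorem runGates_encryptedCnot {r w ct R Bp By Bc : ℕ} {μ : ℕ → Bool} {b₀ : Bits w} {L : List QGate}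
    {T : List Toffoli} {enc : Bool → Bits (r + 1) → Bits ct} {χ : Bits w → ℂ}
    (hBp : 2 ≤ Bp) (hBy : Bp + (r + 1) + w ≤ By) (hBc : By + ct ≤ Bc) (hN : Bc + R ≤ N)
    (hμp : ∀ t : Fin w, μ (Bp + t) = b₀ t)
    (hμ : ∀ q, Bp + w ≤ q → q < Bp + (r + 1) → μ q = false)
    (hμc : ∀ q, Bc ≤ q → q < Bc + R → μ q = false)
    (hT : ∀ g ∈ T, g.1 < N ∧ g.2.1 < N ∧ g.2.2 < N)
    (hrun : ∀ x (g : Bits (w - (r + 1))) m, runT T (prepMem μ Bp x g m) =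
      setMem (prepMem μ Bp (xorSecond (m 0) x) g m) By (enc (x 0) m))
    (hχ : χ = runGates L fun b => if b = b₀ then 1 else 0) (φ : Bits 2 → ℂ) :
    runGates (L.map (QGate.rename fun q => if q < w then Bp + q else N) ++ T.map Toffoli.gate ++
        ((List.range (r + 1)).map fun t => .h (Bp + t)) ++ (List.range R).map fun t => .h (Bc + t))
      (pathSum φ fun x => ofMem N (setMem μ 0 x)) =
    pathSum (J := Bits 2 × (Bits (w - (r + 1)) × Bits ct × Bits (r + 1)) × Bits R)
      (fun j => (((Real.sqrt 2 : ℝ) : ℂ)⁻¹) ^ R * ∑ m, hadamard j.2.1.2.2 m *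
        cipherAmp enc (splitAmp (r + 1) χ) φ j.2.1.1 j.2.1.2.1 j.1 m)
      fun j => ofMem N (setMem (setMem (prepMem μ Bp j.1 j.2.1.1 j.2.1.2.2) By j.2.1.2.1) Bc j.2.2) := by
  classical
  rw [runGates_append, runGates_append, runGates_append, runGates_rename_mem (by omega) L φ
    (b₀ := b₀) fun x t => by rw [setMem_of_ge _ _ (by omega), hμp], ← hχ, pathSum_splitAmp hμ hBp,
    runGates_toffoli_mem hT]
  simp only [hrun]
  rw [runGates_h_mem (by omega), runGates_h_mem hN]
  -- the values of the registers before the transforms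
  have e1 : ∀ (x : Bits 2) (g : Bits (w - (r + 1))) (m : Bits (r + 1)) (y : Bits ct) (t : Fin (r + 1)),
      setMem (prepMem μ Bp x g m) By y (Bp + t) = m t := fun x g m y t => by
    rw [setMem_of_lt _ _ (by omega), prepMem, setMem_add _ _ _ t.2]
  have e2 : ∀ (x : Bits 2) (g : Bits (w - (r + 1))) (m d : Bits (r + 1)) (y : Bits ct) (t : Fin R),
      setMem (setMem (prepMem μ Bp x g m) By y) Bp d (Bc + t) = false := fun x g m d y t => by
    rw [setMem_of_ge _ _ (by omega), setMem_of_ge _ _ (by omega), prepMem,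
      setMem_of_ge _ _ (by omega), setMem_of_ge _ _ (by omega), setMem_of_ge _ _ (by omega),
      hμc _ (by omega) (by omega)]
  have e3 : ∀ (x : Bits 2) (g : Bits (w - (r + 1))) (m d : Bits (r + 1)) (y : Bits ct),
      setMem (setMem (prepMem μ Bp x g m) By y) Bp d = setMem (prepMem μ Bp x g d) By y := by
    intro x g m d y
    funext q
    simp only [prepMem, setMem]
    split_ifs <;> first | rfl | omega
  simp only [e1, e2, e3]
  have e4 : ∀ c : Bits R, hadamard c (fun _ => false) = (((Real.sqrt 2 : ℝ) : ℂ)⁻¹) ^ R := fun c => by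
    simp [hadamard]
  simp only [e4]
  rw [pathSum_comp (fun j : ((Bits 2 × Bits (r + 1) × Bits (w - (r + 1))) × Bits (r + 1)) × Bits R =>
    ((xorSecond (j.1.1.2.1 0) j.1.1.1, (j.1.1.2.2, enc (j.1.1.1 0) j.1.1.2.1, j.1.2), j.2) :
      Bits 2 × (Bits (w - (r + 1)) × Bits ct × Bits (r + 1)) × Bits R))
    _ (fun j => ofMem N
      (setMem (setMem (prepMem μ Bp j.1 j.2.1.1 j.2.1.2.2) By j.2.1.2.1) Bc j.2.2))]
  congr 1
  funext ⟨x, ⟨g, y, d⟩, c⟩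
  simp only [Fintype.sum_prod_type, Prod.mk.injEq]
  rw [Finset.sum_comm, Finset.mul_sum]
  refine Finset.sum_congr rfl fun m _ => ?_
  have hx : ∀ x', xorSecond (m 0) x' = x ↔ x' = xorSecond (m 0) x := fun x' =>
    ⟨fun h => by rw [← h, xorSecond_xorSecond], fun h => by rw [h, xorSecond_xorSecond]⟩
  rw [Finset.sum_eq_single (xorSecond (m 0) x) (fun x' _ hx' => by simp [hx, hx']) (by simp),
    Finset.sum_eq_single g (fun g' _ hg' => by simp [hg']) (by simp),
    Finset.sum_eq_single d (fun d' _ hd' => by simp [hd']) (by simp),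
    Finset.sum_eq_single c (fun c' _ hc' => by simp [hc']) (by simp), cipherAmp]
  have h0 : xorSecond (m 0) x 0 = x 0 := rfl
  simp only [xorSecond_xorSecond, true_and, and_true, h0]
  split_ifs
  · ring
  · simp

/-- The reduced density matrix after a reversible program which does not use the first two qubits, for
the value `o` of the outputs. -/
theorem reduced_toffoli_mem {K O : Type} [Fintype K] [DecidableEq K] [DecidableEq O] {L : List Toffoli}
    (hN : 2 ≤ N) (hL : ∀ g ∈ L, g.1 < N ∧ g.2.1 < N ∧ g.2.2 < N)
    (hL2 : ∀ g ∈ L, 2 ≤ g.1 ∧ 2 ≤ g.2.1 ∧ 2 ≤ g.2.2) (Ψ : Bits 2 × K → ℂ) {f : K → ℕ → Bool}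
    (hf : ∀ κ κ', (∀ q, 2 ≤ q → q < N → f κ q = f κ' q) → κ = κ') {read : Bits N → O} {out : K → O}
    (hread : ∀ (x : Bits 2) κ, read (ofMem N (setMem (runT L (f κ)) 0 x)) = out κ) (o : O) (x y : Bits 2) :
    reduced 2 (runGates (L.map Toffoli.gate) (pathSum Ψ fun j => ofMem N (setMem (f j.2) 0 j.1)))
      (fun b => o = read b) x y = ∑ κ, if out κ = o then Ψ (x, κ) * star (Ψ (y, κ)) else 0 := by
  rw [runGates_toffoli_mem hL]
  have h1 : ∀ j : Bits 2 × K, runT L (setMem (f j.2) 0 j.1) = setMem (runT L (f j.2)) 0 j.1 :=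
    fun j => runT_setMem (fun g hg => by have := hL2 g hg; omega) _ _
  simp only [h1]
  rw [reduced_pathSum (K := K) Ψ (fun j => ofMem N (setMem (runT L (f j.2)) 0 j.1))]
  · simp only [hread]
    exact Finset.sum_congr rfl fun κ _ => if_congr eq_comm rfl rfl
  · intro j
    rw [readBits_ofMem (by omega)]
    funext t
    exact setMem_add _ 0 _ t.2
  · intro j j'
    constructor
    · intro h
      refine hf _ _ fun q hq hqN => ?_
      have h2 : ∀ q, 2 ≤ q ∧ q < N → runT L (f j.2) q = runT L (f j'.2) q := fun q hq => by
        have := h ⟨q, hq.2⟩ hq.1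
        simpa only [ofMem, setMem_of_ge _ _ (show 0 + 2 ≤ q by omega)] using this
      rw [← runT_reverse L (f j.2), ← runT_reverse L (f j'.2)]
      exact runT_congr (fun g hg => by
        have hg := List.mem_reverse.1 hg
        have := hL g hg
        have := hL2 g hg
        omega) h2 q ⟨hq, hqN⟩
    · intro h i hi
      simp only [ofMem]
      rw [setMem_of_ge _ _ (by omega), setMem_of_ge _ _ (by omega), h]
  · intro x κ
    rw [hread, hread]

end PathSum

/-! ### The machine -/

/-- The numbers and circuits from which the machine is built: the number `lvl` of levels, the index
`idx` of the present level (counted from zero), the lengths of keys, ciphertexts and coins, the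
circuits for the conversion, encryption and addition of `AltHE`, and for encryption and homomorphic
evaluation (of the circuit `upd a`, for each of the four bits of the Pauli key update), and the
quantum circuit that prepares the superposition. -/
structure Parts where
  lvl : ℕ
  idx : ℕ
  pkL : ℕ
  evkL : ℕ
  skL : ℕ
  tdL : ℕ
  ctL : ℕ
  encCoins : ℕ
  r : ℕ
  altL : ℕ
  evalCoins : Fin 4 → ℕ
  conv : NandCircuit
  alt : NandCircuit
  xor : NandCircuit
  enc : NandCircuit
  ev : Fin 4 → NandCircuit
  upd : Fin 4 → NandCircuit
  prep : QCircuit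

namespace Parts

variable (p : Parts)

/-- The length of the part of the evaluation key that belongs to a level. -/
def levelLen : ℕ := p.pkL + p.skL * p.ctL + p.tdL * p.ctL
/-- The number of inputs of the Pauli key update. -/
def updIn : ℕ := p.pkL + p.skL + p.tdL + 4 * p.ctL + p.altL + p.altL + (p.r + 1)
/-- The size of the preparation register: the input and the ancillas of the preparation circuit. -/
def prepW : ℕ := p.pkL + p.prep.anc
/-- An upper bound for the numbers of coins of the four evaluations. -/
def evalW : ℕ := p.evalCoins 0 + p.evalCoins 1 + p.evalCoins 2 + p.evalCoins 3
/-- The number of coins. -/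
def coins : ℕ := p.updIn * p.encCoins + 4 * p.evalW
/-- An upper bound for the sizes of the four evaluation circuits. -/
def evL : ℕ := (p.ev 0).length + (p.ev 1).length + (p.ev 2).length + (p.ev 3).length

/-! ### Positions -/

/-- The start of the parts of the evaluation key that belong to the transitions between levels, behind the
evaluation keys of all levels. -/
def lvlPos : ℕ := 2 + p.pkL + (p.lvl + 1) * p.evkL
/-- The public key of the present level. -/
def pkPos : ℕ := if p.idx = 0 then 2 else p.lvlPos + (p.idx - 1) * p.levelLen
/-- The public key of the next level. -/
def pkNext : ℕ := p.lvlPos + p.idx * p.levelLen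
/-- The encryptions of the bits of the secret key and of the trapdoor. -/
def skPos : ℕ := p.pkNext + p.pkL
/-- The evaluation key of the next level. -/
def evkNext : ℕ := 2 + p.pkL + (p.idx + 1) * p.evkL
/-- The control ciphertext. -/
def cPos : ℕ := p.lvlPos + p.lvl * p.levelLen
/-- The ciphertexts of the Pauli keys. -/
def czPos : ℕ := p.cPos + p.ctL
/-- A qubit that remains zero. -/
def blank : ℕ := p.czPos + 4 * p.ctL
/-- The preparation register, which starts with the message register. -/
def prepPos : ℕ := p.blank + 1
/-- The register of the ciphertext `y` of the controlled encryption. -/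
def yPos : ℕ := p.prepPos + (p.r + 1) + p.prepW
/-- The coins. -/
def coinPos : ℕ := p.yPos + p.altL
/-- A qubit that remains one after the initialization. It is followed by the values of the gates of
all circuits, which are initialized to one, too. -/
def one : ℕ := p.coinPos + p.coins
/-- The values of the gates for the conversion of the control ciphertext. -/
def convPos : ℕ := p.one + 1
/-- The values of the gates for the encryption of the message register. -/
def altPos : ℕ := p.convPos + p.conv.length
/-- The values of the gates for the homomorphic shift. -/
def xorPos : ℕ := p.altPos + p.alt.length
/-- The values of the gates for the encryptions of the inputs of the Pauli key update. -/
def encPos : ℕ := p.xorPos + p.xor.length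
/-- The values of the gates for the four homomorphic evaluations. -/
def evPos : ℕ := p.encPos + p.updIn * p.enc.length
/-- The results. -/
def outPos : ℕ := p.evPos + 4 * p.evL
/-- The number of qubits. -/
def total : ℕ := p.outPos + 4 * p.ctL

/-! ### Places of inputs and outputs of the circuits -/

/-- Inputs of the conversion: public key and control ciphertext. -/
def convIn : ℕ → ℕ := appendLoc p.pkL (fun j => p.pkPos + j) fun j => p.cPos + j
/-- The converted control ciphertext. -/
def convOut : ℕ → ℕ := p.conv.outLoc (p.pkL + p.ctL) p.altL p.convIn p.convPos p.blank
/-- Inputs of the encryption by `AltHE`: public key and message register. -/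
def altIn : ℕ → ℕ := appendLoc p.pkL (fun j => p.pkPos + j) fun j => p.prepPos + j
/-- The encryption of the message register. -/
def altOut : ℕ → ℕ := p.alt.outLoc (p.pkL + (p.r + 1)) p.altL p.altIn p.altPos p.blank
/-- Inputs of the homomorphic shift: public key, encryption of the message register, converted control
ciphertext. -/
def xorIn : ℕ → ℕ :=
  appendLoc (p.pkL + p.altL) (appendLoc p.pkL (fun j => p.pkPos + j) p.altOut) p.convOut
/-- The homomorphically shifted encryption. -/
def xorOut : ℕ → ℕ := p.xor.outLoc (p.pkL + p.altL + p.altL) p.altL p.xorIn p.xorPos p.blank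

/-- The places of the inputs of the Pauli key update. The secret key and the trapdoor are not known to the
machine; their places are taken by the blank qubit. -/
def bitLoc : ℕ → ℕ :=
  appendLoc (p.pkL + p.skL + p.tdL + 4 * p.ctL + p.altL + p.altL)
    (appendLoc (p.pkL + p.skL + p.tdL + 4 * p.ctL + p.altL)
      (appendLoc (p.pkL + p.skL + p.tdL + 4 * p.ctL)
        (appendLoc (p.pkL + p.skL + p.tdL) (appendLoc p.pkL (fun j => p.pkPos + j) fun _ => p.blank)
          fun j => p.czPos + j) p.convOut) fun j => p.yPos + j) fun j => p.prepPos + j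
/-- Inputs of the encryption of the input `q` of the Pauli key update: next public key, the bit, coins. -/
def encIn (q : ℕ) : ℕ → ℕ :=
  appendLoc (p.pkL + 1) (appendLoc p.pkL (fun j => p.pkNext + j) fun _ => p.bitLoc q)
    fun j => p.coinPos + q * p.encCoins + j
/-- The encryption, made by the machine, of the input `q` of the Pauli key update. -/
def encOut (q : ℕ) : ℕ → ℕ :=
  p.enc.outLoc (p.pkL + 1 + p.encCoins) p.ctL (p.encIn q) (p.encPos + q * p.enc.length) p.blank
/-- The place of the encryption of the input `q` of the Pauli key update. Encryptions of the secret
key and of the trapdoor are part of the evaluation key; the others are made by the machine. -/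
def ctLoc (q j : ℕ) : ℕ :=
  if q < p.pkL then p.encOut q j
  else if q < p.pkL + p.skL + p.tdL then p.skPos + (q - p.pkL) * p.ctL + j else p.encOut q j
/-- The length of the description of the circuit `upd a`. -/
def codeLen (a : Fin 4) : ℕ := (p.upd a).length * (2 * (p.updIn + (p.upd a).length))
/-- Inputs of the evaluation of `upd a`: next evaluation key, description of the circuit (whose bits are read
from the two constant qubits), encrypted inputs, coins. -/
def evIn (a : Fin 4) : ℕ → ℕ :=
  appendLoc (p.evkL + p.codeLen a + p.updIn * p.ctL)
    (appendLoc (p.evkL + p.codeLen a)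
      (appendLoc p.evkL (fun j => p.evkNext + j) ((p.upd a).codeLoc p.updIn p.one p.blank))
      (blockLoc p.ctL p.ctLoc))
    fun j => p.coinPos + p.updIn * p.encCoins + a * p.evalW + j
/-- The number of inputs of the evaluation of `upd a`. -/
def evInL (a : Fin 4) : ℕ := p.evkL + p.codeLen a + p.updIn * p.ctL + p.evalCoins a
/-- The result of the evaluation of `upd a`. -/
def evOut (a : Fin 4) : ℕ → ℕ :=
  (p.ev a).outLoc (p.evInL a) p.ctL (p.evIn a) (p.evPos + a * p.evL) p.blank

/-! ### Gates -/

/-- Add the conjunction of the bits at `f t` and `g t` to the bit at `T + t`, for `t < n`. -/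
def xorRange (n : ℕ) (f g : ℕ → ℕ) (T : ℕ) : List Toffoli :=
  (List.range n).map fun t => (f t, g t, T + t)

/-- Provide the preparation circuit with its input, and convert the control ciphertext. -/
def initProg : List Toffoli :=
  xorRange p.pkL (fun t => p.pkPos + t) (fun t => p.pkPos + t) p.prepPos ++
  p.conv.prog 1 (p.pkL + p.ctL) (fun _ => p.convIn) p.convPos p.blank

/-- Compute the encryption of the message register and its homomorphic shift. -/
def cipherProg : List Toffoli :=
  p.alt.prog 1 (p.pkL + (p.r + 1)) (fun _ => p.altIn) p.altPos p.blank ++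
  p.xor.prog 1 (p.pkL + p.altL + p.altL) (fun _ => p.xorIn) p.xorPos p.blank

/-- Copy one of the two ciphertexts `e`, `e'`, as `e + x₀ e' + x₀ e` for the first qubit `x₀`. -/
def selectProg : List Toffoli :=
  xorRange p.altL p.altOut p.altOut p.yPos ++
  (xorRange p.altL (fun _ => 0) p.xorOut p.yPos ++ xorRange p.altL (fun _ => 0) p.altOut p.yPos)

/-- The controlled encryption. The message bit is added to the second qubit. -/
def controlProg : List Toffoli :=
  p.cipherProg ++ p.selectProg ++ p.cipherProg.reverse ++ [(p.prepPos, p.prepPos, 1)]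

/-- Encryption of the inputs of the Pauli key update and homomorphic evaluation. -/
def evalProg : List Toffoli :=
  p.enc.prog p.updIn (p.pkL + 1 + p.encCoins) p.encIn p.encPos p.blank ++
  ((p.ev 0).prog 1 (p.evInL 0) (fun _ => p.evIn 0) (p.evPos + (0 : Fin 4) * p.evL) p.blank ++
  ((p.ev 1).prog 1 (p.evInL 1) (fun _ => p.evIn 1) (p.evPos + (1 : Fin 4) * p.evL) p.blank ++
  ((p.ev 2).prog 1 (p.evInL 2) (fun _ => p.evIn 2) (p.evPos + (2 : Fin 4) * p.evL) p.blank ++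
  (p.ev 3).prog 1 (p.evInL 3) (fun _ => p.evIn 3) (p.evPos + (3 : Fin 4) * p.evL) p.blank)))

/-- Copy the results. -/
def copyProg : List Toffoli :=
  xorRange p.ctL (p.evOut 0) (p.evOut 0) (p.outPos + (0 : Fin 4) * p.ctL) ++
  (xorRange p.ctL (p.evOut 1) (p.evOut 1) (p.outPos + (1 : Fin 4) * p.ctL) ++
  (xorRange p.ctL (p.evOut 2) (p.evOut 2) (p.outPos + (2 : Fin 4) * p.ctL) ++
  xorRange p.ctL (p.evOut 3) (p.evOut 3) (p.outPos + (3 : Fin 4) * p.ctL)))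

/-- Exchange the results with the first qubits of the input. -/
def swapProg : List Toffoli :=
  xorRange (4 * p.ctL) (fun t => p.outPos + t) (fun t => p.outPos + t) 2 ++
  (xorRange (4 * p.ctL) (fun t => 2 + t) (fun t => 2 + t) p.outPos ++
  xorRange (4 * p.ctL) (fun t => p.outPos + t) (fun t => p.outPos + t) 2)

/-- The program after the Hadamard transforms. -/
def finalProg : List Toffoli := p.evalProg ++ p.copyProg ++ p.swapProg

/-- The gates that set the qubits from `one` up to the outputs to one. -/
def onesGates : List QGate := (List.range (p.outPos - p.one)).map fun t => .x (p.one + t)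

/-- The preparation circuit, moved to its register. Qubits that do not exist are sent to qubits that do
not exist, so that gates without effect remain so. -/
def prepGates : List QGate :=
  p.prep.gates.map (QGate.rename fun q => if q < p.prepW then p.prepPos + q else p.total)

/-- Hadamard gates on the `n` qubits from `lo` on. -/
def hadamardGates (n lo : ℕ) : List QGate := (List.range n).map fun t => .h (lo + t)

/-- The machine. -/
def machine : QCircuit where
  anc := p.total - p.blank
  gates := p.onesGates ++ (p.initProg.map Toffoli.gate ++ (p.prepGates ++ p.controlProg.map Toffoli.gate ++
    hadamardGates (p.r + 1) p.prepPos ++ hadamardGates p.coins p.coinPos ++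
    p.finalProg.map Toffoli.gate))

end Parts

/-! ### Uniformity of the machine -/

section

variable {k : ℕ} {j a b c : (Fin k → ℕ) → ℕ}

theorem PolyTime.appendLoc {len : (Fin k → ℕ) → ℕ} {f g : (Fin k → ℕ) → ℕ → ℕ} (hlen : PolyTime len)
    (hj : PolyTime j) (hf : PolyTime fun v => f v (j v)) (hg : PolyTime fun v => g v (j v - len v)) :
    PolyTime fun v => appendLoc (len v) (f v) (g v) (j v) :=
  .ite_lt hj hlen hf hg

theorem PolyTime.ref {n base blank t idx : (Fin k → ℕ) → ℕ} {inLoc : (Fin k → ℕ) → ℕ → ℕ}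
    (hn : PolyTime n) (hin : PolyTime fun v => inLoc v (idx v)) (hbase : PolyTime base)
    (hblank : PolyTime blank) (ht : PolyTime t) (hidx : PolyTime idx) :
    PolyTime fun v => NandCircuit.ref (n v) (inLoc v) (base v) (blank v) (t v) (idx v) :=
  .ite_lt hidx hn hin (.ite_lt hidx (hn.add ht) (hbase.add (hidx.sub hn)) hblank)

namespace NandCircuit.Uniform

variable {C : (Fin k → ℕ) → NandCircuit}

theorem gate_fst (hC : NandCircuit.Uniform C) (hj : PolyTime j) :
    PolyTime fun v => ((C v).getD (j v) (0, 0)).1 :=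
  hC.2.1.subst hj (g := fun i v => v i) fun _ => .proj _

theorem gate_snd (hC : NandCircuit.Uniform C) (hj : PolyTime j) :
    PolyTime fun v => ((C v).getD (j v) (0, 0)).2 :=
  hC.2.2.subst hj (g := fun i v => v i) fun _ => .proj _

theorem outLoc (hC : NandCircuit.Uniform C) {n o base blank : (Fin k → ℕ) → ℕ}
    {inLoc : (Fin k → ℕ) → ℕ → ℕ} (hn : PolyTime n) (ho : PolyTime o)
    (hin : ∀ {i : (Fin k → ℕ) → ℕ}, PolyTime i → PolyTime fun v => inLoc v (i v))
    (hbase : PolyTime base) (hblank : PolyTime blank) (hj : PolyTime j) :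
    PolyTime fun v => (C v).outLoc (n v) (o v) (inLoc v) (base v) (blank v) (j v) :=
  have h := ((hn.add hC.1).sub ho).add hj
  .ref hn (hin h) hbase hblank hC.1 h

theorem codeLoc (hC : NandCircuit.Uniform C) {n one blank : (Fin k → ℕ) → ℕ} (hn : PolyTime n)
    (h1 : PolyTime one) (h0 : PolyTime blank) (hj : PolyTime j) :
    PolyTime fun v => (C v).codeLoc (n v) (one v) (blank v) (j v) := by
  have hL := hn.add hC.1
  have hm := hj.mod ((PolyTime.const 2).mul hL)
  have hd := hj.div ((PolyTime.const 2).mul hL)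
  exact .ite_lt hm hL (.ite_eq hm (hC.gate_fst hd) h1 h0)
    (.ite_eq (hm.sub hL) (hC.gate_snd hd) h1 h0)

theorem tail (hC : NandCircuit.Uniform C) :
    NandCircuit.Uniform fun v : Fin (k + 1) → ℕ => C (Fin.tail v) :=
  hC.comp (g := fun i v => v i.succ) fun _ => .proj _

theorem prog (hC : NandCircuit.Uniform C) {l n base blank : (Fin k → ℕ) → ℕ}
    {inLoc : (Fin k → ℕ) → ℕ → ℕ → ℕ} (hl : PolyTime l) (hn : PolyTime n)
    (hin : ∀ {i j : (Fin (k + 1) → ℕ) → ℕ}, PolyTime i → PolyTime j →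
      PolyTime fun v => inLoc (Fin.tail v) (i v) (j v))
    (hbase : PolyTime base) (hblank : PolyTime blank) :
    UniformGates fun v => ((C v).prog (l v) (n v) (inLoc v) (base v) (blank v)).map Toffoli.gate := by
  have hd := (PolyTime.proj (k := k + 1) 0).div hC.1.tail
  have hm := (PolyTime.proj (k := k + 1) 0).mod hC.1.tail
  have hb := hbase.tail.add (hd.mul hC.1.tail)
  have h1 := hC.tail.gate_fst hm
  have h2 := hC.tail.gate_snd hm
  have := UniformGates.ccx_range (hl.mul hC.1)
    (p := fun v t => ref (n v) (inLoc v (t / (C v).length))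
      (base v + t / (C v).length * (C v).length) (blank v) (t % (C v).length)
      ((C v).getD (t % (C v).length) (0, 0)).1)
    (q := fun v t => ref (n v) (inLoc v (t / (C v).length))
      (base v + t / (C v).length * (C v).length) (blank v) (t % (C v).length)
      ((C v).getD (t % (C v).length) (0, 0)).2)
    (r := fun v t => base v + t)
    (.ref hn.tail (hin hd h1) hb hblank.tail hm h1) (.ref hn.tail (hin hd h2) hb hblank.tail hm h2)
    (hbase.tail.add (.proj 0))
  simp only [NandCircuit.prog, List.map_map]
  exact this

end NandCircuit.Uniform
end

namespace Parts

/-- The parts can be computed in polynomial time. -/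
structure Uniform {k : ℕ} (P : (Fin k → ℕ) → Parts) : Prop where
  lvl : PolyTime fun v => (P v).lvl
  idx : PolyTime fun v => (P v).idx
  pkL : PolyTime fun v => (P v).pkL
  evkL : PolyTime fun v => (P v).evkL
  skL : PolyTime fun v => (P v).skL
  tdL : PolyTime fun v => (P v).tdL
  ctL : PolyTime fun v => (P v).ctL
  encCoins : PolyTime fun v => (P v).encCoins
  r : PolyTime fun v => (P v).r
  altL : PolyTime fun v => (P v).altL
  evalCoins : ∀ a, PolyTime fun v => (P v).evalCoins a
  conv : NandCircuit.Uniform fun v => (P v).conv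
  alt : NandCircuit.Uniform fun v => (P v).alt
  xor : NandCircuit.Uniform fun v => (P v).xor
  enc : NandCircuit.Uniform fun v => (P v).enc
  ev : ∀ a, NandCircuit.Uniform fun v => (P v).ev a
  upd : ∀ a, NandCircuit.Uniform fun v => (P v).upd a
  prep : QCircuit.Uniform fun v => (P v).prep

namespace Uniform

variable {k : ℕ} {P : (Fin k → ℕ) → Parts} {j q : (Fin k → ℕ) → ℕ}

theorem tail (h : Uniform P) : Uniform fun v : Fin (k + 1) → ℕ => P (Fin.tail v) where
  lvl := h.lvl.tail
  idx := h.idx.tail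
  pkL := h.pkL.tail
  evkL := h.evkL.tail
  skL := h.skL.tail
  tdL := h.tdL.tail
  ctL := h.ctL.tail
  encCoins := h.encCoins.tail
  r := h.r.tail
  altL := h.altL.tail
  evalCoins a := (h.evalCoins a).tail
  conv := h.conv.tail
  alt := h.alt.tail
  xor := h.xor.tail
  enc := h.enc.tail
  ev a := (h.ev a).tail
  upd a := (h.upd a).tail
  prep := h.prep.comp (g := fun i v => v i.succ) fun _ => .proj _

theorem levelLen (h : Uniform P) : PolyTime fun v => (P v).levelLen :=
  (h.pkL.add (h.skL.mul h.ctL)).add (h.tdL.mul h.ctL)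

theorem updIn (h : Uniform P) : PolyTime fun v => (P v).updIn :=
  (((((h.pkL.add h.skL).add h.tdL).add ((PolyTime.const 4).mul h.ctL)).add h.altL).add h.altL).add
    h.r.succ

theorem prepW (h : Uniform P) : PolyTime fun v => (P v).prepW := h.pkL.add h.prep.1

theorem evalW (h : Uniform P) : PolyTime fun v => (P v).evalW :=
  (((h.evalCoins 0).add (h.evalCoins 1)).add (h.evalCoins 2)).add (h.evalCoins 3)

theorem coins (h : Uniform P) : PolyTime fun v => (P v).coins :=
  (h.updIn.mul h.encCoins).add ((PolyTime.const 4).mul h.evalW)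

theorem evL (h : Uniform P) : PolyTime fun v => (P v).evL :=
  (((h.ev 0).1.add (h.ev 1).1).add (h.ev 2).1).add (h.ev 3).1

theorem lvlPos (h : Uniform P) : PolyTime fun v => (P v).lvlPos :=
  ((PolyTime.const 2).add h.pkL).add (h.lvl.succ.mul h.evkL)

theorem pkPos (h : Uniform P) : PolyTime fun v => (P v).pkPos :=
  .ite_eq h.idx .zero (.const 2) (h.lvlPos.add ((h.idx.sub (.const 1)).mul h.levelLen))

theorem pkNext (h : Uniform P) : PolyTime fun v => (P v).pkNext := h.lvlPos.add (h.idx.mul h.levelLen)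

theorem skPos (h : Uniform P) : PolyTime fun v => (P v).skPos := h.pkNext.add h.pkL

theorem evkNext (h : Uniform P) : PolyTime fun v => (P v).evkNext :=
  ((PolyTime.const 2).add h.pkL).add (h.idx.succ.mul h.evkL)

theorem cPos (h : Uniform P) : PolyTime fun v => (P v).cPos := h.lvlPos.add (h.lvl.mul h.levelLen)

theorem czPos (h : Uniform P) : PolyTime fun v => (P v).czPos := h.cPos.add h.ctL

theorem four_ctL (h : Uniform P) : PolyTime fun v => 4 * (P v).ctL := (PolyTime.const 4).mul h.ctL

theorem blank (h : Uniform P) : PolyTime fun v => (P v).blank := h.czPos.add h.four_ctL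

theorem prepPos (h : Uniform P) : PolyTime fun v => (P v).prepPos := h.blank.succ

theorem yPos (h : Uniform P) : PolyTime fun v => (P v).yPos := (h.prepPos.add h.r.succ).add h.prepW

theorem coinPos (h : Uniform P) : PolyTime fun v => (P v).coinPos := h.yPos.add h.altL

theorem one (h : Uniform P) : PolyTime fun v => (P v).one := h.coinPos.add h.coins

theorem convPos (h : Uniform P) : PolyTime fun v => (P v).convPos := h.one.succ

theorem altPos (h : Uniform P) : PolyTime fun v => (P v).altPos := h.convPos.add h.conv.1

theorem xorPos (h : Uniform P) : PolyTime fun v => (P v).xorPos := h.altPos.add h.alt.1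

theorem encPos (h : Uniform P) : PolyTime fun v => (P v).encPos := h.xorPos.add h.xor.1

theorem evPos (h : Uniform P) : PolyTime fun v => (P v).evPos := h.encPos.add (h.updIn.mul h.enc.1)

theorem outPos (h : Uniform P) : PolyTime fun v => (P v).outPos :=
  h.evPos.add ((PolyTime.const 4).mul h.evL)

theorem total (h : Uniform P) : PolyTime fun v => (P v).total := h.outPos.add h.four_ctL

theorem convIn (h : Uniform P) (hj : PolyTime j) : PolyTime fun v => (P v).convIn (j v) :=
  .appendLoc h.pkL hj (h.pkPos.add hj) (h.cPos.add (hj.sub h.pkL))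

theorem convOut (h : Uniform P) (hj : PolyTime j) : PolyTime fun v => (P v).convOut (j v) :=
  h.conv.outLoc (h.pkL.add h.ctL) h.altL h.convIn h.convPos h.blank hj

theorem altIn (h : Uniform P) (hj : PolyTime j) : PolyTime fun v => (P v).altIn (j v) :=
  .appendLoc h.pkL hj (h.pkPos.add hj) (h.prepPos.add (hj.sub h.pkL))

theorem altOut (h : Uniform P) (hj : PolyTime j) : PolyTime fun v => (P v).altOut (j v) :=
  h.alt.outLoc (h.pkL.add h.r.succ) h.altL h.altIn h.altPos h.blank hj

theorem xorIn (h : Uniform P) (hj : PolyTime j) : PolyTime fun v => (P v).xorIn (j v) :=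
  .appendLoc (h.pkL.add h.altL) hj
    (.appendLoc h.pkL hj (h.pkPos.add hj) (h.altOut (hj.sub h.pkL)))
    (h.convOut (hj.sub (h.pkL.add h.altL)))

theorem xorOut (h : Uniform P) (hj : PolyTime j) : PolyTime fun v => (P v).xorOut (j v) :=
  h.xor.outLoc ((h.pkL.add h.altL).add h.altL) h.altL h.xorIn h.xorPos h.blank hj

theorem bitLoc (h : Uniform P) (hj : PolyTime j) : PolyTime fun v => (P v).bitLoc (j v) := by
  have h1 := (h.pkL.add h.skL).add h.tdL
  have h2 := h1.add h.four_ctL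
  have h3 := h2.add h.altL
  have h4 := h3.add h.altL
  exact .appendLoc h4 hj (.appendLoc h3 hj (.appendLoc h2 hj (.appendLoc h1 hj
    (.appendLoc h.pkL hj (h.pkPos.add hj) h.blank) (h.czPos.add (hj.sub h1)))
    (h.convOut (hj.sub h2))) (h.yPos.add (hj.sub h3))) (h.prepPos.add (hj.sub h4))

theorem encIn (h : Uniform P) (hq : PolyTime q) (hj : PolyTime j) :
    PolyTime fun v => (P v).encIn (q v) (j v) :=
  .appendLoc h.pkL.succ hj (.appendLoc h.pkL hj (h.pkNext.add hj) (h.bitLoc hq))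
    ((h.coinPos.add (hq.mul h.encCoins)).add (hj.sub h.pkL.succ))

theorem encOut (h : Uniform P) (hq : PolyTime q) (hj : PolyTime j) :
    PolyTime fun v => (P v).encOut (q v) (j v) :=
  h.enc.outLoc (h.pkL.succ.add h.encCoins) h.ctL (h.encIn hq) (h.encPos.add (hq.mul h.enc.1)) h.blank hj

theorem ctLoc (h : Uniform P) (hq : PolyTime q) (hj : PolyTime j) :
    PolyTime fun v => (P v).ctLoc (q v) (j v) :=
  .ite_lt hq h.pkL (h.encOut hq hj) (.ite_lt hq ((h.pkL.add h.skL).add h.tdL)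
    ((h.skPos.add ((hq.sub h.pkL).mul h.ctL)).add hj) (h.encOut hq hj))

theorem codeLen (h : Uniform P) (a : Fin 4) : PolyTime fun v => (P v).codeLen a :=
  (h.upd a).1.mul ((PolyTime.const 2).mul (h.updIn.add (h.upd a).1))

theorem evIn (h : Uniform P) (a : Fin 4) (hj : PolyTime j) : PolyTime fun v => (P v).evIn a (j v) := by
  have h1 := h.evkL.add (h.codeLen a)
  have h2 := h1.add (h.updIn.mul h.ctL)
  exact .appendLoc h2 hj (.appendLoc h1 hj (.appendLoc h.evkL hj (h.evkNext.add hj)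
    ((h.upd a).codeLoc h.updIn h.one h.blank (hj.sub h.evkL)))
    (h.ctLoc ((hj.sub h1).div h.ctL) ((hj.sub h1).mod h.ctL)))
    (((h.coinPos.add (h.updIn.mul h.encCoins)).add ((PolyTime.const a).mul h.evalW)).add (hj.sub h2))

theorem evInL (h : Uniform P) (a : Fin 4) : PolyTime fun v => (P v).evInL a :=
  ((h.evkL.add (h.codeLen a)).add (h.updIn.mul h.ctL)).add (h.evalCoins a)

theorem evBase (h : Uniform P) (a : Fin 4) : PolyTime fun v => (P v).evPos + a * (P v).evL :=
  h.evPos.add ((PolyTime.const a).mul h.evL)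

theorem evOut (h : Uniform P) (a : Fin 4) (hj : PolyTime j) : PolyTime fun v => (P v).evOut a (j v) :=
  (h.ev a).outLoc (h.evInL a) h.ctL (h.evIn a) (h.evBase a) h.blank hj

theorem xorRange {n T : (Fin k → ℕ) → ℕ} {f g : (Fin k → ℕ) → ℕ → ℕ} (hn : PolyTime n)
    (hf : PolyTime fun v : Fin (k + 1) → ℕ => f (Fin.tail v) (v 0))
    (hg : PolyTime fun v : Fin (k + 1) → ℕ => g (Fin.tail v) (v 0)) (hT : PolyTime T) :
    UniformGates fun v => (Parts.xorRange (n v) (f v) (g v) (T v)).map Toffoli.gate := by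
  have := UniformGates.ccx_range (r := fun v t => T v + t) hn hf hg (hT.tail.add (.proj 0))
  simp only [Parts.xorRange, List.map_map]
  exact this

theorem initProg (h : Uniform P) : UniformGates fun v => (P v).initProg.map Toffoli.gate := by
  have h1 := h.pkPos.tail.add (.proj 0)
  have := (xorRange (f := fun v t => (P v).pkPos + t) (g := fun v t => (P v).pkPos + t) h.pkL h1 h1
    h.prepPos).append
    (h.conv.prog (inLoc := fun v _ => (P v).convIn) (.const 1) (h.pkL.add h.ctL)
      (fun _ hj => h.tail.convIn hj) h.convPos h.blank)
  simpa only [Parts.initProg, List.map_append] using this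

theorem cipherProg (h : Uniform P) : UniformGates fun v => (P v).cipherProg.map Toffoli.gate := by
  have := (h.alt.prog (inLoc := fun v _ => (P v).altIn) (.const 1) (h.pkL.add h.r.succ)
      (fun _ hj => h.tail.altIn hj) h.altPos h.blank).append
    (h.xor.prog (inLoc := fun v _ => (P v).xorIn) (.const 1) ((h.pkL.add h.altL).add h.altL)
      (fun _ hj => h.tail.xorIn hj) h.xorPos h.blank)
  simpa only [Parts.cipherProg, List.map_append] using this

theorem selectProg (h : Uniform P) : UniformGates fun v => (P v).selectProg.map Toffoli.gate := by
  have h1 := h.tail.altOut (.proj 0)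
  have := (xorRange (f := fun v => (P v).altOut) (g := fun v => (P v).altOut) h.altL h1 h1 h.yPos).append
    ((xorRange (f := fun _ _ => 0) (g := fun v => (P v).xorOut) h.altL .zero (h.tail.xorOut (.proj 0))
      h.yPos).append
    (xorRange (f := fun _ _ => 0) (g := fun v => (P v).altOut) h.altL .zero h1 h.yPos))
  simpa only [Parts.selectProg, List.map_append] using this

theorem controlProg (h : Uniform P) : UniformGates fun v => (P v).controlProg.map Toffoli.gate := by
  have h1 := h.prepPos.tail
  have := ((h.cipherProg.append h.selectProg).append h.cipherProg.reverse).append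
    (UniformGates.ccx_range (p := fun v _ => (P v).prepPos) (q := fun v _ => (P v).prepPos)
      (r := fun _ _ => 1) (.const 1) h1 h1 (.const 1))
  simp only [Parts.controlProg, List.map_append, List.map_reverse]
  exact this

theorem evalProg (h : Uniform P) : UniformGates fun v => (P v).evalProg.map Toffoli.gate := by
  have h1 := fun a => (h.ev a).prog (inLoc := fun v _ => (P v).evIn a) (.const 1) (h.evInL a)
    (fun _ hj => h.tail.evIn a hj) (h.evBase a) h.blank
  have := (h.enc.prog (inLoc := fun v => (P v).encIn) h.updIn (h.pkL.succ.add h.encCoins)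
    (fun hq hj => h.tail.encIn hq hj) h.encPos h.blank).append
    ((h1 0).append ((h1 1).append ((h1 2).append (h1 3))))
  simpa only [Parts.evalProg, List.map_append] using this

theorem copyProg (h : Uniform P) : UniformGates fun v => (P v).copyProg.map Toffoli.gate := by
  have h1 := fun a : Fin 4 => h.tail.evOut a (.proj 0)
  have h2 := fun a : Fin 4 => xorRange (f := fun v => (P v).evOut a) (g := fun v => (P v).evOut a)
    h.ctL (h1 a) (h1 a) (h.outPos.add ((PolyTime.const a).mul h.ctL))
  have := (h2 0).append ((h2 1).append ((h2 2).append (h2 3)))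
  simpa only [Parts.copyProg, List.map_append] using this

theorem swapProg (h : Uniform P) : UniformGates fun v => (P v).swapProg.map Toffoli.gate := by
  have h1 := h.outPos.tail.add (.proj 0)
  have h2 : PolyTime fun v : Fin (k + 1) → ℕ => 2 + v 0 := (PolyTime.const 2).add (.proj 0)
  have h3 := xorRange (f := fun v t => (P v).outPos + t) (g := fun v t => (P v).outPos + t)
    h.four_ctL h1 h1 (.const 2)
  have := h3.append ((xorRange (f := fun _ t => 2 + t) (g := fun _ t => 2 + t) h.four_ctL h2 h2
    h.outPos).append h3)
  simpa only [Parts.swapProg, List.map_append] using this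

theorem machine (h : Uniform P) : QCircuit.Uniform fun v => (P v).machine := by
  have h1 := (h.evalProg.append h.copyProg).append h.swapProg
  simp only [← List.map_append] at h1
  have h2 := (UniformGates.x_range (p := fun v t => (P v).one + t) (h.outPos.sub h.one)
    (h.one.tail.add (.proj 0))).append (h.initProg.append
    (((((UniformGates.rename (ρ := fun v q => if q < (P v).prepW then (P v).prepPos + q else (P v).total)
      ⟨h.prep.2.1, h.prep.2.2⟩ (.ite_lt (.proj 0) h.prepW.tail (h.prepPos.tail.add (.proj 0))
        h.total.tail)).append h.controlProg).append
    (UniformGates.h_range (p := fun v t => (P v).prepPos + t) h.r.succ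
      (h.prepPos.tail.add (.proj 0)))).append
    (UniformGates.h_range (p := fun v t => (P v).coinPos + t) h.coins
      (h.coinPos.tail.add (.proj 0)))).append h1))
  exact ⟨h.total.sub h.blank, h2.1, h2.2⟩

end Uniform
end Parts

/-! ### Places used by the machine -/

section Places

variable {Q : ℕ → Prop}

theorem appendLoc_mem {len len' : ℕ} {f g : ℕ → ℕ} (hf : ∀ j < len, Q (f j)) (hg : ∀ j < len', Q (g j)) :
    ∀ j < len + len', Q (appendLoc len f g j) := fun j hj => by
  unfold appendLoc
  split_ifs with h
  · exact hf j h
  · exact hg _ (by omega)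

theorem blockLoc_mem {n len : ℕ} {f : ℕ → ℕ → ℕ} (hf : ∀ i < n, ∀ j < len, Q (f i j)) :
    ∀ j < n * len, Q (blockLoc len f j) := fun j hj =>
  hf _ (Nat.div_lt_of_lt_mul (by rwa [Nat.mul_comm])) _
    (Nat.mod_lt _ (Nat.pos_of_ne_zero fun h => by simp [h] at hj))

namespace NandCircuit

theorem codeLoc_mem (C : NandCircuit) {n one blank : ℕ} (h1 : Q one) (h0 : Q blank) (j : ℕ) :
    Q (C.codeLoc n one blank j) := by
  simp only [codeLoc, blockLoc, appendLoc]
  split_ifs <;> assumption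

theorem ref_mem {n base blank k : ℕ} {inLoc : ℕ → ℕ} (hin : ∀ j < n, Q (inLoc j)) (h0 : Q blank)
    (hb : ∀ t < k, Q (base + t)) (idx : ℕ) : Q (ref n inLoc base blank k idx) := by
  unfold ref
  split_ifs with h1 h2
  · exact hin _ h1
  · exact hb _ (by omega)
  · exact h0

theorem prog_mem (C : NandCircuit) {l n base blank : ℕ} {inLoc : ℕ → ℕ → ℕ}
    (hin : ∀ i < l, ∀ j < n, Q (inLoc i j)) (h0 : Q blank) (hb : ∀ t < l * C.length, Q (base + t)) :
    ∀ g ∈ C.prog l n inLoc base blank, Q g.1 ∧ Q g.2.1 ∧ Q g.2.2 := by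
  intro g hg
  obtain ⟨t, ht, rfl⟩ := List.mem_map.1 hg
  have ht := List.mem_range.1 ht
  have h1 : t / C.length < l := Nat.div_lt_of_lt_mul (by rwa [Nat.mul_comm])
  have h2 : ∀ s < t % C.length, Q (base + t / C.length * C.length + s) := fun s hs => by
    have := Nat.div_add_mod t C.length
    rw [Nat.mul_comm] at this
    rw [Nat.add_assoc]
    exact hb _ (by omega)
  exact ⟨ref_mem (hin _ h1) h0 h2 _, ref_mem (hin _ h1) h0 h2 _, hb t ht⟩

end NandCircuit
end Places

namespace Parts

variable (p : Parts)

theorem lvl_bounds (hi : p.idx < p.lvl) :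
    2 ≤ p.pkPos ∧ p.pkPos + p.pkL ≤ p.cPos ∧ 2 ≤ p.skPos ∧ p.pkNext + p.pkL = p.skPos ∧ 2 ≤ p.pkNext ∧
      p.skPos + (p.skL + p.tdL) * p.ctL ≤ p.cPos ∧ 2 ≤ p.evkNext ∧ p.evkNext + p.evkL ≤ p.cPos := by
  have h1 : p.idx * p.levelLen + p.levelLen ≤ p.lvl * p.levelLen := by
    rw [← Nat.succ_mul]
    exact Nat.mul_le_mul_right _ hi
  have h2 : (p.idx + 1) * p.evkL + p.evkL ≤ (p.lvl + 1) * p.evkL := by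
    rw [← Nat.succ_mul]
    exact Nat.mul_le_mul_right _ (by omega)
  have h3 : p.levelLen = p.pkL + (p.skL + p.tdL) * p.ctL := by rw [levelLen]; ring
  have h4 : p.idx ≠ 0 → (p.idx - 1) * p.levelLen + p.levelLen = p.idx * p.levelLen := fun h => by
    rw [← Nat.succ_mul, Nat.succ_eq_add_one, Nat.sub_add_cancel (by omega)]
  simp only [pkPos, skPos, pkNext, evkNext, cPos, lvlPos]
  refine ⟨?_, ?_, ?_, ?_, ?_, ?_, ?_, ?_⟩ <;> try omega
  · split_ifs <;> omega
  · split_ifs with h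
    · omega
    · have := h4 h
      omega
  · trivial

theorem positions : p.czPos = p.cPos + p.ctL ∧ p.blank = p.czPos + 4 * p.ctL ∧
    p.prepPos = p.blank + 1 ∧ p.yPos = p.prepPos + (p.r + 1) + p.prepW ∧ p.prepW = p.pkL + p.prep.anc ∧
    p.coinPos = p.yPos + p.altL ∧ p.one = p.coinPos + p.coins ∧ p.convPos = p.one + 1 ∧
    p.altPos = p.convPos + p.conv.length ∧ p.xorPos = p.altPos + p.alt.length ∧
    p.encPos = p.xorPos + p.xor.length ∧ p.evPos = p.encPos + p.updIn * p.enc.length ∧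
    p.outPos = p.evPos + 4 * p.evL ∧ p.total = p.outPos + 4 * p.ctL ∧
    p.coins = p.updIn * p.encCoins + 4 * p.evalW :=
  ⟨rfl, rfl, rfl, rfl, rfl, rfl, rfl, rfl, rfl, rfl, rfl, rfl, rfl, rfl, rfl⟩

theorem length_ev_le (a : Fin 4) : a * p.evL + (p.ev a).length ≤ (a + 1) * p.evL ∧
    (a + 1) * p.evL ≤ 4 * p.evL := by
  refine ⟨?_, Nat.mul_le_mul_right _ a.2⟩
  rw [Nat.succ_mul]
  refine Nat.add_le_add_left ?_ _
  fin_cases a <;> simp [evL] <;> omega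

theorem evalCoins_le (a : Fin 4) : a * p.evalW + p.evalCoins a ≤ 4 * p.evalW := by
  have h1 : p.evalCoins a ≤ p.evalW := by
    fin_cases a <;> simp [evalW] <;> omega
  have h2 : (a + 1) * p.evalW ≤ 4 * p.evalW := Nat.mul_le_mul_right _ a.2
  rw [Nat.succ_mul] at h2
  omega

theorem mul_encCoins_le {q : ℕ} (hq : q < p.updIn) :
    q * p.encCoins + p.encCoins ≤ p.updIn * p.encCoins := by
  rw [← Nat.succ_mul]
  exact Nat.mul_le_mul_right _ hq

section

variable {p : Parts}

theorem convIn_mem (hi : p.idx < p.lvl) (j : ℕ) (hj : j < p.pkL + p.ctL) : 2 ≤ p.convIn j ∧ p.convIn j ≤ p.blank := by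
  have h1 := p.lvl_bounds hi
  have h2 := p.positions
  exact appendLoc_mem (Q := fun q => 2 ≤ q ∧ q ≤ p.blank) (fun j hj => by omega)
    (fun j hj => by omega) j hj

theorem convOut_mem (hi : p.idx < p.lvl) (j : ℕ) : 2 ≤ p.convOut j ∧
    (p.convOut j ≤ p.blank ∨ p.convPos ≤ p.convOut j ∧ p.convOut j < p.altPos) := by
  have h1 := p.lvl_bounds hi
  have h2 := p.positions
  exact NandCircuit.ref_mem (Q := fun q => 2 ≤ q ∧ (q ≤ p.blank ∨ p.convPos ≤ q ∧ q < p.altPos))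
    (fun j hj => by have := convIn_mem hi j hj; omega) (by omega) (fun t ht => by omega) _

theorem altIn_mem (hi : p.idx < p.lvl) (j : ℕ) (hj : j < p.pkL + (p.r + 1)) : 2 ≤ p.altIn j ∧ p.altIn j < p.yPos := by
  have h1 := p.lvl_bounds hi
  have h2 := p.positions
  exact appendLoc_mem (Q := fun q => 2 ≤ q ∧ q < p.yPos) (fun j hj => by omega)
    (fun j hj => by omega) j hj

theorem altOut_mem (hi : p.idx < p.lvl) (j : ℕ) : 2 ≤ p.altOut j ∧ p.altOut j < p.xorPos ∧
    (p.altOut j < p.yPos ∨ p.convPos ≤ p.altOut j) := by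
  have h1 := p.lvl_bounds hi
  have h2 := p.positions
  exact NandCircuit.ref_mem (Q := fun q => 2 ≤ q ∧ q < p.xorPos ∧ (q < p.yPos ∨ p.convPos ≤ q))
    (fun j hj => by have := altIn_mem hi j hj; omega) (by omega) (fun t ht => by omega) _

theorem xorIn_mem (hi : p.idx < p.lvl) (j : ℕ) (hj : j < p.pkL + p.altL + p.altL) : 2 ≤ p.xorIn j ∧ p.xorIn j < p.xorPos ∧
    (p.xorIn j < p.yPos ∨ p.convPos ≤ p.xorIn j) := by
  have h1 := p.lvl_bounds hi
  have h2 := p.positions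
  exact appendLoc_mem (Q := fun q => 2 ≤ q ∧ q < p.xorPos ∧ (q < p.yPos ∨ p.convPos ≤ q))
    (appendLoc_mem (Q := fun q => 2 ≤ q ∧ q < p.xorPos ∧ (q < p.yPos ∨ p.convPos ≤ q))
      (fun j hj => by omega) (fun j _ => altOut_mem hi j))
    (fun j hj => by have := convOut_mem hi j; omega) j hj

theorem xorOut_mem (hi : p.idx < p.lvl) (j : ℕ) : 2 ≤ p.xorOut j ∧ p.xorOut j < p.encPos ∧
    (p.xorOut j < p.yPos ∨ p.convPos ≤ p.xorOut j) := by
  have h1 := p.lvl_bounds hi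
  have h2 := p.positions
  exact NandCircuit.ref_mem (Q := fun q => 2 ≤ q ∧ q < p.encPos ∧ (q < p.yPos ∨ p.convPos ≤ q))
    (fun j hj => by have := xorIn_mem hi j hj; omega) (by omega) (fun t ht => by omega) _

theorem bitLoc_mem (hi : p.idx < p.lvl) (j : ℕ) (hj : j < p.updIn) : 2 ≤ p.bitLoc j ∧ p.bitLoc j < p.encPos := by
  have h1 := p.lvl_bounds hi
  have h2 := p.positions
  have h3 : p.pkL + p.skL + p.tdL = p.pkL + (p.skL + p.tdL) := by omega
  refine appendLoc_mem (Q := fun q => 2 ≤ q ∧ q < p.encPos) (len' := p.r + 1)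
    (appendLoc_mem (Q := fun q => 2 ≤ q ∧ q < p.encPos) (appendLoc_mem (Q := fun q => 2 ≤ q ∧ q < p.encPos)
    (appendLoc_mem (Q := fun q => 2 ≤ q ∧ q < p.encPos) ?_ (fun j hj => by omega))
    (fun j hj => by have := convOut_mem hi j; omega)) (fun j hj => by omega)) (fun j hj => by omega) j hj
  rw [h3]
  exact appendLoc_mem (Q := fun q => 2 ≤ q ∧ q < p.encPos) (fun j hj => by omega) (fun j hj => by omega)

theorem encIn_mem (hi : p.idx < p.lvl) (q : ℕ) (hq : q < p.updIn) (j : ℕ) (hj : j < p.pkL + 1 + p.encCoins) :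
    2 ≤ p.encIn q j ∧ p.encIn q j < p.encPos := by
  have h1 := p.lvl_bounds hi
  have h2 := p.positions
  have h3 := p.mul_encCoins_le hq
  exact appendLoc_mem (Q := fun q => 2 ≤ q ∧ q < p.encPos)
    (appendLoc_mem (Q := fun q => 2 ≤ q ∧ q < p.encPos) (fun j hj => by omega)
      (fun j _ => bitLoc_mem hi q hq)) (fun j hj => by omega) j hj

theorem encOut_mem (hi : p.idx < p.lvl) (q : ℕ) (hq : q < p.updIn) (j : ℕ) : 2 ≤ p.encOut q j ∧ p.encOut q j < p.evPos := by
  have h1 := p.lvl_bounds hi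
  have h2 := p.positions
  have h3 : q * p.enc.length + p.enc.length ≤ p.updIn * p.enc.length := by
    rw [← Nat.succ_mul]
    exact Nat.mul_le_mul_right _ hq
  exact NandCircuit.ref_mem (Q := fun q => 2 ≤ q ∧ q < p.evPos)
    (fun j hj => by have := encIn_mem hi q hq j hj; omega) (by omega) (fun t ht => by omega) _

theorem ctLoc_mem (hi : p.idx < p.lvl) (q : ℕ) (hq : q < p.updIn) (j : ℕ) (hj : j < p.ctL) :
    2 ≤ p.ctLoc q j ∧ p.ctLoc q j < p.evPos := by
  have h1 := p.lvl_bounds hi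
  have h2 := p.positions
  have h3 := encOut_mem hi q hq j
  unfold ctLoc
  split_ifs with h4 h5
  · exact h3
  · have h6 : (q - p.pkL) * p.ctL + p.ctL ≤ (p.skL + p.tdL) * p.ctL := by
      rw [← Nat.succ_mul]
      exact Nat.mul_le_mul_right _ (by omega)
    omega
  · exact h3

theorem evIn_mem (hi : p.idx < p.lvl) (a : Fin 4) (j : ℕ) (hj : j < p.evInL a) : 2 ≤ p.evIn a j ∧ p.evIn a j < p.evPos := by
  have h1 := p.lvl_bounds hi
  have h2 := p.positions
  have h3 := p.evalCoins_le a
  exact appendLoc_mem (Q := fun q => 2 ≤ q ∧ q < p.evPos)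
    (appendLoc_mem (Q := fun q => 2 ≤ q ∧ q < p.evPos)
      (appendLoc_mem (Q := fun q => 2 ≤ q ∧ q < p.evPos) (fun j hj => by omega)
        (fun j _ => NandCircuit.codeLoc_mem (Q := fun q => 2 ≤ q ∧ q < p.evPos) _ (by omega)
          (by omega) j))
      (blockLoc_mem (Q := fun q => 2 ≤ q ∧ q < p.evPos) (ctLoc_mem hi)))
    (fun j hj => by omega) j hj

theorem evOut_mem (hi : p.idx < p.lvl) (a : Fin 4) (j : ℕ) : 2 ≤ p.evOut a j ∧ p.evOut a j < p.outPos := by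
  have h1 := p.lvl_bounds hi
  have h2 := p.positions
  have h3 := p.length_ev_le a
  exact NandCircuit.ref_mem (Q := fun q => 2 ≤ q ∧ q < p.outPos)
    (fun j hj => by have := evIn_mem hi a j hj; omega) (by omega) (fun t ht => by omega) _

/-! ### Shape of the programs -/

theorem initProg_straightLine (hi : p.idx < p.lvl) : StraightLine p.prepPos p.altPos p.initProg := by
  have h1 := p.lvl_bounds hi
  have h2 := p.positions
  refine ((StraightLine.range_map (lo := p.prepPos) (n := p.pkL) (fun t ht => ?_) fun t ht => ?_).mono
    le_rfl (show _ ≤ p.convPos by omega)).append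
    ((p.conv.prog_straightLine (l := 1) (fun _ _ j hj => ?_) ?_).mono le_rfl ?_) ?_ ?_
  · omega
  · omega
  · have := convIn_mem hi j hj; omega
  · omega
  · omega
  · omega
  · omega

theorem cipherProg_straightLine (hi : p.idx < p.lvl) : StraightLine p.altPos p.encPos p.cipherProg := by
  have h1 := p.lvl_bounds hi
  have h2 := p.positions
  refine ((p.alt.prog_straightLine (l := 1) (fun _ _ j hj => ?_) ?_).mono le_rfl
    (show _ ≤ p.xorPos by omega)).append
    ((p.xor.prog_straightLine (l := 1) (fun _ _ j hj => ?_) ?_).mono le_rfl ?_) ?_ ?_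
  · have := altIn_mem hi j hj; omega
  · omega
  · have := xorIn_mem hi j hj; omega
  · omega
  · omega
  · omega
  · omega

theorem evalProg_straightLine (hi : p.idx < p.lvl) : StraightLine p.encPos p.outPos p.evalProg := by
  have h1 := p.lvl_bounds hi
  have h2 := p.positions
  have h3 : ∀ a : Fin 4, StraightLine (p.evPos + a * p.evL) (p.evPos + (a + 1) * p.evL)
      ((p.ev a).prog 1 (p.evInL a) (fun _ => p.evIn a) (p.evPos + a * p.evL) p.blank) := fun a => by
    have h4 := p.length_ev_le a
    exact ((p.ev a).prog_straightLine (l := 1) (fun _ _ j hj => by have := evIn_mem hi a j hj; omega)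
      (by omega)).mono le_rfl (by omega)
  have h5 := p.enc.prog_straightLine (l := p.updIn) (base := p.encPos) (blank := p.blank)
    (fun q hq j hj => (encIn_mem hi q hq j hj).2) (by omega)
  have e0 : ((0 : Fin 4) : ℕ) = 0 := rfl
  have e1 : ((1 : Fin 4) : ℕ) = 1 := rfl
  have e2 : ((2 : Fin 4) : ℕ) = 2 := rfl
  have e3 : ((3 : Fin 4) : ℕ) = 3 := rfl
  have g0 := h3 0
  have g1 := h3 1
  have g2 := h3 2
  have g3 := h3 3
  unfold evalProg
  rw [e0] at g0 ⊢
  rw [e1] at g1 ⊢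
  rw [e2] at g2 ⊢
  rw [e3] at g3 ⊢
  refine (h5.mono le_rfl (show _ ≤ p.evPos + 0 * p.evL by omega)).append
    (g0.append (g1.append (g2.append (g3.mono le_rfl ?_) ?_ ?_) ?_ ?_) ?_ ?_) ?_ ?_ <;> omega

theorem copyProg_straightLine (hi : p.idx < p.lvl) : StraightLine p.outPos p.total p.copyProg := by
  have h2 := p.positions
  have h3 : ∀ a : Fin 4, StraightLine (p.outPos + a * p.ctL) (p.outPos + (a + 1) * p.ctL)
      (xorRange p.ctL (p.evOut a) (p.evOut a) (p.outPos + a * p.ctL)) := fun a =>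
    (StraightLine.range_map (fun t _ => by have := evOut_mem hi a t; omega)
      fun t _ => by have := evOut_mem hi a t; omega).mono le_rfl (by rw [Nat.succ_mul]; omega)
  have e0 : ((0 : Fin 4) : ℕ) = 0 := rfl
  have e1 : ((1 : Fin 4) : ℕ) = 1 := rfl
  have e2 : ((2 : Fin 4) : ℕ) = 2 := rfl
  have e3 : ((3 : Fin 4) : ℕ) = 3 := rfl
  have g0 := h3 0
  have g1 := h3 1
  have g2 := h3 2
  have g3 := h3 3
  unfold copyProg
  rw [e0] at g0 ⊢
  rw [e1] at g1 ⊢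
  rw [e2] at g2 ⊢
  rw [e3] at g3 ⊢
  refine (g0.mono (by omega) le_rfl).append (g1.append (g2.append (g3.mono le_rfl ?_) ?_ ?_) ?_ ?_) ?_ ?_ <;>
    omega

/-- The encryption program does not touch the two qubits, the ciphertext register and the coins. -/
theorem cipherProg_mem (hi : p.idx < p.lvl) : ∀ g ∈ p.cipherProg, ∀ q, q = g.1 ∨ q = g.2.1 ∨ q = g.2.2 →
    2 ≤ q ∧ q < p.encPos ∧ (q < p.yPos ∨ p.convPos ≤ q) := by
  have h1 := p.lvl_bounds hi
  have h2 := p.positions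
  intro g hg
  have : ∀ Q : ℕ → Prop, (∀ q, 2 ≤ q ∧ q < p.encPos ∧ (q < p.yPos ∨ p.convPos ≤ q) → Q q) →
      Q g.1 ∧ Q g.2.1 ∧ Q g.2.2 := fun Q hQ => by
    rcases List.mem_append.1 hg with hg | hg
    · exact NandCircuit.prog_mem (Q := Q) _
        (fun _ _ j hj => hQ _ (by have := altIn_mem hi j hj; omega)) (hQ _ (by omega))
        (fun t ht => hQ _ (by omega)) g hg
    · exact NandCircuit.prog_mem (Q := Q) _
        (fun _ _ j hj => hQ _ (by have := xorIn_mem hi j hj; omega)) (hQ _ (by omega))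
        (fun t ht => hQ _ (by omega)) g hg
  have h3 := this _ fun q hq => hq
  rintro q (rfl | rfl | rfl)
  exacts [h3.1, h3.2.1, h3.2.2]

end
end Parts

namespace Parts

/-! ### What the machine computes -/

/-- The part of the classical input that the machine uses: the public keys of the present and of the
next level, the evaluation key of the next level, the encryptions of the secret key and the
trapdoor, the control ciphertext and the ciphertexts of the Pauli keys. -/
structure Input (p : Parts) where
  pk : Bits p.pkL
  pk' : Bits p.pkL
  evk' : Bits p.evkL
  keyCt : Fin (p.skL + p.tdL) → Bits p.ctL
  c : Bits p.ctL
  cz : Fin 4 → Bits p.ctL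

namespace Input

variable {p : Parts} (I : p.Input)

/-- The converted control ciphertext. -/
def chat : Bits p.altL := p.conv.out p.altL (List.ofFn I.pk ++ List.ofFn I.c)

/-- The encryption of the message `m`, homomorphically shifted by the control ciphertext if `a` is set. -/
def cipher (a : Bool) (m : Bits (p.r + 1)) : Bits p.altL :=
  let e := p.alt.out p.altL (List.ofFn I.pk ++ List.ofFn m)
  if a then p.xor.out p.altL (List.ofFn I.pk ++ List.ofFn e ++ List.ofFn I.chat) else e

/-- The inputs of the Pauli key update, when `kt` are the secret key and the trapdoor. -/
def updInputs (kt : Bits (p.skL + p.tdL)) (y : Bits p.altL) (d : Bits (p.r + 1)) : List Bool :=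
  List.ofFn I.pk ++ List.ofFn kt ++ (List.ofFn fun j => List.ofFn (I.cz j)).flatten ++
    List.ofFn I.chat ++ List.ofFn y ++ List.ofFn d

/-- The inputs of the Pauli key update, as far as the machine knows them: the secret key and the
trapdoor, which it only has in encrypted form, are replaced by zeros. -/
def bits (y : Bits p.altL) (d : Bits (p.r + 1)) : List Bool := I.updInputs (fun _ => false) y d

/-- The encryptions of the inputs of the Pauli key update. -/
def cts (y : Bits p.altL) (d : Bits (p.r + 1)) (coins : Bits p.coins) (q : ℕ) : Bits p.ctL :=
  if h : p.pkL ≤ q ∧ q < p.pkL + p.skL + p.tdL then I.keyCt ⟨q - p.pkL, by omega⟩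
  else p.enc.out p.ctL (List.ofFn I.pk' ++ [(I.bits y d).getD q false] ++
    List.ofFn (readBits coins (q * p.encCoins) p.encCoins))

/-- The results. -/
def result (y : Bits p.altL) (d : Bits (p.r + 1)) (coins : Bits p.coins) (a : Fin 4) : Bits p.ctL :=
  (p.ev a).out p.ctL (List.ofFn I.evk' ++ (p.upd a).code p.updIn ++
    (List.ofFn fun q : Fin p.updIn => List.ofFn (I.cts y d coins q)).flatten ++
    List.ofFn (readBits coins (p.updIn * p.encCoins + a * p.evalW) (p.evalCoins a)))

/-- The memory holds the input. -/
structure HoldsIn (m : ℕ → Bool) : Prop where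
  pk : HoldsAt m (fun j => p.pkPos + j) (List.ofFn I.pk)
  pk' : HoldsAt m (fun j => p.pkNext + j) (List.ofFn I.pk')
  evk' : HoldsAt m (fun j => p.evkNext + j) (List.ofFn I.evk')
  keyCt : ∀ i : Fin (p.skL + p.tdL),
    HoldsAt m (fun j => p.skPos + i * p.ctL + j) (List.ofFn (I.keyCt i))
  c : HoldsAt m (fun j => p.cPos + j) (List.ofFn I.c)
  cz : HoldsAt m (fun j => p.czPos + j) (List.ofFn fun j => List.ofFn (I.cz j)).flatten

/-- The memory holds the input, the converted control ciphertext and the constants, and the places for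
the values of the gates and for the results are initialized. -/
structure Ready (m : ℕ → Bool) : Prop extends I.HoldsIn m where
  blank : m p.blank = false
  one : m p.one = true
  chat : HoldsAt m p.convOut (List.ofFn I.chat)
  work : ∀ q, p.altPos ≤ q → q < p.outPos → m q = true
  out : ∀ q, p.outPos ≤ q → m q = false

variable {I}

theorem HoldsIn.congr {m m' : ℕ → Bool} (h : I.HoldsIn m) (hi : p.idx < p.lvl)
    (hm : ∀ q, 2 ≤ q → q < p.blank → m' q = m q) : I.HoldsIn m' := by
  have h1 := p.lvl_bounds hi
  have h2 := p.positions
  refine ⟨h.pk.congr fun j hj => ?_, h.pk'.congr fun j hj => ?_, h.evk'.congr fun j hj => ?_,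
    fun i => (h.keyCt i).congr fun j hj => ?_, h.c.congr fun j hj => ?_, h.cz.congr fun j hj => ?_⟩
  · rw [List.length_ofFn] at hj; exact hm _ (by omega) (by omega)
  · rw [List.length_ofFn] at hj; exact hm _ (by omega) (by omega)
  · rw [List.length_ofFn] at hj; exact hm _ (by omega) (by omega)
  · rw [List.length_ofFn] at hj
    have h3 : (i : ℕ) * p.ctL + p.ctL ≤ (p.skL + p.tdL) * p.ctL := by
      rw [← Nat.succ_mul]
      exact Nat.mul_le_mul_right _ i.2
    exact hm _ (by omega) (by omega)
  · rw [List.length_ofFn] at hj; exact hm _ (by omega) (by omega)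
  · rw [flatten_length (len := p.ctL) (fun l hl => by
      obtain ⟨i, rfl⟩ := (List.mem_ofFn' _ l).1 hl; exact List.length_ofFn), List.length_ofFn] at hj
    exact hm _ (by omega) (by omega)

/-- The contents of the registers for the quantum part of the computation and of the two qubits do not matter. -/
theorem Ready.congr {m m' : ℕ → Bool} (h : I.Ready m) (hi : p.idx < p.lvl)
    (hm : ∀ q, (2 ≤ q ∧ q < p.prepPos) ∨ p.one ≤ q → m' q = m q) : I.Ready m' := by
  have h1 := p.lvl_bounds hi
  have h2 := p.positions
  refine ⟨h.toHoldsIn.congr hi fun q hq hq' => hm q (by omega), ?_, ?_, ?_, ?_, ?_⟩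
  · rw [hm _ (by omega), h.blank]
  · rw [hm _ (by omega), h.one]
  · exact h.chat.congr fun j _ => hm _ (by have := convOut_mem hi j; omega)
  · intro q hq hq'
    rw [hm _ (by omega), h.work q hq hq']
  · intro q hq
    rw [hm _ (by omega), h.out q hq]

/-! ### Initialization -/

/-- The initialization makes the memory ready, puts the public key into the preparation register, and
leaves the rest of the registers zero. -/
theorem ready_initProg {m : ℕ → Bool} (hi : p.idx < p.lvl) (h : I.HoldsIn m)
    (h0 : ∀ q, p.blank ≤ q → q < p.one → m q = false)
    (h1 : ∀ q, p.one ≤ q → q < p.outPos → m q = true) (h2 : ∀ q, p.outPos ≤ q → m q = false) :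
    I.Ready (runT p.initProg m) ∧
      (∀ j : Fin p.pkL, runT p.initProg m (p.prepPos + j) = I.pk j) ∧
      ∀ q, p.prepPos + p.pkL ≤ q → q < p.one → runT p.initProg m q = false := by
  have b1 := p.lvl_bounds hi
  have b2 := p.positions
  have hS := initProg_straightLine hi
  have hin : I.HoldsIn (runT p.initProg m) := h.congr hi fun q _ hq => hS.run_of_lt m (by omega)
  have hpk := HoldsAt.ofFn_iff.1 hin.pk
  have hbl : runT p.initProg m p.blank = false := by
    rw [hS.run_of_lt m (by omega), h0 _ (by omega) (by omega)]
  have hrest : ∀ q, p.prepPos + p.pkL ≤ q → q < p.convPos → runT p.initProg m q = m q := by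
    intro q hq hq'
    refine runT_of_not_target (fun g hg => ?_) m
    rcases List.mem_append.1 hg with hg | hg
    · obtain ⟨t, ht, rfl⟩ := List.mem_map.1 hg
      have := List.mem_range.1 ht
      simp only
      omega
    · obtain ⟨t, ht, rfl⟩ := List.mem_map.1 hg
      simp only
      omega
  refine ⟨⟨hin, hbl, ?_, ?_, ?_, ?_⟩, ?_, ?_⟩
  · rw [hrest _ (by omega) (by omega), h1 _ (by omega) (by omega)]
  · have := p.conv.holdsAt_out (m := runT p.initProg m) (l := 1) (n := p.pkL + p.ctL)
      (inLoc := fun _ => p.convIn) (base := p.convPos) (blank := p.blank) (fun g hg => ?_) hbl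
      Nat.zero_lt_one (x := List.ofFn I.pk ++ List.ofFn I.c) (by simp)
      (HoldsAt.append (by simp) hin.pk hin.c) p.altL
    · simp only [Nat.zero_mul, Nat.add_zero] at this
      exact this
    · rw [hS.run_target m (List.mem_append_right _ hg)]
      have hg' := (p.conv.prog_straightLine (l := 1) (n := p.pkL + p.ctL)
        (inLoc := fun _ => p.convIn) (base := p.convPos) (blank := p.blank)
        (fun _ _ j hj => by have := convIn_mem hi j hj; omega) (by omega)).1 g hg
      rw [h1 _ (by omega) (by omega), Bool.true_xor]
  · intro q hq hq'
    rw [hS.run_of_ge m hq, h1 _ (by omega) hq']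
  · intro q hq
    rw [hS.run_of_ge m (by omega), h2 _ hq]
  · intro j
    have := hS.run_target m (g := (p.pkPos + j, p.pkPos + j, p.prepPos + j))
      (List.mem_append_left _ (List.mem_map.2 ⟨j, List.mem_range.2 j.2, rfl⟩))
    simp only at this
    rw [this, h0 _ (by omega) (by omega), hpk]
    simp
  · intro q hq hq'
    rw [hrest _ hq (by omega), h0 _ (by omega) hq']

/-! ### Controlled encryption -/

/-- The two ways to encrypt the message register. -/
theorem cipherProg_out {m : ℕ → Bool} (hi : p.idx < p.lvl) (h : I.Ready m) {msg : Bits (p.r + 1)}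
    (hmsg : ∀ j : Fin (p.r + 1), m (p.prepPos + j) = msg j) :
    (∀ j : Fin p.altL, runT p.cipherProg m (p.altOut j) = I.cipher false msg j) ∧
      ∀ j : Fin p.altL, runT p.cipherProg m (p.xorOut j) = I.cipher true msg j := by
  have b1 := p.lvl_bounds hi
  have b2 := p.positions
  have hS := cipherProg_straightLine hi
  have hlt : ∀ q, q < p.altPos → runT p.cipherProg m q = m q := fun q hq => hS.run_of_lt m hq
  have hbl : runT p.cipherProg m p.blank = false := by rw [hlt _ (by omega), h.blank]
  have hpk : HoldsAt (runT p.cipherProg m) (fun j => p.pkPos + j) (List.ofFn I.pk) :=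
    h.pk.congr fun j hj => hlt _ (by rw [List.length_ofFn] at hj; omega)
  have heq : ∀ g ∈ p.cipherProg, runT p.cipherProg m g.2.2 =
      !(runT p.cipherProg m g.1 && runT p.cipherProg m g.2.1) := fun g hg => by
    have := hS.1 g hg
    rw [hS.run_target m hg, h.work _ (by omega) (by omega), Bool.true_xor]
  have halt : HoldsAt (runT p.cipherProg m) p.altOut (List.ofFn (I.cipher false msg)) := by
    have := p.alt.holdsAt_out (m := runT p.cipherProg m) (l := 1) (n := p.pkL + (p.r + 1))
      (inLoc := fun _ => p.altIn) (base := p.altPos) (blank := p.blank)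
      (fun g hg => heq g (List.mem_append_left _ hg)) hbl
      Nat.zero_lt_one (x := List.ofFn I.pk ++ List.ofFn msg) (by simp)
      (HoldsAt.append (by simp) hpk (HoldsAt.ofFn_iff.2 fun j => by
        rw [hlt _ (by omega), hmsg])) p.altL
    simp only [Nat.zero_mul, Nat.add_zero] at this
    exact this
  refine ⟨HoldsAt.ofFn_iff.1 halt, HoldsAt.ofFn_iff.1 ?_⟩
  have := p.xor.holdsAt_out (m := runT p.cipherProg m) (l := 1) (n := p.pkL + p.altL + p.altL)
    (inLoc := fun _ => p.xorIn) (base := p.xorPos) (blank := p.blank)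
    (fun g hg => heq g (List.mem_append_right _ hg)) hbl Nat.zero_lt_one
    (x := List.ofFn I.pk ++ List.ofFn (I.cipher false msg) ++ List.ofFn I.chat) (by simp; omega)
    (HoldsAt.append (by simp) (HoldsAt.append (by simp) hpk halt)
      (h.chat.congr fun j _ => hlt _ (by have := convOut_mem hi j; omega))) p.altL
  simp only [Nat.zero_mul, Nat.add_zero] at this
  exact this

end Input

theorem runT_xorRange {n T : ℕ} {f g : ℕ → ℕ} (hf : ∀ k < n, f k < T ∨ T + n ≤ f k)
    (hg : ∀ k < n, g k < T ∨ T + n ≤ g k) (m : ℕ → Bool) (y : Bits n) :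
    runT (xorRange n f g T) (setMem m T y) =
      setMem m T fun j => y j ^^ (m (f j) && m (g j)) := by
  have hout : ∀ q, q < T ∨ T + n ≤ q → setMem m T y q = m q := fun q hq => if_neg (by omega)
  funext q
  by_cases hq : T ≤ q ∧ q < T + n
  · obtain ⟨j, rfl⟩ := Nat.exists_eq_add_of_le hq.1
    have hj : j < n := by omega
    rw [xorRange, runT_range_target hf hg _ hj, setMem_add _ _ _ hj, setMem_add _ _ _ hj,
      hout _ (hf j hj), hout _ (hg j hj)]
  · rw [xorRange, runT_range_of_not_mem _ (by omega), setMem, setMem, if_neg hq, if_neg hq]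

namespace Input

variable {p : Parts} {I : p.Input}

/-- The controlled encryption, as a map of basis states. -/
theorem runT_controlProg {μ : ℕ → Bool} (hi : p.idx < p.lvl) (h : I.Ready μ)
    (hy : ∀ q, p.yPos ≤ q → q < p.coinPos → μ q = false) (x : Bits 2)
    (g : Bits (p.prepW - (p.r + 1))) (msg : Bits (p.r + 1)) :
    runT p.controlProg (prepMem μ p.prepPos x g msg) =
      setMem (prepMem μ p.prepPos (xorSecond (msg 0) x) g msg) p.yPos (I.cipher (x 0) msg) := by
  have b1 := p.lvl_bounds hi
  have b2 := p.positions
  set m := prepMem μ p.prepPos x g msg with hm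
  have hmsg : ∀ j : Fin (p.r + 1), m (p.prepPos + j) = msg j := fun j => by
    rw [hm, prepMem, setMem_add _ _ _ j.2]
  have hready : I.Ready m := h.congr hi fun q hq => by
    rw [hm, prepMem, setMem, if_neg (by omega), setMem, if_neg (by omega), setMem, if_neg (by omega)]
  obtain ⟨ho, ho'⟩ := cipherProg_out hi hready hmsg
  set m₁ := runT p.cipherProg m with hm₁
  have hm₁y : m₁ = setMem m₁ p.yPos (fun _ : Fin p.altL => false) := by
    funext q
    unfold setMem
    split_ifs with hq
    · rw [getBit_of_lt _ (by omega), hm₁, (cipherProg_straightLine hi).run_of_lt _ (by omega), hm,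
        prepMem, setMem, if_neg (by omega), setMem, if_neg (by omega), setMem, if_neg (by omega),
        hy q (by omega) (by omega)]
    · rfl
  have hm₁0 : m₁ 0 = x 0 := by
    rw [hm₁, (cipherProg_straightLine hi).run_of_lt _ (by omega), hm, prepMem, setMem,
      if_neg (by omega), setMem, if_neg (by omega)]
    exact setMem_add μ 0 x (t := 0) (by omega)
  have hselect : runT p.selectProg m₁ = setMem m₁ p.yPos (I.cipher (x 0) msg) := by
    have a1 : ∀ k < p.altL, p.altOut k < p.yPos ∨ p.yPos + p.altL ≤ p.altOut k := fun k _ => by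
      have := altOut_mem hi k; omega
    have a2 : ∀ k < p.altL, p.xorOut k < p.yPos ∨ p.yPos + p.altL ≤ p.xorOut k := fun k _ => by
      have := xorOut_mem hi k; omega
    have a3 : ∀ k < p.altL, 0 < p.yPos ∨ p.yPos + p.altL ≤ 0 := fun k _ => by omega
    rw [selectProg, runT_append, runT_append]
    conv_lhs => rw [hm₁y]
    rw [runT_xorRange a1 a1, runT_xorRange a3 a2, runT_xorRange a3 a1]
    congr 1
    funext j
    rw [ho, ho', hm₁0]
    cases x 0 <;> cases I.cipher false msg j <;> cases I.cipher true msg j <;> rfl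
  rw [controlProg, runT_append, runT_append, runT_append, ← hm₁, hselect, runT_setMem, hm₁, runT_reverse]
  · funext q
    rw [runT_cons]
    change Toffoli.step _ _ q = _
    have hq1 : setMem m p.yPos (I.cipher (x 0) msg) 1 = x 1 := by
      rw [setMem_of_lt _ _ (by omega), hm, prepMem, setMem, if_neg (by omega), setMem,
        if_neg (by omega)]
      exact setMem_add μ 0 x (t := 1) (by omega)
    have hq2 : setMem m p.yPos (I.cipher (x 0) msg) p.prepPos = msg 0 := by
      rw [setMem_of_lt _ _ (by omega)]
      exact hmsg 0
    by_cases hq : q = 1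
    · subst hq
      have := Toffoli.step_target (g := (p.prepPos, p.prepPos, 1))
        (m := setMem m p.yPos (I.cipher (x 0) msg)) (by simp only; omega) (by simp only; omega)
      simp only at this
      rw [this, hq1, hq2, setMem_of_lt _ _ (by omega), prepMem, setMem, if_neg (by omega), setMem,
        if_neg (by omega), Bool.and_self]
      exact (setMem_add μ 0 (xorSecond (msg 0) x) (t := 1) (by omega)).symm
    · rw [Toffoli.step_of_ne (by simpa using hq)]
      simp only [hm, prepMem, setMem]
      have : q < 2 → getBit x (q - 0) = getBit (xorSecond (msg 0) x) (q - 0) := fun h2 => by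
        obtain rfl : q = 0 := by omega
        rfl
      split_ifs <;> first | rfl | omega | exact this (by omega)
  · intro g hg
    have hg := List.mem_reverse.1 hg
    have c1 := cipherProg_mem hi g hg g.1 (Or.inl rfl)
    have c2 := cipherProg_mem hi g hg g.2.1 (Or.inr (Or.inl rfl))
    have c3 := cipherProg_mem hi g hg g.2.2 (Or.inr (Or.inr rfl))
    omega

/-! ### Homomorphic evaluation -/

/-- The memory after the measurements. -/
def evalMem (μ : ℕ → Bool) (x : Bits 2) (g : Bits (p.prepW - (p.r + 1))) (y : Bits p.altL)
    (d : Bits (p.r + 1)) (coins : Bits p.coins) : ℕ → Bool :=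
  setMem (setMem (prepMem μ p.prepPos x g d) p.yPos y) p.coinPos coins

theorem evalMem_eq (μ : ℕ → Bool) (x : Bits 2) (g : Bits (p.prepW - (p.r + 1))) (y : Bits p.altL)
    (d : Bits (p.r + 1)) (coins : Bits p.coins) {q : ℕ}
    (hq : (2 ≤ q ∧ q < p.prepPos) ∨ p.one ≤ q) : evalMem μ x g y d coins q = μ q := by
  have b2 := p.positions
  simp only [evalMem, prepMem, setMem]
  rw [if_neg (by omega), if_neg (by omega), if_neg (by omega), if_neg (by omega), if_neg (by omega)]

theorem evalMem_coins (μ : ℕ → Bool) (x : Bits 2) (g : Bits (p.prepW - (p.r + 1))) (y : Bits p.altL)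
    (d : Bits (p.r + 1)) (coins : Bits p.coins) {q : ℕ} (hq : q < p.coins) :
    evalMem μ x g y d coins (p.coinPos + q) = getBit coins q := by
  rw [evalMem, setMem, if_pos (by omega), Nat.add_sub_cancel_left]

theorem evalMem_y (μ : ℕ → Bool) (x : Bits 2) (g : Bits (p.prepW - (p.r + 1))) (y : Bits p.altL)
    (d : Bits (p.r + 1)) (coins : Bits p.coins) (j : Fin p.altL) :
    evalMem μ x g y d coins (p.yPos + j) = y j := by
  have b2 := p.positions
  rw [evalMem, setMem_of_lt _ _ (by omega), setMem_add _ _ _ j.2]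

theorem evalMem_d (μ : ℕ → Bool) (x : Bits 2) (g : Bits (p.prepW - (p.r + 1))) (y : Bits p.altL)
    (d : Bits (p.r + 1)) (coins : Bits p.coins) (j : Fin (p.r + 1)) :
    evalMem μ x g y d coins (p.prepPos + j) = d j := by
  have b2 := p.positions
  rw [evalMem, setMem_of_lt _ _ (by omega), setMem_of_lt _ _ (by omega), prepMem, setMem_add _ _ _ j.2]

theorem updInputs_length (kt : Bits (p.skL + p.tdL)) (y : Bits p.altL) (d : Bits (p.r + 1)) :
    (I.updInputs kt y d).length = p.updIn := by
  have : (List.ofFn fun j => List.ofFn (I.cz j)).flatten.length = 4 * p.ctL := by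
    rw [flatten_length (len := p.ctL) (fun l hl => by
      obtain ⟨i, rfl⟩ := (List.mem_ofFn' _ l).1 hl; exact List.length_ofFn), List.length_ofFn]
  simp only [updInputs, List.length_append, List.length_ofFn, this, Parts.updIn]
  omega

theorem updInputs_getD_of_not_mem (kt kt' : Bits (p.skL + p.tdL)) (y : Bits p.altL)
    (d : Bits (p.r + 1)) {q : ℕ} (hq : q < p.pkL ∨ p.pkL + p.skL + p.tdL ≤ q) :
    (I.updInputs kt y d).getD q false = (I.updInputs kt' y d).getD q false := by
  simp only [updInputs, List.append_assoc]
  rcases hq with hq | hq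
  · rw [List.getD_append _ _ _ _ (by simpa using hq), List.getD_append _ _ _ _ (by simpa using hq)]
  · have key : ∀ (kt : Bits (p.skL + p.tdL)) (T : List Bool),
        (List.ofFn I.pk ++ (List.ofFn kt ++ T)).getD q false =
          T.getD (q - p.pkL - (p.skL + p.tdL)) false := fun kt T => by
      rw [List.getD_append_right _ _ _ _ (by rw [List.length_ofFn]; omega),
        List.getD_append_right _ _ _ _ (by simp only [List.length_ofFn]; omega)]
      simp only [List.length_ofFn]
    rw [key, key]

theorem updInputs_getD_add (kt : Bits (p.skL + p.tdL)) (y : Bits p.altL) (d : Bits (p.r + 1))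
    (t : Fin (p.skL + p.tdL)) : (I.updInputs kt y d).getD (p.pkL + t) false = kt t := by
  simp only [updInputs, List.append_assoc]
  rw [List.getD_append_right _ _ _ _ (by simp), List.getD_append _ _ _ _ (by simp)]
  simp [List.getD_eq_getElem?_getD]

/-- The ciphertexts do not depend on the coins for the evaluation. -/
theorem cts_congr (y : Bits p.altL) (d : Bits (p.r + 1)) {coins coins' : Bits p.coins}
    (h : ∀ s < p.updIn * p.encCoins, getBit coins s = getBit coins' s) {q : ℕ} (hq : q < p.updIn) :
    I.cts y d coins q = I.cts y d coins' q := by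
  have h1 : readBits coins (q * p.encCoins) p.encCoins = readBits coins' (q * p.encCoins) p.encCoins :=
    funext fun j => h _ (by have := p.mul_encCoins_le hq; omega)
  rw [cts, cts, h1]

theorem cts_setBits (y : Bits p.altL) (d : Bits (p.r + 1)) (coins : Bits p.coins) {n off : ℕ}
    (c : Bits n) (h : p.updIn * p.encCoins ≤ off) {q : ℕ} (hq : q < p.updIn) :
    I.cts y d (setBits coins off c) q = I.cts y d coins q :=
  I.cts_congr y d (fun s hs => by rw [getBit_setBits, if_neg (by omega)]) hq

/-- The coins for the four evaluations lie behind those for the encryptions. -/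
theorem evalCoins_bound (a : Fin 4) :
    p.updIn * p.encCoins + a * p.evalW + p.evalCoins a ≤ p.coins := by
  have := p.evalCoins_le a
  simp only [Parts.coins]
  omega

theorem result_setBits (y : Bits p.altL) (d : Bits (p.r + 1)) (coins : Bits p.coins) (a : Fin 4)
    (c : Bits (p.evalCoins a)) :
    I.result y d (setBits coins (p.updIn * p.encCoins + a * p.evalW) c) a =
      (p.ev a).out p.ctL (List.ofFn I.evk' ++ (p.upd a).code p.updIn ++
        (List.ofFn fun q : Fin p.updIn => List.ofFn (I.cts y d coins q)).flatten ++ List.ofFn c) := by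
  rw [result, readBits_setBits _ _ _ (evalCoins_bound a)]
  simp only [I.cts_setBits y d coins c (Nat.le_add_right _ _) (Fin.is_lt _)]

/-- The values computed by `evalProg` and `copyProg`. -/
theorem runT_copyProg {μ : ℕ → Bool} (hi : p.idx < p.lvl) (h : I.Ready μ) (x : Bits 2)
    (g : Bits (p.prepW - (p.r + 1))) (y : Bits p.altL) (d : Bits (p.r + 1)) (coins : Bits p.coins)
    (a : Fin 4) (t : Fin p.ctL) :
    runT (p.evalProg ++ p.copyProg) (evalMem μ x g y d coins) (p.outPos + a * p.ctL + t) =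
      I.result y d coins a t := by
  have b1 := p.lvl_bounds hi
  have b2 := p.positions
  set M := evalMem μ x g y d coins with hM
  have hr : I.Ready M := h.congr hi fun q hq => evalMem_eq μ x g y d coins hq
  have hS : StraightLine p.encPos p.total (p.evalProg ++ p.copyProg) :=
    (evalProg_straightLine hi).append (copyProg_straightLine hi) (by omega) (by omega)
  set m := runT (p.evalProg ++ p.copyProg) M with hm
  have hlt : ∀ q, q < p.encPos → m q = M q := fun q hq => hS.run_of_lt M hq
  have hin : I.HoldsIn m := hr.toHoldsIn.congr hi fun q _ hq => hlt q (by omega)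
  have hbl : m p.blank = false := by rw [hlt _ (by omega), hr.blank]
  have hone : m p.one = true := by rw [hlt _ (by omega), hr.one]
  have heq : ∀ g ∈ p.evalProg, m g.2.2 = !(m g.1 && m g.2.1) := fun g hg => by
    have := (evalProg_straightLine hi).1 g hg
    rw [hm, hS.run_target M (List.mem_append_left _ hg), hr.work _ (by omega) (by omega),
      Bool.true_xor]
  have hbits : HoldsAt m p.bitLoc (I.bits y d) := by
    refine HoldsAt.append ?_ (HoldsAt.append ?_ (HoldsAt.append ?_ (HoldsAt.append ?_
      (HoldsAt.append ?_ hin.pk ?_) hin.cz) ?_) ?_) ?_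
    · have := I.updInputs_length (fun _ => false) y d
      simp only [updInputs, List.length_append, List.length_ofFn, updIn] at this ⊢
      omega
    · have := I.updInputs_length (fun _ => false) y d
      simp only [updInputs, List.length_append, List.length_ofFn, updIn] at this ⊢
      omega
    · have := I.updInputs_length (fun _ => false) y d
      simp only [updInputs, List.length_append, List.length_ofFn, updIn] at this ⊢
      omega
    · simp only [List.length_append, List.length_ofFn]
      omega
    · simp only [List.length_ofFn]
    · exact HoldsAt.ofFn_iff.2 fun _ => hbl
    · exact hr.chat.congr fun j _ => hlt _ (by have := convOut_mem hi j; omega)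
    · exact HoldsAt.ofFn_iff.2 fun j => by rw [hlt _ (by omega), hM, evalMem_y]
    · exact HoldsAt.ofFn_iff.2 fun j => by rw [hlt _ (by omega), hM, evalMem_d]
  have hcoins : ∀ q, q < p.coins → m (p.coinPos + q) = getBit coins q := fun q hq => by
    rw [hlt _ (by omega), hM, evalMem_coins _ _ _ _ _ _ hq]
  have hct : ∀ q : Fin p.updIn, HoldsAt m (p.ctLoc q) (List.ofFn (I.cts y d coins q)) := by
    intro q
    have henc := p.enc.holdsAt_out (m := m) (l := p.updIn) (n := p.pkL + 1 + p.encCoins)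
      (inLoc := p.encIn) (base := p.encPos) (blank := p.blank)
      (fun g hg => heq g (List.mem_append_left _ hg)) hbl q.2
      (x := List.ofFn I.pk' ++ [(I.bits y d).getD q false] ++
        List.ofFn (readBits coins (q * p.encCoins) p.encCoins)) (by simp; omega)
      (HoldsAt.append (by simp) (HoldsAt.append (by simp) hin.pk'
        (HoldsAt.singleton_iff.2 (hbits q (by rw [bits, updInputs_length]; exact q.2))))
        (HoldsAt.ofFn_iff.2 fun j => by
          have := p.mul_encCoins_le q.2
          rw [Nat.add_assoc, hcoins _ (by omega)]
          rfl)) p.ctL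
    unfold cts
    split_ifs with h1
    · have := hin.keyCt ⟨q - p.pkL, by omega⟩
      refine fun j hj => ?_
      rw [ctLoc, if_neg (by omega), if_pos h1.2]
      exact this j hj
    · refine fun j hj => ?_
      have := henc j hj
      rw [ctLoc]
      split_ifs
      · exact this
      · omega
      · exact this
  have hev : HoldsAt m (p.evOut a) (List.ofFn (I.result y d coins a)) := by
    have hmem : ∀ g ∈ (p.ev a).prog 1 (p.evInL a) (fun _ => p.evIn a) (p.evPos + a * p.evL) p.blank,
        g ∈ p.evalProg := fun g hg => by
      unfold evalProg
      simp only [List.mem_append]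
      fin_cases a
      · exact Or.inr (Or.inl hg)
      · exact Or.inr (Or.inr (Or.inl hg))
      · exact Or.inr (Or.inr (Or.inr (Or.inl hg)))
      · exact Or.inr (Or.inr (Or.inr (Or.inr hg)))
    have hlen : (List.ofFn fun q : Fin p.updIn => List.ofFn (I.cts y d coins q)).flatten.length =
        p.updIn * p.ctL := by
      rw [flatten_length (len := p.ctL) (fun l hl => by
        obtain ⟨i, rfl⟩ := (List.mem_ofFn' _ l).1 hl; exact List.length_ofFn), List.length_ofFn]
    have hcode : (List.ofFn I.evk' ++ (p.upd a).code p.updIn).length = p.evkL + p.codeLen a := by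
      simp [NandCircuit.code_length, codeLen]
    have := (p.ev a).holdsAt_out (m := m) (l := 1) (n := p.evInL a) (inLoc := fun _ => p.evIn a)
      (base := p.evPos + a * p.evL) (blank := p.blank) (fun g hg => heq g (hmem g hg)) hbl
      Nat.zero_lt_one
      (x := List.ofFn I.evk' ++ (p.upd a).code p.updIn ++
        (List.ofFn fun q : Fin p.updIn => List.ofFn (I.cts y d coins q)).flatten ++
        List.ofFn (readBits coins (p.updIn * p.encCoins + a * p.evalW) (p.evalCoins a)))
      (by rw [List.length_append, List.length_append, hcode, hlen, List.length_ofFn]; rfl)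
      (HoldsAt.append (by rw [List.length_append, hcode, hlen])
        (HoldsAt.append hcode (HoldsAt.append (by simp) hin.evk'
          ((p.upd a).holdsAt_code p.updIn hone hbl))
          (HoldsAt.flatten (fun q => List.length_ofFn) hct))
        (HoldsAt.ofFn_iff.2 fun j => by
          have := p.evalCoins_le a
          rw [Nat.add_assoc, Nat.add_assoc, hcoins _ (by omega), ← Nat.add_assoc]
          rfl)) p.ctL
    simp only [Nat.zero_mul, Nat.add_zero] at this
    exact this
  have hcopy : (p.evOut a t, p.evOut a t, p.outPos + a * p.ctL + t) ∈ p.copyProg := by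
    have h1 : (p.evOut a t, p.evOut a t, p.outPos + a * p.ctL + t) ∈
        xorRange p.ctL (p.evOut a) (p.evOut a) (p.outPos + a * p.ctL) :=
      List.mem_map.2 ⟨t, List.mem_range.2 t.2, rfl⟩
    unfold copyProg
    simp only [List.mem_append]
    fin_cases a
    · exact Or.inl h1
    · exact Or.inr (Or.inl h1)
    · exact Or.inr (Or.inr (Or.inl h1))
    · exact Or.inr (Or.inr (Or.inr h1))
  have h3 := hS.run_target M (List.mem_append_right _ hcopy)
  simp only [← hm] at h3
  rw [h3, hr.out _ (by omega), HoldsAt.ofFn_iff.1 hev t]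
  simp

/-- The final program puts the results behind the two qubits. -/
theorem runT_finalProg {μ : ℕ → Bool} (hi : p.idx < p.lvl) (h : I.Ready μ) (x : Bits 2)
    (g : Bits (p.prepW - (p.r + 1))) (y : Bits p.altL) (d : Bits (p.r + 1)) (coins : Bits p.coins)
    (a : Fin 4) (t : Fin p.ctL) :
    runT p.finalProg (evalMem μ x g y d coins) (2 + a * p.ctL + t) = I.result y d coins a t := by
  have b1 := p.lvl_bounds hi
  have b2 := p.positions
  have hj : a * p.ctL + t < 4 * p.ctL := by
    have : (a + 1) * p.ctL ≤ 4 * p.ctL := Nat.mul_le_mul_right _ a.2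
    rw [Nat.succ_mul] at this
    omega
  rw [← runT_copyProg hi h x g y d coins a t, finalProg, runT_append, Nat.add_assoc, Nat.add_assoc]
  generalize runT (p.evalProg ++ p.copyProg) (evalMem μ x g y d coins) = m
  generalize (a * p.ctL + t : ℕ) = j at hj
  have hA : ∀ k < 4 * p.ctL, p.outPos + k < 2 ∨ 2 + 4 * p.ctL ≤ p.outPos + k := by omega
  have hB : ∀ k < 4 * p.ctL, 2 + k < p.outPos ∨ p.outPos + 4 * p.ctL ≤ 2 + k := by omega
  rw [swapProg, runT_append, runT_append]
  unfold xorRange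
  rw [runT_range_target hA hA _ hj, runT_range_of_not_mem _ (by omega),
    runT_range_target hB hB _ hj, runT_range_target hA hA _ hj, runT_range_of_not_mem _ (by omega)]
  cases m (2 + j) <;> cases m (p.outPos + j) <;> rfl

end Input
end Parts

/-! ### The state produced by the machine -/

/-- A run of a circuit on a classical input starts from a basis state. -/
theorem runGates_ket (C : QCircuit) (l : List Bool) :
    C.run (ket l) = runGates C.gates fun b => if b = (fun t : Fin _ => l.getD t false) then 1 else 0 := by
  unfold QCircuit.run runGates
  congr 1
  funext b
  unfold ket
  rw [← ite_and]
  refine if_congr ⟨fun h => funext fun t => ?_, fun h => ⟨fun j => ?_, funext fun j => ?_⟩⟩ rfl rfl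
  · refine Fin.addCases (fun j => ?_) (fun j => ?_) t
    · rw [congrFun h.2 j]
      simp [List.getD_eq_getElem?_getD]
    · rw [h.1 j, List.getD_eq_default _ _ (by simp)]
  · rw [h]
    exact List.getD_eq_default _ _ (by simp)
  · rw [h]
    simp [List.getD_eq_getElem?_getD]

/-- The preparation circuit on an input of known length. -/
theorem reduced_run_ket (C : QCircuit) (k : ℕ) {n : ℕ} (x : Bits n) (S : Prop) :
    reduced k (C.run (ket (List.ofFn x))) (fun _ => S) =
      reduced k (runGates C.gates fun b : Bits (n + C.anc) =>
        if b = (fun t : Fin _ => getBit x t) then (1 : ℂ) else 0) fun _ => S := by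
  have key : ∀ l : List Bool, ∀ hl : l.length = n, reduced k (C.run (ket l)) (fun _ => S) =
      reduced k (runGates C.gates fun b : Bits (n + C.anc) =>
        if b = (fun t : Fin _ => l.getD t false) then (1 : ℂ) else 0) fun _ => S := by
    rintro l rfl
    rw [runGates_ket]
  rw [key _ List.length_ofFn]
  have : (fun t : Fin (n + C.anc) => (List.ofFn x).getD t false) = fun t : Fin _ => getBit x t := by
    funext t
    unfold getBit
    split_ifs with h <;> simp [List.getD_eq_getElem?_getD, h]
  rw [this]

/-- The memory that holds a classical input behind two qubits. -/
def inputMem (l : List Bool) (q : ℕ) : Bool := if 2 ≤ q then l.getD (q - 2) false else false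

theorem inputMem_of_ge (l : List Bool) {q : ℕ} (h : 2 + l.length ≤ q) : inputMem l q = false := by
  rw [inputMem, if_pos (by omega), List.getD_eq_default _ _ (by omega)]

theorem holdsAt_inputMem (l : List Bool) : HoldsAt (inputMem l) (fun j => 2 + j) l := fun j _ => by
  simp only [inputMem]
  rw [if_pos (by omega), Nat.add_sub_cancel_left]

/-- A run on two qubits and a classical input, with one path for each basis state of the two qubits. -/
theorem run_withInput (C : QCircuit) (φ : Bits 2 → ℂ) (l : List Bool) :
    C.run (withInput φ l) = runGates C.gates
      (pathSum φ fun x => ofMem (2 + l.length + C.anc) (setMem (inputMem l) 0 x)) := by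
  unfold QCircuit.run runGates
  congr 1
  funext b
  set x₀ : Bits 2 := fun j => b (Fin.castAdd C.anc (Fin.castAdd l.length j)) with hx₀
  have hmem : ∀ x, ofMem (2 + l.length + C.anc) (setMem (inputMem l) 0 x) = b ↔
      x = x₀ ∧ (∀ j : Fin C.anc, b (Fin.natAdd _ j) = false) ∧
        (fun j => b (Fin.castAdd C.anc (Fin.natAdd 2 j))) = fun j => l.get j := by
    intro x
    have e1 : ∀ j : Fin 2, ofMem (2 + l.length + C.anc) (setMem (inputMem l) 0 x)
        (Fin.castAdd C.anc (Fin.castAdd l.length j)) = x j := fun j => by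
      have := setMem_add (inputMem l) 0 x j.2
      simpa [ofMem] using this
    have e2 : ∀ j : Fin l.length, ofMem (2 + l.length + C.anc) (setMem (inputMem l) 0 x)
        (Fin.castAdd C.anc (Fin.natAdd 2 j)) = l.get j := fun j => by
      simp only [ofMem, Fin.val_castAdd, Fin.val_natAdd]
      rw [setMem_of_ge _ _ (by omega), inputMem, if_pos (by omega), Nat.add_sub_cancel_left]
      simp [List.getD_eq_getElem?_getD]
    have e3 : ∀ j : Fin C.anc, ofMem (2 + l.length + C.anc) (setMem (inputMem l) 0 x)
        (Fin.natAdd _ j) = false := fun j => by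
      simp only [ofMem, Fin.val_natAdd]
      rw [setMem_of_ge _ _ (by omega), inputMem_of_ge _ (by omega)]
    constructor
    · rintro rfl
      exact ⟨funext fun j => (e1 j).symm, e3, funext e2⟩
    · rintro ⟨rfl, h2, h3⟩
      funext t
      refine Fin.addCases (fun j => ?_) (fun j => ?_) t
      · refine Fin.addCases (fun j => ?_) (fun j => ?_) j
        · rw [e1]
        · rw [e2, ← congrFun h3 j]
      · rw [e3, h2]
  simp only [pathSum, hmem, withInput, ket]
  rw [Finset.sum_eq_single x₀ (fun x _ hx => if_neg fun h => hx h.1) (by simp)]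
  split_ifs with h1 h2 h3 h3 <;> simp_all

namespace Parts

theorem xorRange_mem {Q : ℕ → Prop} {n T : ℕ} {f g : ℕ → ℕ} (hf : ∀ t < n, Q (f t))
    (hg : ∀ t < n, Q (g t)) (hT : ∀ t < n, Q (T + t)) :
    ∀ a ∈ xorRange n f g T, Q a.1 ∧ Q a.2.1 ∧ Q a.2.2 := by
  intro a ha
  obtain ⟨t, ht, rfl⟩ := List.mem_map.1 ha
  have ht := List.mem_range.1 ht
  exact ⟨hf t ht, hg t ht, hT t ht⟩

variable {p : Parts}

theorem initProg_mem (hi : p.idx < p.lvl) : ∀ g ∈ p.initProg, (2 ≤ g.1 ∧ g.1 < p.total) ∧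
    (2 ≤ g.2.1 ∧ g.2.1 < p.total) ∧ (2 ≤ g.2.2 ∧ g.2.2 < p.total) := by
  have h1 := p.lvl_bounds hi
  have h2 := p.positions
  intro g hg
  rcases List.mem_append.1 hg with hg | hg
  · exact xorRange_mem (Q := fun q => 2 ≤ q ∧ q < p.total) (fun t ht => by omega) (fun t ht => by omega)
      (fun t ht => by omega) g hg
  · exact NandCircuit.prog_mem (Q := fun q => 2 ≤ q ∧ q < p.total) _
      (fun _ _ j hj => by have := convIn_mem hi j hj; omega) (by omega) (fun t ht => by omega) g hg

theorem controlProg_mem (hi : p.idx < p.lvl) : ∀ g ∈ p.controlProg, g.1 < p.total ∧ g.2.1 < p.total ∧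
    g.2.2 < p.total := by
  have h1 := p.lvl_bounds hi
  have h2 := p.positions
  have h3 : ∀ g ∈ p.cipherProg, g.1 < p.total ∧ g.2.1 < p.total ∧ g.2.2 < p.total := fun g hg => by
    have c1 := cipherProg_mem hi g hg g.1 (Or.inl rfl)
    have c2 := cipherProg_mem hi g hg g.2.1 (Or.inr (Or.inl rfl))
    have c3 := cipherProg_mem hi g hg g.2.2 (Or.inr (Or.inr rfl))
    omega
  have ha := fun t => altOut_mem hi t
  have hx := fun t => xorOut_mem hi t
  intro g hg
  simp only [controlProg, selectProg, List.mem_append, List.mem_reverse, List.mem_singleton] at hg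
  rcases hg with ((hg | hg | hg | hg) | hg) | rfl
  · exact h3 g hg
  · exact xorRange_mem (Q := fun q => q < p.total) (fun t _ => by have := ha t; omega)
      (fun t _ => by have := ha t; omega) (fun t ht => by omega) g hg
  · exact xorRange_mem (Q := fun q => q < p.total) (fun t _ => by omega)
      (fun t _ => by have := hx t; omega) (fun t ht => by omega) g hg
  · exact xorRange_mem (Q := fun q => q < p.total) (fun t _ => by omega)
      (fun t _ => by have := ha t; omega) (fun t ht => by omega) g hg
  · exact h3 g hg
  · simp only
    omega

theorem finalProg_mem (hi : p.idx < p.lvl) : ∀ g ∈ p.finalProg, (2 ≤ g.1 ∧ g.1 < p.total) ∧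
    (2 ≤ g.2.1 ∧ g.2.1 < p.total) ∧ (2 ≤ g.2.2 ∧ g.2.2 < p.total) := by
  have h1 := p.lvl_bounds hi
  have h2 := p.positions
  have hev : ∀ a : Fin 4, ∀ g ∈ (p.ev a).prog 1 (p.evInL a) (fun _ => p.evIn a) (p.evPos + a * p.evL)
      p.blank, (2 ≤ g.1 ∧ g.1 < p.total) ∧ (2 ≤ g.2.1 ∧ g.2.1 < p.total) ∧
        (2 ≤ g.2.2 ∧ g.2.2 < p.total) := fun a => by
    have h3 := p.length_ev_le a
    exact NandCircuit.prog_mem (Q := fun q => 2 ≤ q ∧ q < p.total) _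
      (fun _ _ j hj => by have := evIn_mem hi a j hj; omega) (by omega) (fun t ht => by omega)
  have hcopy : ∀ a : Fin 4, ∀ g ∈ xorRange p.ctL (p.evOut a) (p.evOut a) (p.outPos + a * p.ctL),
      (2 ≤ g.1 ∧ g.1 < p.total) ∧ (2 ≤ g.2.1 ∧ g.2.1 < p.total) ∧
        (2 ≤ g.2.2 ∧ g.2.2 < p.total) := fun a => by
    have h3 : (a + 1) * p.ctL ≤ 4 * p.ctL := Nat.mul_le_mul_right _ a.2
    rw [Nat.succ_mul] at h3
    exact xorRange_mem (Q := fun q => 2 ≤ q ∧ q < p.total)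
      (fun t _ => by have := evOut_mem hi a t; omega) (fun t _ => by have := evOut_mem hi a t; omega)
      (fun t ht => by omega)
  intro g hg
  simp only [finalProg, evalProg, copyProg, swapProg, List.mem_append] at hg
  rcases hg with ((hg | hg | hg | hg | hg) | hg | hg | hg | hg) | hg | hg | hg
  · exact NandCircuit.prog_mem (Q := fun q => 2 ≤ q ∧ q < p.total) _
      (fun q hq j hj => by have := encIn_mem hi q hq j hj; omega) (by omega) (fun t ht => by omega) g hg
  · exact hev 0 g hg
  · exact hev 1 g hg
  · exact hev 2 g hg
  · exact hev 3 g hg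
  · exact hcopy 0 g hg
  · exact hcopy 1 g hg
  · exact hcopy 2 g hg
  · exact hcopy 3 g hg
  all_goals
    exact xorRange_mem (Q := fun q => 2 ≤ q ∧ q < p.total) (fun t ht => by omega) (fun t ht => by omega)
      (fun t ht => by omega) g hg

theorem two_le_prepPos (p : Parts) : 2 ≤ p.prepPos := by
  have h1 : p.lvlPos = 2 + p.pkL + (p.lvl + 1) * p.evkL := rfl
  have h2 : p.cPos = p.lvlPos + p.lvl * p.levelLen := rfl
  have h3 := p.positions
  generalize (p.lvl + 1) * p.evkL = a at h1
  generalize p.lvl * p.levelLen = b at h2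
  omega

namespace Input

variable {I : p.Input}

theorem evalMem_eq_setMem (μ : ℕ → Bool) (x : Bits 2) (g : Bits (p.prepW - (p.r + 1))) (y : Bits p.altL)
    (d : Bits (p.r + 1)) (coins : Bits p.coins) :
    evalMem μ x g y d coins = setMem (evalMem μ (fun _ => false) g y d coins) 0 x := by
  have b1 := p.two_le_prepPos
  have b2 := p.positions
  funext q
  simp only [evalMem, prepMem, setMem]
  split_ifs <;> first | rfl | omega

theorem evalMem_g (μ : ℕ → Bool) (x : Bits 2) (g : Bits (p.prepW - (p.r + 1))) (y : Bits p.altL)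
    (d : Bits (p.r + 1)) (coins : Bits p.coins) {q : ℕ} (hq : q < p.prepW - (p.r + 1)) :
    evalMem μ x g y d coins (p.prepPos + (p.r + 1) + q) = getBit g q := by
  have b2 := p.positions
  rw [evalMem, setMem_of_lt _ _ (by omega), setMem_of_lt _ _ (by omega), prepMem,
    setMem_of_ge _ _ (by omega), setMem_add _ _ _ hq, getBit_of_lt _ hq]

/-- The measured values can be read off the memory outside the two qubits. So paths with different values do
not interfere when these qubits are traced out. -/
theorem evalMem_injective (μ : ℕ → Bool) (x : Bits 2) {N : ℕ} (hN : p.one ≤ N)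
    (κ κ' : (Bits (p.prepW - (p.r + 1)) × Bits p.altL × Bits (p.r + 1)) × Bits p.coins)
    (h : ∀ q, 2 ≤ q → q < N → evalMem μ x κ.1.1 κ.1.2.1 κ.1.2.2 κ.2 q =
      evalMem μ x κ'.1.1 κ'.1.2.1 κ'.1.2.2 κ'.2 q) : κ = κ' := by
  have b2 := p.positions
  obtain ⟨⟨g, y, d⟩, c⟩ := κ
  obtain ⟨⟨g', y', d'⟩, c'⟩ := κ'
  simp only at h
  have hb := p.two_le_prepPos
  have h1 : g = g' := bits_ext fun q hq => by
    have := h (p.prepPos + (p.r + 1) + q) (by omega) (by omega)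
    rwa [evalMem_g _ _ _ _ _ _ hq, evalMem_g _ _ _ _ _ _ hq] at this
  have h2 : y = y' := funext fun j => by
    have := h (p.yPos + j) (by omega) (by omega)
    rwa [evalMem_y, evalMem_y] at this
  have h3 : d = d' := funext fun j => by
    have := h (p.prepPos + j) (by omega) (by omega)
    rwa [evalMem_d, evalMem_d] at this
  have h4 : c = c' := bits_ext fun q hq => by
    have := h (p.coinPos + q) (by omega) (by omega)
    rwa [evalMem_coins _ _ _ _ _ _ hq, evalMem_coins _ _ _ _ _ _ hq] at this
  rw [h1, h2, h3, h4]

/-- The density matrix of the two qubits, for the result `o` of the machine. -/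
theorem reduced_machine (hi : p.idx < p.lvl) {l : List Bool} (hl : 2 + l.length = p.blank)
    (hI : I.HoldsIn (inputMem l)) (φ : Bits 2 → ℂ) (o : Fin 4 → Bits p.ctL) (b b' : Bits 2) :
    reduced 2 (p.machine.run (withInput φ l))
      (fun b => o = fun j : Fin 4 => readBits b (2 + j * p.ctL) p.ctL) b b' =
    ∑ κ : (Bits (p.prepW - (p.r + 1)) × Bits p.altL × Bits (p.r + 1)) × Bits p.coins,
      if I.result κ.1.2.1 κ.1.2.2 κ.2 = o then
        ((((Real.sqrt 2 : ℝ) : ℂ)⁻¹) ^ p.coins * ∑ m, hadamard κ.1.2.2 m *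
          cipherAmp I.cipher (splitAmp (p.r + 1) (runGates p.prep.gates fun b : Bits p.prepW =>
            if b = (fun t : Fin _ => getBit I.pk t) then 1 else 0)) φ κ.1.1 κ.1.2.1 b m) *
        star ((((Real.sqrt 2 : ℝ) : ℂ)⁻¹) ^ p.coins * ∑ m, hadamard κ.1.2.2 m *
          cipherAmp I.cipher (splitAmp (p.r + 1) (runGates p.prep.gates fun b : Bits p.prepW =>
            if b = (fun t : Fin _ => getBit I.pk t) then 1 else 0)) φ κ.1.1 κ.1.2.1 b' m)
      else 0 := by
  classical
  have b1 := p.lvl_bounds hi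
  have b2 := p.positions
  rw [run_withInput]
  have hN : 2 + l.length + p.machine.anc = p.total := by
    change 2 + l.length + (p.total - p.blank) = p.total
    omega
  generalize 2 + l.length + p.machine.anc = N at hN
  subst hN
  set μ₁ : ℕ → Bool := fun q => if p.one ≤ q ∧ q < p.outPos then true else inputMem l q with hμ₁
  obtain ⟨hready, hprep, hzero⟩ := ready_initProg (m := μ₁) hi
    (hI.congr hi fun q _ hq => if_neg (by omega))
    (fun q hq hq' => (if_neg (by omega)).trans (inputMem_of_ge l (by omega)))
    (fun q hq hq' => if_pos ⟨hq, hq'⟩)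
    (fun q hq => (if_neg (by omega)).trans (inputMem_of_ge l (by omega)))
  set μ := runT p.initProg μ₁ with hμ
  have hones : runGates p.onesGates (pathSum φ fun x => ofMem p.total (setMem (inputMem l) 0 x)) =
      pathSum φ fun x => ofMem p.total (setMem μ₁ 0 x) := by
    rw [onesGates, runGates_x_pathSum]
    congr 1
    funext x
    refine bits_ext fun q hq => ?_
    rw [getBit_ofMem, getBit_ofMem, getBit_ofMem, if_pos hq, if_pos hq, if_pos hq]
    by_cases h : p.one ≤ q ∧ q < p.outPos
    · rw [if_pos (by omega), setMem_of_ge _ _ (by omega), setMem_of_ge _ _ (by omega),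
        inputMem_of_ge l (by omega), hμ₁]
      simp only
      rw [if_pos h]
      rfl
    · rw [if_neg (by omega)]
      simp only [setMem, hμ₁]
      rw [if_neg h]
  have hinit : runGates (p.initProg.map Toffoli.gate)
      (pathSum φ fun x => ofMem p.total (setMem μ₁ 0 x)) =
      pathSum φ fun x => ofMem p.total (setMem μ 0 x) := by
    rw [runGates_toffoli_mem fun g hg => by have := initProg_mem hi g hg; omega]
    congr 1
    funext x
    rw [runT_setMem fun g hg => by have := initProg_mem hi g hg; omega]
  have hcnot := runGates_encryptedCnot (N := p.total) (r := p.r) (w := p.prepW) (ct := p.altL)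
    (R := p.coins) (Bp := p.prepPos) (By := p.yPos) (Bc := p.coinPos) (μ := μ)
    (b₀ := fun t => getBit I.pk t) (L := p.prep.gates) (T := p.controlProg) (enc := I.cipher)
    (by omega) (by omega) (by omega) (by omega)
    (fun t => by
      by_cases ht : (t : ℕ) < p.pkL
      · rw [getBit_of_lt _ ht, ← hprep]
      · rw [getBit_of_ge _ (not_lt.1 ht), hzero _ (by omega) (by omega)])
    (fun q hq hq' => hzero q (by omega) (by omega)) (fun q hq hq' => hzero q (by omega) (by omega))
    (controlProg_mem hi)
    (fun x g m => runT_controlProg hi hready (fun q hq hq' => hzero q (by omega) (by omega)) x g m)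
    rfl φ
  have hgates : p.machine.gates = p.onesGates ++ (p.initProg.map Toffoli.gate ++
      (p.prepGates ++ p.controlProg.map Toffoli.gate ++ hadamardGates (p.r + 1) p.prepPos ++
        hadamardGates p.coins p.coinPos ++ p.finalProg.map Toffoli.gate)) := rfl
  rw [hgates, runGates_append, hones, runGates_append, hinit,
    runGates_append]
  unfold prepGates hadamardGates
  rw [hcnot]
  have hmem : ∀ j : Bits 2 × (Bits (p.prepW - (p.r + 1)) × Bits p.altL × Bits (p.r + 1)) × Bits p.coins,
      setMem (setMem (prepMem μ p.prepPos j.1 j.2.1.1 j.2.1.2.2) p.yPos j.2.1.2.1) p.coinPos j.2.2 =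
        setMem (evalMem μ (fun _ => false) j.2.1.1 j.2.1.2.1 j.2.1.2.2 j.2.2) 0 j.1 := fun j =>
    evalMem_eq_setMem μ j.1 j.2.1.1 j.2.1.2.1 j.2.1.2.2 j.2.2
  simp only [hmem]
  refine reduced_toffoli_mem (by omega) (fun g hg => by have := finalProg_mem hi g hg; omega)
    (fun g hg => by have := finalProg_mem hi g hg; omega) _
    (f := fun κ : (Bits (p.prepW - (p.r + 1)) × Bits p.altL × Bits (p.r + 1)) × Bits p.coins =>
      evalMem μ (fun _ => false) κ.1.1 κ.1.2.1 κ.1.2.2 κ.2)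
    (fun κ κ' h => evalMem_injective μ _ (by omega) κ κ' h)
    (read := fun b => fun j : Fin 4 => readBits b (2 + j * p.ctL) p.ctL)
    (out := fun κ => I.result κ.1.2.1 κ.1.2.2 κ.2) (fun x κ => ?_) o b b'
  funext a
  have ha : (a + 1) * p.ctL ≤ 4 * p.ctL := Nat.mul_le_mul_right _ a.2
  rw [Nat.succ_mul] at ha
  rw [readBits_ofMem (by omega)]
  funext t
  rw [setMem_of_ge _ _ (by omega), runT_finalProg hi hready]

end Input
end Parts

/-! ### The machine for a given scheme -/

theorem Efficient.comp {C : ℕ → ℕ → NandCircuit} (hC : Efficient C) {k : ℕ} {a b : (Fin k → ℕ) → ℕ}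
    (ha : PolyTime a) (hb : PolyTime b) : NandCircuit.Uniform fun v => C (a v) (b v) :=
  NandCircuit.Uniform.comp hC (g := fun i v => ![a v, b v] i) fun i => by
    fin_cases i
    · exact ha
    · exact hb

/-- The parts of the machine for the level `i`, where `U` are the circuits for the Pauli key update. -/
abbrev machineParts {S : LeveledScheme} (A : AltScheme S) (U : Fin 4 → ℕ → NandCircuit)
    (lam L ℓ i : ℕ) : Parts where
  lvl := ℓ
  idx := i
  pkL := S.pkLen lam L
  evkL := S.evkLen lam L
  skL := S.skLen lam L
  tdL := S.tdLen lam L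
  ctL := S.ctLen lam L
  encCoins := S.encCoins lam L
  r := A.rLen lam L
  altL := A.ctLen lam L
  evalCoins a := S.evalCoins lam L (A.updateInputs lam L) (U a lam).length
  conv := A.convertC lam L
  alt := A.encC lam L
  xor := A.xorC lam L
  enc := S.encC lam L
  ev a := S.evalC lam L (A.updateInputs lam L) (U a lam).length
  upd a := U a lam
  prep := A.prepC lam L

theorem AltScheme.updateInputs_polyTime {S : LeveledScheme} (A : AltScheme S) {k : ℕ}
    {a b : (Fin k → ℕ) → ℕ} (ha : PolyTime a) (hb : PolyTime b) :
    PolyTime fun v => A.updateInputs (a v) (b v) :=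
  ((((((S.pkLen_poly.comp₂ ha hb).add (S.skLen_poly.comp₂ ha hb)).add
    (S.tdLen_poly.comp₂ ha hb)).add ((PolyTime.const 4).mul (S.ctLen_poly.comp₂ ha hb))).add
    (A.ctLen_poly.comp₂ ha hb)).add (A.ctLen_poly.comp₂ ha hb)).add (A.rLen_poly.comp₂ ha hb).succ

theorem machineParts_uniform {S : LeveledScheme} (A : AltScheme S) {U : Fin 4 → ℕ → NandCircuit}
    (hU : ∀ a, NandCircuit.Uniform fun v : Fin 1 → ℕ => U a (v 0)) {k : ℕ}
    {lam L ℓ i : (Fin k → ℕ) → ℕ} (hlam : PolyTime lam) (hL : PolyTime L) (hℓ : PolyTime ℓ)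
    (hi : PolyTime i) : Parts.Uniform fun v => machineParts A U (lam v) (L v) (ℓ v) (i v) := by
  have hU' : ∀ a, NandCircuit.Uniform fun v => U a (lam v) := fun a =>
    (hU a).comp (g := fun _ v => lam v) fun _ => hlam
  have hl := A.updateInputs_polyTime hlam hL
  have hev : ∀ (a : Fin 4) (j : Fin 4), PolyTime fun v =>
      ![lam v, L v, A.updateInputs (lam v) (L v), (U a (lam v)).length] j := fun a j => by
    fin_cases j
    · exact hlam
    · exact hL
    · exact hl
    · exact (hU' a).1
  exact
    { lvl := hℓ
      idx := hi
      pkL := S.pkLen_poly.comp₂ hlam hL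
      evkL := S.evkLen_poly.comp₂ hlam hL
      skL := S.skLen_poly.comp₂ hlam hL
      tdL := S.tdLen_poly.comp₂ hlam hL
      ctL := S.ctLen_poly.comp₂ hlam hL
      encCoins := S.encCoins_poly.comp₂ hlam hL
      r := A.rLen_poly.comp₂ hlam hL
      altL := A.ctLen_poly.comp₂ hlam hL
      evalCoins := fun a => S.evalCoins_poly.comp (hev a)
      conv := A.convertC_eff.comp hlam hL
      alt := A.encC_eff.comp hlam hL
      xor := A.xorC_eff.comp hlam hL
      enc := S.encC_eff.comp hlam hL
      ev := fun a => S.evalC_eff.comp (hev a)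
      upd := hU'
      prep := A.prepC_eff.comp (g := fun j v => ![lam v, L v] j) fun j => by
        fin_cases j
        · exact hlam
        · exact hL }

/-! ### The input of the machine -/

theorem HoldsAt.of_eq {m : ℕ → Bool} {f g : ℕ → ℕ} {x : List Bool} (h : HoldsAt m f x)
    (hfg : ∀ j, g j = f j) : HoldsAt m g x := fun j hj => by rw [hfg, h j hj]

section Input

variable {S : LeveledScheme} {lam L ℓ : ℕ}

/-- The part of the evaluation key that belongs to the transition to the level `i + 1`. -/
def levelKey (ω : QCoins S lam L ℓ) (i : Fin ℓ) : List Bool :=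
  List.ofFn (ω.keys i.succ).pk ++
    (List.ofFn fun j => List.ofFn
      (S.enc (ω.keys i.succ).pk ((ω.keys i.castSucc).sk j) (ω.2.1 i j))).flatten ++
    (List.ofFn fun j => List.ofFn
      (S.enc (ω.keys i.succ).pk ((ω.keys i.castSucc).td j) (ω.2.2 i j))).flatten

theorem evk_eq (ω : QCoins S lam L ℓ) : ω.evk =
    (List.ofFn fun i : Fin (ℓ + 1) => List.ofFn (ω.keys i).evk).flatten ++
      (List.ofFn (levelKey ω)).flatten := rfl

theorem flatten_ofFn_length {n len : ℕ} (x : Fin n → List Bool) (h : ∀ i, (x i).length = len) :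
    (List.ofFn x).flatten.length = n * len := by
  rw [flatten_length (len := len) (fun l hl => by
    obtain ⟨i, rfl⟩ := (List.mem_ofFn' x l).1 hl; exact h i), List.length_ofFn]

theorem levelKey_length (ω : QCoins S lam L ℓ) (i : Fin ℓ) : (levelKey ω i).length =
    S.pkLen lam L + S.skLen lam L * S.ctLen lam L + S.tdLen lam L * S.ctLen lam L := by
  rw [levelKey, List.length_append, List.length_append, List.length_ofFn,
    flatten_ofFn_length _ fun _ => List.length_ofFn, flatten_ofFn_length _ fun _ => List.length_ofFn]

/-- What the machine for the level `i` uses of its classical input. -/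
def machineInput (A : AltScheme S) (U : Fin 4 → ℕ → NandCircuit) (ω : QCoins S lam L ℓ) (i : Fin ℓ)
    (c : Bits (S.ctLen lam L)) (czx : KeyCts S lam L) : (machineParts A U lam L ℓ i).Input where
  pk := (ω.keys i.castSucc).pk
  pk' := (ω.keys i.succ).pk
  evk' := (ω.keys i.succ).evk
  keyCt := Fin.append
    (fun j => S.enc (ω.keys i.succ).pk ((ω.keys i.castSucc).sk j) (ω.2.1 i j))
    (fun j => S.enc (ω.keys i.succ).pk ((ω.keys i.castSucc).td j) (ω.2.2 i j))
  c := c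
  cz := czx

/-- The classical input of the machine. -/
def classicalInput (ω : QCoins S lam L ℓ) (c : Bits (S.ctLen lam L)) (czx : KeyCts S lam L) :
    List Bool :=
  ω.pk ++ ω.evk ++ List.ofFn c ++ (List.ofFn fun j => List.ofFn (czx j)).flatten

variable (A : AltScheme S) (U : Fin 4 → ℕ → NandCircuit) (ω : QCoins S lam L ℓ) (i : Fin ℓ)
    (c : Bits (S.ctLen lam L)) (czx : KeyCts S lam L)

theorem keyCt_castAdd (t : Fin (S.skLen lam L)) :
    (machineInput A U ω i c czx).keyCt (Fin.castAdd (S.tdLen lam L) t) =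
      S.enc (ω.keys i.succ).pk ((ω.keys i.castSucc).sk t) (ω.2.1 i t) :=
  Fin.append_left (fun j => S.enc (ω.keys i.succ).pk ((ω.keys i.castSucc).sk j) (ω.2.1 i j))
    (fun j => S.enc (ω.keys i.succ).pk ((ω.keys i.castSucc).td j) (ω.2.2 i j)) t

theorem keyCt_natAdd (t : Fin (S.tdLen lam L)) :
    (machineInput A U ω i c czx).keyCt (Fin.natAdd (S.skLen lam L) t) =
      S.enc (ω.keys i.succ).pk ((ω.keys i.castSucc).td t) (ω.2.2 i t) :=
  Fin.append_right (fun j => S.enc (ω.keys i.succ).pk ((ω.keys i.castSucc).sk j) (ω.2.1 i j))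
    (fun j => S.enc (ω.keys i.succ).pk ((ω.keys i.castSucc).td j) (ω.2.2 i j)) t

theorem classicalInput_length :
    2 + (classicalInput ω c czx).length = (machineParts A U lam L ℓ i).blank := by
  rw [classicalInput, evk_eq, QCoins.pk]
  simp only [List.length_append, List.length_ofFn]
  rw [flatten_ofFn_length _ fun _ => List.length_ofFn, flatten_ofFn_length _ (levelKey_length ω),
    flatten_ofFn_length _ fun _ => List.length_ofFn]
  simp only [Parts.blank, Parts.czPos, Parts.cPos, Parts.lvlPos, Parts.levelLen]
  omega

theorem holdsIn_classicalInput :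
    (machineInput A U ω i c czx).HoldsIn (inputMem (classicalInput ω c czx)) := by
  have h := holdsAt_inputMem (classicalInput ω c czx)
  generalize inputMem (classicalInput ω c czx) = m at h
  rw [classicalInput, HoldsAt.append_iff, HoldsAt.append_iff, HoldsAt.append_iff, evk_eq,
    HoldsAt.append_iff, HoldsAt.flatten_iff (fun _ => List.length_ofFn),
    HoldsAt.flatten_iff (levelKey_length ω)] at h
  obtain ⟨⟨⟨h1, h2, h3⟩, h4⟩, h5⟩ := h
  simp only [List.length_append, List.length_ofFn, QCoins.pk,
    flatten_ofFn_length _ fun i : Fin (ℓ + 1) => List.length_ofFn (f := (ω.keys i).evk),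
    flatten_ofFn_length _ (levelKey_length ω)] at h2 h3 h4 h5
  set bl := S.pkLen lam L + S.skLen lam L * S.ctLen lam L + S.tdLen lam L * S.ctLen lam L with hbl
  have hblock : ∀ i : Fin ℓ,
      HoldsAt m (fun j => (machineParts A U lam L ℓ i).pkNext + j) (List.ofFn (ω.keys i.succ).pk) ∧
      (∀ t : Fin (S.skLen lam L), HoldsAt m
        (fun j => (machineParts A U lam L ℓ i).skPos + t * S.ctLen lam L + j)
        (List.ofFn (S.enc (ω.keys i.succ).pk ((ω.keys i.castSucc).sk t) (ω.2.1 i t)))) ∧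
      ∀ t : Fin (S.tdLen lam L), HoldsAt m
        (fun j => (machineParts A U lam L ℓ i).skPos + (S.skLen lam L + t) * S.ctLen lam L + j)
        (List.ofFn (S.enc (ω.keys i.succ).pk ((ω.keys i.castSucc).td t) (ω.2.2 i t))) := by
    intro i
    have := h3 i
    rw [levelKey, HoldsAt.append_iff, HoldsAt.append_iff,
      HoldsAt.flatten_iff (fun _ => List.length_ofFn),
      HoldsAt.flatten_iff (fun _ => List.length_ofFn)] at this
    obtain ⟨⟨g1, g2⟩, g3⟩ := this
    simp only [List.length_append, List.length_ofFn,
      flatten_ofFn_length _ fun t : Fin (S.skLen lam L) => List.length_ofFn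
        (f := S.enc (ω.keys i.succ).pk ((ω.keys i.castSucc).sk t) (ω.2.1 i t))] at g2 g3
    refine ⟨g1.of_eq fun j => ?_, fun t => (g2 t).of_eq fun j => ?_, fun t => (g3 t).of_eq fun j => ?_⟩ <;>
    · simp only [Parts.skPos, Parts.pkNext, Parts.lvlPos, Parts.levelLen, ← hbl]
      ring
  refine ⟨?_, (hblock i).1, ?_, ?_, ?_, ?_⟩
  · change HoldsAt m _ (List.ofFn (ω.keys i.castSucc).pk)
    simp only [Parts.pkPos]
    by_cases h0 : (i : ℕ) = 0
    · rw [if_pos h0]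
      have : i.castSucc = 0 := Fin.ext h0
      rw [this]
      exact h1
    · rw [if_neg h0]
      have h6 := (hblock ⟨i - 1, by omega⟩).1
      have : (⟨i - 1, by omega⟩ : Fin ℓ).succ = i.castSucc := Fin.ext (by simp; omega)
      rw [this] at h6
      exact h6
  · refine (h2 i.succ).of_eq fun j => ?_
    simp only [Parts.evkNext, Fin.val_succ]
    ring
  · intro t
    obtain ⟨t, rfl⟩ : ∃ t' : Fin (S.skLen lam L + S.tdLen lam L), t' = t := ⟨t, rfl⟩
    refine Fin.addCases (fun t => ?_) (fun t => ?_) t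
    · rw [keyCt_castAdd]
      exact (hblock i).2.1 t
    · rw [keyCt_natAdd]
      exact (hblock i).2.2 t
  · refine h4.of_eq fun j => ?_
    simp only [Parts.cPos, Parts.lvlPos, Parts.levelLen, ← hbl]
    ring
  · refine h5.of_eq fun j => ?_
    simp only [Parts.czPos, Parts.cPos, Parts.lvlPos, Parts.levelLen, ← hbl]
    ring

end Input

/-! ### Correctness of the machine -/

section Correctness

variable {S : LeveledScheme} {lam L ℓ : ℕ} (A : AltScheme S) (U : Fin 4 → ℕ → NandCircuit)
  (ω : QCoins S lam L ℓ) (i : Fin ℓ) (c : Bits (S.ctLen lam L)) (czx : KeyCts S lam L)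

/-- The encryptions of the secret key and of the trapdoor of the level `i` decrypt correctly. -/
def KeyCtsCorrect (ω : QCoins S lam L ℓ) (i : Fin ℓ) : Prop :=
  (∀ j, S.dec (ω.keys i.succ).sk
    (S.enc (ω.keys i.succ).pk ((ω.keys i.castSucc).sk j) (ω.2.1 i j)) = (ω.keys i.castSucc).sk j) ∧
  ∀ j, S.dec (ω.keys i.succ).sk
    (S.enc (ω.keys i.succ).pk ((ω.keys i.castSucc).td j) (ω.2.2 i j)) = (ω.keys i.castSucc).td j

/-- The inputs of the Pauli key update for the level `i`. -/
def updateInput (y : Bits (A.ctLen lam L)) (d : Bits (A.rLen lam L + 1)) : List Bool :=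
  (machineInput A U ω i c czx).updInputs
    (Fin.append (ω.keys i.castSucc).sk (ω.keys i.castSucc).td) y d

variable {ω i}

/-- Every input of the homomorphic evaluation is a fresh encryption. Hence the results are possible
ciphertexts of the next level, whatever the coins are. -/
theorem exists_cts_eq_enc (y : Bits (A.ctLen lam L)) (d : Bits (A.rLen lam L + 1))
    (coins : Bits (machineParts A U lam L ℓ i).coins) (q : ℕ) :
    ∃ μ r, (machineInput A U ω i c czx).cts y d coins q = S.enc (ω.keys i.succ).pk μ r := by
  unfold Parts.Input.cts
  split_ifs with h
  · have : ∀ t : Fin (S.skLen lam L + S.tdLen lam L), ∃ μ r,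
        (machineInput A U ω i c czx).keyCt t = S.enc (ω.keys i.succ).pk μ r := by
      refine Fin.addCases (fun t => ?_) fun t => ?_
      · exact ⟨_, _, keyCt_castAdd A U ω i c czx t⟩
      · exact ⟨_, _, keyCt_natAdd A U ω i c czx t⟩
    exact this _
  · exact ⟨_, _, rfl⟩

/-- The inputs of the homomorphic evaluation decrypt to those of the Pauli key update: for the secret key and
trapdoor by assumption, and for the others with high probability over the coins. -/
theorem le_uprob_dec_cts {ε : ℝ} (hε : 0 ≤ ε) (hk : S.CorrectKeys (ω.keys i.succ) ε)
    (hkey : KeyCtsCorrect ω i) (y : Bits (A.ctLen lam L)) (d : Bits (A.rLen lam L + 1)) {q : ℕ}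
    (hq : q < A.updateInputs lam L) :
    1 - ε ≤ uprob fun coins : Bits (machineParts A U lam L ℓ i).coins =>
      S.dec (ω.keys i.succ).sk ((machineInput A U ω i c czx).cts y d coins q) =
        (updateInput A U ω i c czx y d).getD q false := by
  by_cases h : S.pkLen lam L ≤ q ∧ q < S.pkLen lam L + S.skLen lam L + S.tdLen lam L
  · rw [uprob_of_forall]
    · linarith
    · intro coins
      obtain ⟨t, ht⟩ := Nat.exists_eq_add_of_le h.1
      have htlt : t < S.skLen lam L + S.tdLen lam L := by omega
      have h1 : (machineInput A U ω i c czx).cts y d coins q =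
          (machineInput A U ω i c czx).keyCt ⟨t, htlt⟩ := by
        unfold Parts.Input.cts
        rw [dif_pos h]
        congr 2
        simp only
        omega
      have h2 : (updateInput A U ω i c czx y d).getD q false =
          Fin.append (ω.keys i.castSucc).sk (ω.keys i.castSucc).td ⟨t, htlt⟩ := by
        rw [ht]
        exact Parts.Input.updInputs_getD_add (I := machineInput A U ω i c czx) _ y d ⟨t, htlt⟩
      rw [h1, h2]
      generalize (⟨t, htlt⟩ : Fin (S.skLen lam L + S.tdLen lam L)) = t
      refine Fin.addCases (fun t => ?_) (fun t => ?_) t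
      · rw [keyCt_castAdd, Fin.append_left]
        exact hkey.1 t
      · rw [keyCt_natAdd, Fin.append_right]
        exact hkey.2 t
  · have h1 := (machineParts A U lam L ℓ i).mul_encCoins_le hq
    have h2 := (machineParts A U lam L ℓ i).positions
    refine le_uprob_readBits (n := S.encCoins lam L) (off := q * S.encCoins lam L) (by
      change q * S.encCoins lam L + S.encCoins lam L ≤ _ at h1
      omega) fun b => (hk.1 ((updateInput A U ω i c czx y d).getD q false)).trans
      (uprob_mono fun r hr => ?_)
    rw [Parts.Input.cts, dif_neg h]
    have h3 : ((machineInput A U ω i c czx).bits y d).getD q false =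
        (updateInput A U ω i c czx y d).getD q false :=
      Parts.Input.updInputs_getD_of_not_mem (I := machineInput A U ω i c czx) _ _ y d
        (by simp only; omega)
    have h4 : readBits (setBits b (q * S.encCoins lam L) r) (q * S.encCoins lam L) (S.encCoins lam L) =
        r := readBits_setBits _ _ _ (by
      change q * S.encCoins lam L + S.encCoins lam L ≤ _ at h1
      omega)
    rw [h3, h4]
    exact hr

/-- Homomorphic evaluation is correct with high probability over its coins, for all coins of the encryptions. -/
theorem le_uprob_dec_result {ε : ℝ} (hk : S.CorrectKeys (ω.keys i.succ) ε)
    (hU : ∀ a, LeveledScheme.IsDepth L (A.updateInputs lam L) (U a lam))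
    (y : Bits (A.ctLen lam L)) (d : Bits (A.rLen lam L + 1)) (a : Fin 4) :
    1 - ε ≤ uprob fun coins : Bits (machineParts A U lam L ℓ i).coins =>
      S.dec (ω.keys i.succ).sk ((machineInput A U ω i c czx).result y d coins a) =
        (U a lam).outBit (List.ofFn fun q : Fin (A.updateInputs lam L) =>
          S.dec (ω.keys i.succ).sk ((machineInput A U ω i c czx).cts y d coins q)) := by
  refine le_uprob_readBits (Parts.Input.evalCoins_bound a) fun b => ?_
  choose μ r hμ using fun q : Fin (A.updateInputs lam L) =>
    exists_cts_eq_enc A U (ω := ω) c czx y d b q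
  refine (hk.2 _ (U a lam) μ r (hU a)).trans (uprob_mono fun r' h => ?_)
  have hcts : ∀ q : Fin (A.updateInputs lam L), (machineInput A U ω i c czx).cts y d
      (setBits b ((machineParts A U lam L ℓ i).updIn * (machineParts A U lam L ℓ i).encCoins +
        a * (machineParts A U lam L ℓ i).evalW) r') q = S.enc (ω.keys i.succ).pk (μ q) (r q) :=
    fun q => ((machineInput A U ω i c czx).cts_setBits y d b r' (Nat.le_add_right _ _) q.2).trans (hμ q)
  have hres := (machineInput A U ω i c czx).result_setBits y d b a r'
  rw [hres]
  simp only [hcts]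
  refine Eq.trans ?_ h
  congr 2
  simp only [← hμ]
  rfl

/-- The results decrypt to the updated Pauli keys. -/
theorem le_uprob_results {ε : ℝ} (hε : 0 ≤ ε) (hk : S.CorrectKeys (ω.keys i.succ) ε)
    (hkey : KeyCtsCorrect ω i) (hU : ∀ a, LeveledScheme.IsDepth L (A.updateInputs lam L) (U a lam))
    (y : Bits (A.ctLen lam L)) (d : Bits (A.rLen lam L + 1)) :
    1 - (A.updateInputs lam L + 4) * ε ≤
      uprob fun coins : Bits (machineParts A U lam L ℓ i).coins => ∀ a,
        S.dec (ω.keys i.succ).sk ((machineInput A U ω i c czx).result y d coins a) =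
          (U a lam).outBit (updateInput A U ω i c czx y d) := by
  have h1 := le_uprob_forall fun q : Fin (A.updateInputs lam L) =>
    le_uprob_dec_cts A U c czx hε hk hkey y d q.2
  have h2 := le_uprob_forall fun a : Fin 4 => le_uprob_dec_result A U c czx hk hU y d a
  have h3 := le_uprob_and h1 h2
  refine le_trans (le_of_eq (by push_cast; ring)) (h3.trans (uprob_mono fun coins h a => ?_))
  rw [h.2 a]
  congr 1
  have hlen : (updateInput A U ω i c czx y d).length = A.updateInputs lam L :=
    Parts.Input.updInputs_length (I := machineInput A U ω i c czx) _ y d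
  refine List.ext_getElem (by rw [List.length_ofFn, hlen]) fun q hq hq' => ?_
  rw [List.getElem_ofFn, h.1 ⟨q, by rwa [List.length_ofFn] at hq⟩, List.getD_eq_getElem _ _ hq']

/-- The circuits `U` compute the Pauli key update, by assumption. -/
theorem outBit_updateInput {U : Fin 4 → ℕ → NandCircuit} {a : Fin 4}
    (hU : ∀ (pk : Bits (S.pkLen lam L)) (sk : Bits (S.skLen lam L)) (td : Bits (S.tdLen lam L))
      (c : Fin 4 → Bits (S.ctLen lam L)) (chat y : Bits (A.ctLen lam L)) (d : Bits (A.rLen lam L + 1)),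
      (U a lam).outBit (List.ofFn pk ++ List.ofFn sk ++ List.ofFn td ++
        (List.ofFn fun j => List.ofFn (c j)).flatten ++ List.ofFn chat ++ List.ofFn y ++ List.ofFn d) =
        A.pauliUpdate pk sk td c chat y d a)
    (y : Bits (A.ctLen lam L)) (d : Bits (A.rLen lam L + 1)) :
    (U a lam).outBit (updateInput A U ω i c czx y d) =
      A.pauliUpdate (ω.keys i.castSucc).pk (ω.keys i.castSucc).sk (ω.keys i.castSucc).td czx
        (A.convert (ω.keys i.castSucc).pk c) y d a := by
  rw [← hU, updateInput, Parts.Input.updInputs, List.ofFn_fin_append, ← List.append_assoc]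
  rfl

end Correctness

/-! ### Correctness for good keys -/

section GoodKeys

variable {S : LeveledScheme} {lam L ℓ : ℕ} {A : AltScheme S} {U : Fin 4 → ℕ → NandCircuit}
  {ω : QCoins S lam L ℓ} {i : Fin ℓ}

/-- The inversion of the two ways of encrypting: without and with the homomorphic shift. -/
def invert (A : AltScheme S) (k : Keys S lam L) (c : Bits (S.ctLen lam L)) (a : Bool)
    (y : Bits (A.ctLen lam L)) : Bits (A.rLen lam L + 1) :=
  A.recover k.pk k.sk k.td (if a then A.hxorInv k.pk y (A.convert k.pk c) else y)

/-- A quantum capable scheme handles nearly all messages correctly, in both ways of encrypting. The three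
sources of failure are recovery, decryption and the homomorphic shift. -/
theorem le_dprob_correct {ε : ℝ} (hk : A.CapableKeys (ω.keys i.castSucc) ε)
    {c : Bits (S.ctLen lam L)} (hc : S.Occurs (ω.keys i.castSucc) c) (czx : KeyCts S lam L) (a : Bool) :
    1 - 3 * ε ≤ dprob (A.D lam L (ω.keys i.castSucc).pk)
      (Correct (machineInput A U ω i c czx).cipher (invert A (ω.keys i.castSucc) c) (fun m => m 0)
        (A.dec (ω.keys i.castSucc).sk) (S.dec (ω.keys i.castSucc).sk c) a) := by
  obtain ⟨hD, hD1⟩ := A.D_mem lam L (ω.keys i.castSucc).pk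
  have h := le_dprob_and hD hD1 hk.recover_enc (le_dprob_and hD hD1 hk.dec_enc (hk.hxor_dec c hc))
  refine le_trans (by linarith) (h.trans (dprob_mono hD fun m hm hmc => ?_))
  obtain ⟨h1, h2, h3⟩ := hmc
  cases a
  · refine ⟨h1, ?_⟩
    rw [Bool.false_and, Bool.xor_false]
    exact h2
  · refine ⟨(congrArg (A.recover _ _ _) (hk.hxor_inv c hc m hm)).trans h1, ?_⟩
    rw [Bool.true_and, ← hk.convert_dec c hc]
    refine Eq.trans h3 ?_
    rw [h2]

/-- For good keys, the machine works. -/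
theorem machine_correct {ε : ℝ} (hε0 : 0 ≤ ε) (hε1 : ε ≤ 1)
    (hcap : A.CapableKeys (ω.keys i.castSucc) ε) (hcor : S.CorrectKeys (ω.keys i.succ) ε)
    (hkey : KeyCtsCorrect ω i)
    (hdepth : ∀ a, LeveledScheme.IsDepth L (A.updateInputs lam L) (U a lam))
    (hU : ∀ a (pk : Bits (S.pkLen lam L)) (sk : Bits (S.skLen lam L)) (td : Bits (S.tdLen lam L))
      (c : Fin 4 → Bits (S.ctLen lam L)) (chat y : Bits (A.ctLen lam L)) (d : Bits (A.rLen lam L + 1)),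
      (U a lam).outBit (List.ofFn pk ++ List.ofFn sk ++ List.ofFn td ++
        (List.ofFn fun j => List.ofFn (c j)).flatten ++ List.ofFn chat ++ List.ofFn y ++ List.ofFn d) =
        A.pauliUpdate pk sk td c chat y d a)
    {z x : Bits 2} {ψ : Bits 2 → ℂ} {c : Bits (S.ctLen lam L)} {czx : KeyCts S lam L}
    (hψ : ∑ b, ‖ψ b‖ ^ 2 = 1) (hc : S.Occurs (ω.keys i.castSucc) c)
    (hczx : ∀ j, S.dec (ω.keys i.castSucc).sk (czx j) = ![z 0, z 1, x 0, x 1] j)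
    {ρ : KeyCts S lam L → Matrix (Bits 2) (Bits 2) ℂ}
    (hρ : ρ = outState ((machineParts A U lam L ℓ i).machine.run
      (withInput ((pauli z x).mulVec ψ) (classicalInput ω c czx)))) :
    ∃ z' x' : KeyCts S lam L → Bits 2,
      (∀ o, ρ o ≠ 0 → ∀ j, S.Occurs (ω.keys i.succ) (o j)) ∧
      (∀ o, ρ o ≠ 0 → ∀ j,
        S.dec (ω.keys i.succ).sk (o j) = ![z' o 0, z' o 1, x' o 0, x' o 1] j) ∧
      traceDist (Matrix.blockDiagonal ρ)
        (Matrix.blockDiagonal fun o => (ρ o).trace • pure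
          ((cnot ^ (S.dec (ω.keys i.castSucc).sk c).toNat * pauli (z' o) (x' o)).mulVec ψ)) ≤
        2 * √(1020 * ε + 18 * ((A.updateInputs lam L + 4) * ε)) := by
  have hρ' := fun o => (machineInput A U ω i c czx).reduced_machine i.2
    (classicalInput_length A U ω i c czx) (holdsIn_classicalInput A U ω i c czx)
    ((pauli z x).mulVec ψ) o
  have hρ'' : ∀ o b b', ρ o b b' = _ := fun o b b' => (by rw [hρ]; rfl : ρ o b b' = _).trans (hρ' o b b')
  refine ⟨fun o => ![S.dec (ω.keys i.succ).sk (o 0), S.dec (ω.keys i.succ).sk (o 1)],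
    fun o => ![S.dec (ω.keys i.succ).sk (o 2), S.dec (ω.keys i.succ).sk (o 3)],
    fun o ho j => ?_, fun o _ j => by fin_cases j <;> rfl, ?_⟩
  · -- an outcome with nonzero probability is the result for some measured values and coins
    obtain ⟨κ, hκ⟩ : ∃ κ : (Bits ((machineParts A U lam L ℓ i).prepW -
        ((machineParts A U lam L ℓ i).r + 1)) × Bits (A.ctLen lam L) × Bits (A.rLen lam L + 1)) ×
        Bits (machineParts A U lam L ℓ i).coins,
        (machineInput A U ω i c czx).result κ.1.2.1 κ.1.2.2 κ.2 = o := by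
      by_contra hne
      push Not at hne
      refine ho (Matrix.ext fun b b' => ?_)
      rw [hρ'']
      exact Finset.sum_eq_zero fun κ _ => if_neg (hne κ)
    rw [← hκ]
    choose μ r hμ using exists_cts_eq_enc A U (ω := ω) (i := i) c czx κ.1.2.1 κ.1.2.2 κ.2
    refine ⟨A.updateInputs lam L, U j lam, fun q => μ q, fun q => r q,
      readBits κ.2 ((machineParts A U lam L ℓ i).updIn * (machineParts A U lam L ℓ i).encCoins +
        j * (machineParts A U lam L ℓ i).evalW) _, hdepth j, ?_⟩
    simp only [← hμ]
    rfl
  · obtain ⟨hD, hD1⟩ := A.D_mem lam L (ω.keys i.castSucc).pk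
    refine traceDist_encryptedCnot_le hD hD1 hε0 hε1
      (fun a => le_dprob_correct (U := U) hcap hc czx a) (hcap.shift c hc)
      (fun x y => ?_) hcap.prep hψ z x
      (κ := ((((Real.sqrt 2 : ℝ) : ℂ)⁻¹) ^ (machineParts A U lam L ℓ i).coins)) ?_
      (C := Bits (machineParts A U lam L ℓ i).coins)
      (out := fun p c' => (machineInput A U ω i c czx).result p.2.1 p.2.2 c')
      (by positivity) (fun g y d => ?_) hρ''
    · rw [reduced_run_ket, reduced_true]
      rfl
    · rw [norm_pow, norm_inv, Complex.norm_real, Real.norm_eq_abs, abs_of_nonneg (Real.sqrt_nonneg _),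
        ← pow_mul, mul_comm _ 2, pow_mul, inv_pow, Real.sq_sqrt (by norm_num), Fintype.card_fun,
        Fintype.card_bool, Fintype.card_fin]
      push_cast
      rw [← mul_pow]
      norm_num
    · refine (le_uprob_results A U c czx hε0 hcor hkey hdepth y d).trans (uprob_mono fun coins h => ?_)
      have h' : ∀ a, S.dec (ω.keys i.succ).sk ((machineInput A U ω i c czx).result y d coins a) =
          A.pauliUpdate (ω.keys i.castSucc).pk (ω.keys i.castSucc).sk (ω.keys i.castSucc).td czx
            (A.convert (ω.keys i.castSucc).pk c) y d a := fun a =>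
        (h a).trans (outBit_updateInput A c czx (hU a) y d)
      simp only [h', AltScheme.pauliUpdate, hczx]
      rfl

end GoodKeys

/-! ### Random keys -/

section KeyGeneration

variable {S : LeveledScheme} {lam L ℓ : ℕ}

theorem CapableKeys.mono {A : AltScheme S} {k : Keys S lam L} {ε δ : ℝ} (h : A.CapableKeys k ε)
    (hεδ : ε ≤ δ) : A.CapableKeys k δ where
  prep := h.prep.trans hεδ
  dec_enc := (by linarith : 1 - δ ≤ 1 - ε).trans h.dec_enc
  recover_enc := (by linarith : 1 - δ ≤ 1 - ε).trans h.recover_enc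
  convert_dec := h.convert_dec
  hxor_dec := fun c hc => (by linarith : 1 - δ ≤ 1 - ε).trans (h.hxor_dec c hc)
  hxor_inv := h.hxor_inv
  shift := fun c hc => (h.shift c hc).trans hεδ

theorem CorrectKeys.mono {k : Keys S lam L} {ε δ : ℝ} (h : S.CorrectKeys k ε) (hεδ : ε ≤ δ) :
    S.CorrectKeys k δ :=
  ⟨fun μ => (by linarith : 1 - δ ≤ 1 - ε).trans (h.1 μ),
    fun l f μ r hf => (by linarith : 1 - δ ≤ 1 - ε).trans (h.2 l f μ r hf)⟩

/-- The keys of a level are distributed as a single key generation. -/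
theorem le_uprob_keys {P : Keys S lam L → Prop} {ε : ℝ} (j : Fin (ℓ + 1))
    (h : 1 - ε ≤ uprob fun r : Bits (S.genCoins lam L) => P (S.keyGen r)) :
    1 - ε ≤ uprob fun ω : QCoins S lam L ℓ => P (ω.keys j) :=
  le_uprob_of_part (fun ω => ω.1 j) (fun ω r => (Function.update ω.1 j r, ω.2))
    (fun ω r => Function.update_self ..) (fun ω => by simp) (fun ω r r' => by simp) fun ω => by
      simpa [QCoins.keys] using h

/-- A fresh encryption of a bit that depends only on the keys decrypts correctly, if the keys are
correct. The coins of the encryption are described by how to read and how to replace them. -/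
theorem le_uprob_dec_enc {ε : ℝ} (hε : 0 ≤ ε) (j : Fin (ℓ + 1))
    (get : QCoins S lam L ℓ → Bits (S.encCoins lam L))
    (set : QCoins S lam L ℓ → Bits (S.encCoins lam L) → QCoins S lam L ℓ)
    (h₁ : ∀ ω r, get (set ω r) = r) (h₂ : ∀ ω, set ω (get ω) = ω)
    (h₃ : ∀ ω r r', set (set ω r) r' = set ω r') (h₄ : ∀ ω r, (set ω r).1 = ω.1)
    (b : (Fin (ℓ + 1) → Bits (S.genCoins lam L)) → Bool) :
    1 - ε ≤ uprob fun ω : QCoins S lam L ℓ => S.CorrectKeys (ω.keys j) ε →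
      S.dec (ω.keys j).sk (S.enc (ω.keys j).pk (b ω.1) (get ω)) = b ω.1 := by
  refine le_uprob_of_part get set h₁ h₂ h₃ fun ω => ?_
  have hkeys : ∀ r, (set ω r).keys = ω.keys := fun r => by
    funext j
    rw [QCoins.keys, QCoins.keys, h₄]
  simp only [h₁, h₄, hkeys]
  by_cases hk : S.CorrectKeys (ω.keys j) ε
  · exact (hk.1 _).trans (uprob_mono fun r hr _ => hr)
  · rw [uprob_of_forall fun r hk' => absurd hk' hk]
    linarith

/-- The keys of the next level are correct and decrypt the encryptions in the evaluation key: these are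
fresh encryptions of bits that were chosen independently of their coins. -/
theorem le_uprob_keyCtsCorrect {ε : ℝ} (hε : 0 ≤ ε) (i : Fin ℓ)
    (h : 1 - ε ≤ uprob fun r : Bits (S.genCoins lam L) => S.CorrectKeys (S.keyGen r) ε) :
    1 - (1 + S.skLen lam L + S.tdLen lam L) * ε ≤ uprob fun ω : QCoins S lam L ℓ =>
      S.CorrectKeys (ω.keys i.succ) ε ∧ KeyCtsCorrect ω i := by
  have h1 := fun j : Fin (S.skLen lam L) => le_uprob_dec_enc (S := S) hε i.succ (fun ω => ω.2.1 i j)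
    (fun ω r => (ω.1, Function.update ω.2.1 i (Function.update (ω.2.1 i) j r), ω.2.2))
    (fun ω r => by simp) (fun ω => by simp) (fun ω r r' => by simp) (fun ω r => rfl)
    fun κ => (S.keyGen (κ i.castSucc)).sk j
  have h2 := fun j : Fin (S.tdLen lam L) => le_uprob_dec_enc (S := S) hε i.succ (fun ω => ω.2.2 i j)
    (fun ω r => (ω.1, ω.2.1, Function.update ω.2.2 i (Function.update (ω.2.2 i) j r)))
    (fun ω r => by simp) (fun ω => by simp) (fun ω r r' => by simp) (fun ω r => rfl)
    fun κ => (S.keyGen (κ i.castSucc)).td j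
  have h3 := le_uprob_and (le_uprob_keys (P := fun k => S.CorrectKeys k ε) i.succ h)
    (le_uprob_and (le_uprob_forall h1) (le_uprob_forall h2))
  exact le_trans (by linarith) (h3.trans (uprob_mono fun ω hω =>
    ⟨hω.1, fun j => hω.2.1 j hω.1, fun j => hω.2.2 j hω.1⟩))

end KeyGeneration

end QHom

theorem mainTheorem5 (S : LeveledScheme) (A : AltScheme S) (Lc : ℕ → ℕ)
    (hLc : PolyTime fun v : Fin 1 → ℕ => Lc (v 0))
    (hS : S.HomomorphicFor Lc)
    (hA : A.QuantumCapableFor Lc)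
    (hU : A.UpdateInDepth Lc) :
    ∃ M : ℕ → ℕ → ℕ → QCircuit,
      QCircuit.Uniform (fun v : Fin 3 → ℕ => M (v 0) (v 1) (v 2)) ∧
      ∃ ν : ℕ → ℝ, Negligible ν ∧
        ∀ (lam ℓ : ℕ) (i : Fin ℓ),
          1 - ν lam ≤ uprob fun ω : QCoins S lam (Lc lam) ℓ =>
            ∀ (s : Bool) (z x : Bits 2) (ψ : Bits 2 → ℂ)
              (c : Bits (S.ctLen lam (Lc lam))) (czx : KeyCts S lam (Lc lam)),
              ∑ b, ‖ψ b‖ ^ 2 = 1 →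
              S.Occurs (ω.keys i.castSucc) c →
              S.dec (ω.keys i.castSucc).sk c = s →
              (∀ j, S.dec (ω.keys i.castSucc).sk (czx j) = ![z 0, z 1, x 0, x 1] j) →
              let input : List Bool := ω.pk ++ ω.evk ++ List.ofFn c ++
                (List.ofFn fun j => List.ofFn (czx j)).flatten
              let ρ : KeyCts S lam (Lc lam) → Matrix (Bits 2) (Bits 2) ℂ :=
                outState ((M lam ℓ i).run (withInput ((pauli z x).mulVec ψ) input))
              ∃ z' x' : KeyCts S lam (Lc lam) → Bits 2,
                (∀ o, ρ o ≠ 0 → ∀ j, S.Occurs (ω.keys i.succ) (o j)) ∧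
                (∀ o, ρ o ≠ 0 → ∀ j,
                  S.dec (ω.keys i.succ).sk (o j) = ![z' o 0, z' o 1, x' o 0, x' o 1] j) ∧
                traceDist (Matrix.blockDiagonal ρ)
                  (Matrix.blockDiagonal fun o =>
                    (ρ o).trace • pure ((cnot ^ s.toNat * pauli (z' o) (x' o)).mulVec ψ)) ≤ ν lam := by
  obtain ⟨εS, hεS, hS⟩ := hS
  obtain ⟨εA, hεA, hA⟩ := hA
  choose U hU₁ hU₂ using hU
  have hεS0 : ∀ lam, 0 ≤ εS lam := fun lam => by
    have := (hS lam).trans (uprob_le_one _)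
    linarith
  have hεA0 : ∀ lam, 0 ≤ εA lam := fun lam => by
    have := (hA lam).trans (uprob_le_one _)
    linarith
  set ε : ℕ → ℝ := fun lam => εA lam + εS lam with hεdef
  have hε : Negligible ε := hεA.add hεS
  have hε0 : ∀ lam, 0 ≤ ε lam := fun lam => add_nonneg (hεA0 lam) (hεS0 lam)
  have hlam : PolyTime fun v : Fin 1 → ℕ => v 0 := .proj 0
  refine ⟨fun lam ℓ i => (machineParts A U lam (Lc lam) ℓ i).machine,
    (machineParts_uniform A hU₁ (.proj 0) (hLc.comp₁ (.proj 0)) (.proj 1) (.proj 2)).machine,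
    fun lam => (S.skLen lam (Lc lam) + S.tdLen lam (Lc lam) + 2 : ℕ) * ε lam +
      2 * √((18 * (A.updateInputs lam (Lc lam) + 4) + 1020 : ℕ) * ε lam), ?_, fun lam ℓ i => ?_⟩
  · refine (hε.mul_polyTime (p := fun lam => S.skLen lam (Lc lam) + S.tdLen lam (Lc lam) + 2)
      ?_).add ((hε.mul_polyTime (p := fun lam => 18 * (A.updateInputs lam (Lc lam) + 4) + 1020)
        ?_).sqrt.const_mul 2)
    · exact ((S.skLen_poly.comp₂ hlam hLc).add (S.tdLen_poly.comp₂ hlam hLc)).add (.const 2)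
    · exact ((PolyTime.const 18).mul ((A.updateInputs_polyTime hlam hLc).add (.const 4))).add
        (.const 1020)
  have hsqrt := Real.sqrt_nonneg ((18 * (A.updateInputs lam (Lc lam) + 4) + 1020 : ℕ) * ε lam)
  have hcoef : ε lam ≤ (S.skLen lam (Lc lam) + S.tdLen lam (Lc lam) + 2 : ℕ) * ε lam :=
    le_mul_of_one_le_left (hε0 lam) (by push_cast; linarith)
  by_cases hε1 : ε lam ≤ 1
  · have h1 : 1 - ε lam ≤ uprob fun ω : QCoins S lam (Lc lam) ℓ =>
        A.CapableKeys (ω.keys i.castSucc) (ε lam) :=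
      le_uprob_keys (P := fun k => A.CapableKeys k (ε lam)) i.castSucc ((by linarith [hεS0 lam] : 1 - ε lam ≤ 1 - εA lam).trans
        ((hA lam).trans (uprob_mono fun r h => CapableKeys.mono h (by linarith [hεS0 lam]))))
    have h2 := le_uprob_keyCtsCorrect (hε0 lam) i
      ((by linarith [hεA0 lam] : 1 - ε lam ≤ 1 - εS lam).trans
        ((hS lam).trans (uprob_mono fun r h => CorrectKeys.mono h (by linarith [hεA0 lam]))))
    refine le_trans ?_ ((le_uprob_and h1 h2).trans (uprob_mono fun ω hω => ?_))
    · push_cast at hsqrt ⊢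
      linarith
    · rintro s z x ψ c czx hψ hc rfl hczx input ρ
      obtain ⟨z', x', hocc, hdec, hdist⟩ := machine_correct (U := U) (hε0 lam) hε1 hω.1 hω.2.1 hω.2.2
        (fun a => (hU₂ a lam).1) (fun a => (hU₂ a lam).2) hψ hc hczx (ρ := ρ) rfl
      refine ⟨z', x', hocc, hdec, hdist.trans ?_⟩
      refine le_trans (le_of_eq ?_) (le_add_of_nonneg_left ((hε0 lam).trans hcoef))
      congr 2
      push_cast
      ring
  · -- The bound is trivial.
    exact le_trans (by linarith) (uprob_nonneg _)
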